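/- Let $a < b$ be coprime positive integers and let $d$ be a divisor of $b-1$ with $1 \le d < b-1$. *Definitions.* An $a,b$-Dyck path is a lattice path of unit north and east steps from $(0,0)$ to $(b,a)$ that stays weakly above the line $y = \frac{a}{b}x$. A valley of such a path $D$ is a lattice point of $D$ immediately preceded by an east step and immediately followed by a north step. From each valley fire a laser, that is, a line segment of slope $\frac ab$ running northeast from the valley until it next meets $D$. Label the east ends of the non-terminal east steps of $D$ from left to right by $1, \dots, b-1$, each label being placed slightly below its lattice point. The set partition $\pi(D)$ of $[b-1] = \{1,\dots,b-1\}$ has $i \sim j$ if and only if the labels $i$ and $j$ are not separated by a laser. The set of $a,b$-noncrossing partitions is $\mathsf{NC}(a,b) = \{\pi(D) : D \text{ an } a,b\text{-Dyck path}\}$. The $a,b$-rank of the blocks of a partition $\pi \in \mathsf{NC}(a,b)$ is determined recursively by $$\sum_{B'} \mathrm{rank}(B') = \left\lceil (\max B - \min B + 1)\frac ab \right\rceil \quad\text{for every block } B \text{ of } \pi,$$ where the sum is over the blocks $B'$ of $\pi$ with $[\min B', \max B'] \subseteq [\min B, \max B]$. The rotation $\mathrm{rot}$ is the cyclic permutation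 $1 \mapsto 2 \mapsto \cdots \mapsto b-1 \mapsto 1$ of $[b-1]$, acting also on subsets and on set partitions of $[b-1]$. A block $B$ of a $\mathrm{rot}^d$-invariant partition is central if $\mathrm{rot}^d(B) = B$. *Statement.* Let $m_1, \dots, m_a$ be nonnegative integers with $$\frac{b-1}{d}\,(m_1 + 2m_2 + \cdots + a m_a) \le a,$$ and put $m = m_1 + \cdots + m_a$. Then $m \le d$, and the number of partitions $\pi \in \mathsf{NC}(a,b)$ that are invariant under $\mathrm{rot}^d$ and have, for each $1 \le i \le a$, exactly $m_i$ orbits of non-central blocks of $a,b$-rank $i$ under the action of $\langle \mathrm{rot}^d \rangle$, is the multinomial coefficient $$\binom{d}{m_1, \dots, m_a, d-m} = \frac{d!}{m_1! \cdots m_a!\,(d-m)!}.$$ -/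

import Mathlib

open scoped Nat

namespace RationalNC

/-- The two kinds of unit steps of a lattice path. -/
inductive Step where
  | north : Step
  | east : Step

instance : DecidableEq Step := fun s t => by
  cases s <;> cases t <;> first | exact isTrue rfl | exact isFalse (by simp)

/-- The `x`-coordinate of the lattice point reached from `(0,0)` after the first `t` steps. -/
def xCoord (w : List Step) (t : ℕ) : ℕ := (w.take t).count Step.east

/-- The `y`-coordinate of the lattice point reached from `(0,0)` after the first `t` steps. -/
def yCoord (w : List Step) (t : ℕ) : ℕ := (w.take t).count Step.north

/-- An `a,b`-Dyck path: a lattice path of north and east steps from `(0,0)` to `(b,a)` that stays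
(weakly) above the line `y = (a/b) x`. -/
structure DyckPath (a b : ℕ) where
  steps : List Step
  x_end : xCoord steps steps.length = b
  y_end : yCoord steps steps.length = a
  above : ∀ t ≤ steps.length, a * xCoord steps t ≤ b * yCoord steps t

namespace DyckPath

variable {a b : ℕ} (D : DyckPath a b)

/-- The lattice point of `D` before step number `t` is a valley: it is immediately preceded by an
east step and immediately followed by a north step. -/
def IsValley (t : ℕ) : Prop :=
  0 < t ∧ D.steps[t - 1]? = some Step.east ∧ D.steps[t]? = some Step.north

/-- Step number `s` of `D` is an east step, from `(j, h)` to `(j + 1, h)`, that meets the ray of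
slope `a/b` fired northeast from the lattice point `(i, y)` of `D` before step number `t`: the ray
is at height `h` where its abscissa is `x = i + (b/a)(h - y)`, and one asks for `j ≤ x ≤ j + 1`. -/
def Meets (t s : ℕ) : Prop :=
  D.steps[s]? = some Step.east ∧
    (a : ℤ) * ((xCoord D.steps s : ℤ) - xCoord D.steps t) ≤
      (b : ℤ) * ((yCoord D.steps s : ℤ) - yCoord D.steps t) ∧
    (b : ℤ) * ((yCoord D.steps s : ℤ) - yCoord D.steps t) ≤
      (a : ℤ) * ((xCoord D.steps s : ℤ) + 1 - xCoord D.steps t)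

/-- The laser set of `D`: the pairs `(i, j)` such that the laser fired from a valley with
`x`-coordinate `i` ends on an east step with west `x`-coordinate `j`. The laser of a valley ends
where it first meets the part of `D` after the valley; just after a valley the path `D` is above
the laser, so this happens on an east step. -/
def lasers : Set (ℕ × ℕ) :=
  {p | ∃ t s : ℕ, D.IsValley t ∧ t ≤ s ∧ D.Meets t s ∧ (∀ s', t ≤ s' → s' < s → ¬ D.Meets t s') ∧
    p = (xCoord D.steps t, xCoord D.steps s)}

/-- The visibility relation on labels. The label `k` sits slightly below the east end of the
east step that ends at `x = k`. A laser `(i, j)` runs from the lattice point at `x = i` to a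
point with `j ≤ x ≤ j + 1`, and the labels that it separates from the others are those with
`i < k ≤ j`. So two labels are related iff every laser has both or neither of them on that side. -/
def visible : Setoid ℕ where
  r k l := ∀ p ∈ D.lasers, (p.1 < k ∧ k ≤ p.2) ↔ (p.1 < l ∧ l ≤ p.2)
  iseqv :=
    ⟨fun _ _ _ => Iff.rfl, fun h p hp => (h p hp).symm, fun h h' p hp => (h p hp).trans (h' p hp)⟩

open scoped Classical in
/-- The set partition `π(D)` of `{1, …, b - 1}` into classes of mutually visible labels. -/
noncomputable def partition : Finpartition (Finset.Icc 1 (b - 1)) :=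
  Finpartition.ofSetSetoid D.visible (Finset.Icc 1 (b - 1))

end DyckPath

/-- The set `NC(a,b)` of `a,b`-noncrossing partitions of `{1, …, b - 1}`. -/
def NC (a b : ℕ) : Set (Finpartition (Finset.Icc 1 (b - 1))) :=
  Set.range (DyckPath.partition : DyckPath a b → _)

/-- The rotation `1 ↦ 2 ↦ ⋯ ↦ n ↦ 1` of `{1, …, n}`. -/
def rot (n k : ℕ) : ℕ := if k = n then 1 else k + 1

/-- The action of the `e`-th power of the rotation on subsets of `{1, …, n}`. -/
def rotBlock (n e : ℕ) (B : Finset ℕ) : Finset ℕ := B.image (rot n)^[e]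

/-- The partition `π` of `{1, …, n}` is invariant under the `e`-th power of the rotation. -/
def IsRotInvariant {n : ℕ} (e : ℕ) (π : Finpartition (Finset.Icc 1 n)) : Prop :=
  π.parts.image (rotBlock n e) = π.parts

/-- The least element of a nonempty block. -/
noncomputable def blockMin (B : Finset ℕ) : ℕ := sInf (B : Set ℕ)

/-- The greatest element of a nonempty block. -/
noncomputable def blockMax (B : Finset ℕ) : ℕ := sSup (B : Set ℕ)

/-- The interval `[min B, max B]`. -/
noncomputable def hull (B : Finset ℕ) : Finset ℕ := Finset.Icc (blockMin B) (blockMax B)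

/-- The rank of a block `B` of `π`, by recursion on the partial order
`B' ≼ B ↔ [min B', max B'] ⊆ [min B, max B]` on the blocks: the ranks of all blocks `B' ≼ B` sum to
`⌈(max B - min B + 1) a / b⌉` (see `sum_rank`). Different blocks have different minima, so the
blocks strictly below `B` are those with `[min B', max B'] ⊂ [min B, max B]`. -/
noncomputable def rank (a b : ℕ) {s : Finset ℕ} (π : Finpartition s) (B : Finset ℕ) : ℤ :=
  ⌈((blockMax B : ℚ) - (blockMin B : ℚ) + 1) * ((a : ℚ) / b)⌉ -
    ∑ B' ∈ (π.parts.filter fun B' => hull B' ⊂ hull B).attach, rank a b π B'.1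
termination_by (hull B).card
decreasing_by exact Finset.card_lt_card (Finset.mem_filter.mp B'.2).2

theorem hull_injOn {s : Finset ℕ} (π : Finpartition s) {B C : Finset ℕ} (hB : B ∈ π.parts)
    (hC : C ∈ π.parts) (h : hull B = hull C) : B = C := by
  have mem : ∀ E ∈ π.parts, blockMin E ∈ E := fun E hE => by
    have := Nat.sInf_mem (s := (E : Set ℕ)) (Finset.coe_nonempty.mpr (π.nonempty_of_mem_parts hE))
    exact_mod_cast this
  have le : ∀ E ∈ π.parts, blockMin E ≤ blockMax E := fun E hE =>
    le_csSup E.bddAbove (by exact_mod_cast mem E hE)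
  have h1 : blockMin B = blockMin C := by
    have h2 : blockMin B ∈ hull C := h ▸ Finset.left_mem_Icc.mpr (le B hB)
    have h3 : blockMin C ∈ hull B := h ▸ Finset.left_mem_Icc.mpr (le C hC)
    exact le_antisymm (Finset.mem_Icc.mp h3).1 (Finset.mem_Icc.mp h2).1
  exact π.eq_of_mem_parts hB hC (mem B hB) (h1 ▸ mem C hC)

/-- The defining property of the ranks of the blocks of a partition. -/
theorem sum_rank (a b : ℕ) {s : Finset ℕ} (π : Finpartition s) {B : Finset ℕ} (hB : B ∈ π.parts) :
    ∑ B' ∈ π.parts with hull B' ⊆ hull B, rank a b π B' =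
      ⌈((blockMax B : ℚ) - (blockMin B : ℚ) + 1) * ((a : ℚ) / b)⌉ := by
  have h : (π.parts.filter fun B' => hull B' ⊆ hull B) =
      insert B (π.parts.filter fun B' => hull B' ⊂ hull B) := by
    ext C
    simp only [Finset.mem_filter, Finset.mem_insert]
    constructor
    · rintro ⟨hC, hs⟩
      rcases hs.eq_or_ssubset with h | h
      · exact Or.inl (hull_injOn π hC hB h)
      · exact Or.inr ⟨hC, h⟩
    · rintro (rfl | ⟨hC, hs⟩)
      · exact ⟨hB, subset_rfl⟩
      · exact ⟨hC, hs.subset⟩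
  rw [h, Finset.sum_insert (by simp), rank, Finset.sum_attach _ (fun B' => rank a b π B')]
  ring

/-- A block is central if it is fixed by the `d`-th power of the rotation. -/
def IsCentral (n d : ℕ) (B : Finset ℕ) : Prop := rotBlock n d B = B

/-- The orbit of a block under the group generated by the `d`-th power of the rotation. -/
def rotOrbit (n d : ℕ) (B : Finset ℕ) : Set (Finset ℕ) := {C | ∃ k : ℕ, C = rotBlock n (d * k) B}

/-- The orbits of non-central blocks of rank `i` of the partition `π` of `{1, …, b - 1}`. -/
def orbitsOfRank (a b d : ℕ) (π : Finpartition (Finset.Icc 1 (b - 1))) (i : ℤ) :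
    Set (Set (Finset ℕ)) :=
  {O | ∃ B ∈ π.parts, ¬ IsCentral (b - 1) d B ∧ rank a b π B = i ∧ O = rotOrbit (b - 1) d B}

end RationalNC

/-! Put `n = b - 1`, let `h k` be the height of the `k`-th east step of a path, and call `b * h k -
a * k` the level at `k`. A laser fired from `i` covers `k` exactly when the level stays above its
value at `i` up to `k`. So two labels share a block iff they have the same last earlier position of
smaller level. The blocks are thus the fibres of a potential with increments `b * t x - a`, where `t
x = h x - h (x - 1)` vanishes off the block minima and equals the rank of the block at its minimum.

This picture depends on the cut between `n` and `1`. To remove the cut, extend everything to ℤ and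
weight each block by its rank. Then `NC a b` consists of the noncrossing partitions of the cycle
with positive weights of sum `a` such that the classes met strictly between consecutive elements `l
< l'` of a class have total weight less than `a * (l' - l) / b` (`Valid`). This is visibly rotation
invariant, and the weights are forced to be the ranks (`valid_of_mem_NC`, `Valid.mem_NC`). The
bridge is `Valid.fibres` and `Fibres.valid`: choose at most one start modulo `n` in each class, in a
compatible way, and let the potential put the weight of a class at its start; the gap inequalities
then correspond to the classes being the fibres of the potential.

The bridge is used twice. Starting at block minima yields the Dyck path. For a partition invariant
under `rot^d`, start a class at an element with none of its `d` predecessors in the class: by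
noncrossing, each non-central class has exactly one such element modulo `n`, and a central one has
none. The weights at the starts form a `d`-periodic sequence of total at most `a` per turn. Through
its potential the sequence determines the partition (`eq_of_seqOf_eq`), and every such sequence
occurs (`exists_seqOf_eq`): the positions without an earlier smaller potential form the central
block, which receives the missing weight. The nonzero terms of one period represent the orbits of
non-central blocks (`ncard_orbitsOfRank`), so what remains is to count words of length `d` with
given multiplicities; the hypothesis on the `m i` is the bound on the sum of such a word. -/

namespace RationalNC

/-! ### Periodic predicates on ℤ -/

section Periodic

variable {n : ℤ} {Q : ℤ → Prop}

theorem periodic_mul (hQ : ∀ x, Q (x + n) ↔ Q x) (k x : ℤ) : Q (x + k * n) ↔ Q x := by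
  induction k generalizing x with
  | zero => simp
  | succ i ih => rw [← ih x, ← hQ (x + i * n), add_mul, one_mul, add_assoc]
  | pred i ih => rw [← ih x, ← hQ, sub_mul, one_mul, add_assoc, sub_add_cancel]

/-- Applied with `Q` being membership in a class, to reach the neighbouring elements of that class
around a given position. -/
theorem exists_last_of_periodic (hn : 0 < n) (hQ : ∀ x, Q (x + n) ↔ Q x) {x₀ : ℤ} (h₀ : Q x₀)
    (z : ℤ) : ∃ l, z - n < l ∧ l ≤ z ∧ Q l ∧ ∀ x, l < x → x ≤ z → ¬ Q x := by
  have hk := periodic_mul hQ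
  obtain ⟨k, hk1, hk2⟩ : ∃ k : ℤ, z - n < x₀ + k * n ∧ x₀ + k * n ≤ z := by
    refine ⟨(z - x₀) / n, ?_, ?_⟩
    · have := Int.lt_ediv_add_one_mul_self (z - x₀) hn; linarith
    · have := Int.ediv_mul_le (z - x₀) hn.ne'; linarith
  obtain ⟨l, ⟨h1, h2⟩, h3⟩ := Int.exists_greatest_of_bdd (P := fun x => Q x ∧ x ≤ z)
    ⟨z, fun _ h => h.2⟩ ⟨_, (hk k x₀).2 h₀, hk2⟩
  refine ⟨l, lt_of_lt_of_le hk1 (h3 _ ⟨(hk k x₀).2 h₀, hk2⟩), h2, h1, fun x hx hxz hQx => ?_⟩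
  exact absurd (h3 x ⟨hQx, hxz⟩) (not_le.2 hx)

theorem exists_first_of_periodic (hn : 0 < n) (hQ : ∀ x, Q (x + n) ↔ Q x) {x₀ : ℤ} (h₀ : Q x₀)
    (z : ℤ) : ∃ l, z ≤ l ∧ l < z + n ∧ Q l ∧ ∀ x, z ≤ x → x < l → ¬ Q x := by
  obtain ⟨l, h1, h2, h3, h4⟩ := exists_last_of_periodic (Q := fun x => Q (-x)) (x₀ := -x₀) hn
    (fun x => by rw [← hQ]; ring_nf) (by simpa using h₀) (-z)
  refine ⟨-l, by linarith, by linarith, h3, fun x hx hxl hQx => h4 (-x) (by linarith)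
    (by linarith) (by simpa using hQx)⟩

end Periodic

/-- The potential `G` has increments `b t x - a`. -/
theorem potential_sub {a b : ℤ} {t G : ℤ → ℤ} (hG : ∀ x, G x = G (x - 1) + b * t x - a) {x y : ℤ}
    (hxy : x ≤ y) : G y - G x = b * ∑ i ∈ Finset.Ioc x y, t i - a * (y - x) := by
  induction y, hxy using Int.leInduction with
  | base => simp
  | succ y hy ih =>
    have h : Finset.Ioc x (y + 1) = insert (y + 1) (Finset.Ioc x y) := by
      ext i; simp only [Finset.mem_Ioc, Finset.mem_insert]; omega
    have h2 := hG (y + 1)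
    rw [add_sub_cancel_right] at h2
    rw [h, Finset.sum_insert (by simp), h2]
    linarith

/-! ### Weighted noncrossing partitions of the cycle and their potentials -/

open scoped Classical in
/-- A weighted noncrossing partition of the cycle `ℤ / n` (classes of `κ`, weights `ω`) of total
weight `a`, in which the gap between cyclically consecutive elements of a class has small weight. -/
structure Valid {ι : Type*} (a n : ℤ) (κ : ℤ → ι) (ω : ι → ℤ) : Prop where
  per : ∀ x, κ (x + n) = κ x
  noncross : ∀ x y z u, x < y → y < z → z < u → u < x + n → κ x = κ z → κ y = κ u → κ x = κ y
  pos : ∀ x, 0 < ω (κ x)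
  total : ∑ C ∈ (Finset.Ioc 0 n).image κ, ω C = a
  -- The value `l' = l + n` is allowed, so for a singleton class the gap is the rest of the cycle.
  gap : ∀ l l', l < l' → l' ≤ l + n → κ l = κ l' → (∀ y, l < y → y < l' → κ y ≠ κ l) →
    (n + 1) * ∑ C ∈ (Finset.Ioo l l').image κ, ω C < a * (l' - l)

/-- A choice of at most one starting point, modulo `n`, in each class of `κ`. -/
structure Starts {ι : Type*} (n : ℤ) (κ : ℤ → ι) (P : ℤ → Prop) : Prop where
  per : ∀ x, P (x + n) ↔ P x
  uniq : ∀ x y, P x → P y → κ x = κ y → x < y → x + n ≤ y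

/-- The classes of `κ` are the fibres of the map sending a label to the last earlier position of
smaller potential, and `P` is the set of successors of such positions. -/
structure Fibres {ι : Type*} (n : ℤ) (κ : ℤ → ι) (P : ℤ → Prop) (G : ℤ → ℤ) : Prop where
  start_lt : ∀ p y, P p → κ y = κ p → p ≤ y → y < p + n → G (p - 1) < G y
  lt_of_no_start : ∀ z y, z < y → (∀ x, z < x → x ≤ y → κ x = κ y → ¬ P x) → G y < G z

section Engine

variable {ι : Type*} {a n : ℤ} {κ : ℤ → ι} {ω : ι → ℤ} {P : ℤ → Prop} {t G : ℤ → ℤ}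

theorem image_window [DecidableEq ι] (hn : 0 < n) (hκ : ∀ x, κ (x + n) = κ x) (c : ℤ) :
    (Finset.Ico c (c + n)).image κ = (Finset.Ioc 0 n).image κ := by
  ext C
  simp only [Finset.mem_image, Finset.mem_Ico, Finset.mem_Ioc]
  constructor
  · rintro ⟨x, _, rfl⟩
    obtain ⟨l, h1, h2, h3, -⟩ := exists_first_of_periodic (Q := fun y => κ y = κ x) hn
      (fun y => by rw [hκ]) rfl 1
    exact ⟨l, ⟨by omega, by omega⟩, h3⟩
  · rintro ⟨x, _, rfl⟩
    obtain ⟨l, h1, h2, h3, -⟩ := exists_first_of_periodic (Q := fun y => κ y = κ x) hn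
      (fun y => by rw [hκ]) rfl c
    exact ⟨l, ⟨by omega, by omega⟩, h3⟩

open scoped Classical in
/-- In a window containing at most one start of each class, the sum of `t` is the total weight
of the classes that start in it. -/
theorem sum_starts (ht : ∀ x, t x = if P x then ω (κ x) else 0) (S : Finset ℤ)
    (hS : ∀ x ∈ S, ∀ y ∈ S, P x → P y → κ x = κ y → x = y) :
    ∑ x ∈ S, t x = ∑ C ∈ (S.filter P).image κ, ω C := by
  rw [Finset.sum_image, Finset.sum_filter]
  · exact Finset.sum_congr rfl fun x _ => ht x
  · intro x hx y hy h
    simp only [Finset.coe_filter, Set.mem_ofPred_eq] at hx hy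
    exact hS x hx.1 y hy.1 hx.2 hy.2 h

theorem Starts.eq_of_abs (hP : Starts n κ P) {x y : ℤ} (hx : P x) (hy : P y) (h : κ x = κ y)
    (h1 : x < y + n) (h2 : y < x + n) : x = y := by
  rcases lt_trichotomy x y with h3 | h3 | h3
  · have := hP.uniq x y hx hy h h3; omega
  · exact h3
  · have := hP.uniq y x hy hx h.symm h3; omega

open scoped Classical in
/-- A valid weighted partition with a coherent choice of starts is recovered from its potential. -/
theorem Valid.fibres (hn : 0 < n) (hV : Valid a n κ ω) (hP : Starts n κ P)
    -- Compatibility of the starts: a class seen inside a gap that is not closed by a start has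
    -- begun inside that gap.
    (hgap : ∀ l l' z, l < z → z < l' → κ l = κ l' → (∀ y, l < y → y < l' → κ y ≠ κ l) →
      ¬ P l' → ∃ p, l < p ∧ p ≤ z ∧ P p ∧ κ p = κ z)
    (ht : ∀ x, t x = if P x then ω (κ x) else 0)
    (hG : ∀ x, G x = G (x - 1) + (n + 1) * t x - a) : Fibres n κ P G := by
  classical
  have hper : ∀ C : ι, ∀ y, κ (y + n) = C ↔ κ y = C := fun C y => by rw [hV.per]
  have hsum_le : ∀ S : Finset ℤ, ∑ C ∈ (S.filter P).image κ, ω C ≤ ∑ C ∈ S.image κ, ω C := by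
    intro S
    refine Finset.sum_le_sum_of_subset_of_nonneg
      (Finset.image_subset_image (Finset.filter_subset _ _)) fun C hC _ => ?_
    obtain ⟨x, -, rfl⟩ := Finset.mem_image.1 hC
    exact (hV.pos x).le
  -- consecutive elements of a class
  have hcons : ∀ l l', l < l' → l' ≤ l + n → κ l = κ l' → (∀ y, l < y → y < l' → κ y ≠ κ l) →
      ¬ P l' → G l' < G l := by
    intro l l' h1 h2 h3 h4 h5
    -- The starts inside the gap carry at most the weight of the classes met there, and `l'` carries
    -- none, so the gap inequality makes the potential drop.
    have hg := hV.gap l l' h1 h2 h3 h4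
    have hs := potential_sub hG h1.le
    have : Finset.Ioc l l' = insert l' (Finset.Ioo l l') := by
      ext i; simp only [Finset.mem_Ioc, Finset.mem_insert, Finset.mem_Ioo]; omega
    rw [this, Finset.sum_insert (by simp), ht l', if_neg h5, zero_add, sum_starts ht] at hs
    · have := hsum_le (Finset.Ioo l l')
      have h6 : (n + 1) * ∑ C ∈ ((Finset.Ioo l l').filter P).image κ, ω C ≤
          (n + 1) * ∑ C ∈ (Finset.Ioo l l').image κ, ω C :=
        mul_le_mul_of_nonneg_left this (by omega)
      linarith
    · intro x hx y hy hPx hPy hxy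
      simp only [Finset.mem_Ioo] at hx hy
      exact hP.eq_of_abs hPx hPy hxy (by omega) (by omega)
  -- elements of a class without start in between
  have hdec : ∀ (k : ℕ) (l l' : ℤ), l' - l = k → l ≤ l' → κ l = κ l' →
      (∀ x, l < x → x ≤ l' → κ x = κ l' → ¬ P x) → G l' ≤ G l := by
    intro k
    induction k using Nat.strong_induction_on with
    | _ k ih =>
      intro l l' hk h1 h3 h4
      rcases h1.eq_or_lt with rfl | h1
      · rfl
      obtain ⟨m, hm1, hm2, hm3, hm4⟩ := exists_last_of_periodic (Q := fun y => κ y = κ l') hn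
        (hper _) rfl (l' - 1)
      have hlm : l ≤ m := by
        by_contra h
        exact hm4 l (by omega) (by omega) h3
      have hmm := hcons m l' (by omega) (by omega) hm3
        (fun y hy1 hy2 => by rw [hm3]; exact hm4 y hy1 (by omega)) (h4 l' h1 le_rfl rfl)
      have := ih (m - l).toNat (by omega) l m (by omega) hlm (h3.trans hm3.symm)
        (fun x hx1 hx2 hx3 => h4 x hx1 (by omega) (hx3.trans hm3))
      omega
  -- Follow the class from `y` to its last element `e` before `p + n`, where the potential is no
  -- larger. Every class starts in `[p, e]` or meets the gap from `e` to `p + n`. Hence the weight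
  -- started in `[p, e]` is at least `a` minus that of the gap, and the gap inequality gives `G (p -
  -- 1) < G e`.
  have hstart : ∀ p y, P p → κ y = κ p → p ≤ y → y < p + n → G (p - 1) < G y := by
    intro p y hp hy hpy hyn
    obtain ⟨e, he1, he2, he3, he4⟩ := exists_last_of_periodic (Q := fun y => κ y = κ p) hn
      (hper _) rfl (p + n - 1)
    have hye : y ≤ e := by
      by_contra h
      exact he4 y (by omega) (by omega) hy
    have hGe : G e ≤ G y := by
      refine hdec (e - y).toNat y e (by omega) hye (hy.trans he3.symm) fun x hx1 hx2 hx3 hPx => ?_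
      have := hP.eq_of_abs hp hPx (hx3.trans he3).symm (by omega) (by omega)
      omega
    have hg := hV.gap e (p + n) (by omega) (by omega) (by rw [he3, hV.per])
      (fun z hz1 hz2 => by rw [he3]; exact he4 z hz1 (by omega))
    have hs := potential_sub hG (show p - 1 ≤ e by omega)
    have hI : Finset.Ioc (p - 1) e = Finset.Icc p e := by
      ext i; simp only [Finset.mem_Ioc, Finset.mem_Icc]; omega
    rw [hI, sum_starts ht] at hs
    · have htot : (Finset.Ioc 0 n).image κ ⊆
          ((Finset.Icc p e).filter P).image κ ∪ (Finset.Ioo e (p + n)).image κ := by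
        rw [← image_window hn hV.per p]
        intro C hC
        obtain ⟨z, hz, rfl⟩ := Finset.mem_image.1 hC
        rw [Finset.mem_Ico] at hz
        rw [Finset.mem_union, Finset.mem_image, Finset.mem_image]
        by_cases hze : e < z
        · exact Or.inr ⟨z, by rw [Finset.mem_Ioo]; omega, rfl⟩
        left
        by_cases hzp : κ z = κ p
        · exact ⟨p, by simp [hp]; omega, hzp.symm⟩
        obtain ⟨l, hl1, hl2, hl3, hl4⟩ := exists_last_of_periodic (Q := fun y => κ y = κ p) hn
          (hper _) rfl z
        obtain ⟨l', hm1, hm2, hm3, hm4⟩ := exists_first_of_periodic (Q := fun y => κ y = κ p) hn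
          (hper _) rfl z
        have hlz : l ≠ z := fun h => hzp (h ▸ hl3)
        have hlz' : l' ≠ z := fun h => hzp (h ▸ hm3)
        have hpl : p ≤ l := by
          by_contra h
          exact hl4 p (by omega) (by omega) rfl
        have hle : l' ≤ e := by
          by_contra h
          exact hm4 e (by omega) (by omega) he3
        obtain ⟨q, hq1, hq2, hq3, hq4⟩ := hgap l l' z (by omega) (by omega) (hl3.trans hm3.symm)
          (fun y hy1 hy2 => by
            rw [hl3]
            rcases le_or_gt y z with h | h
            · exact hl4 y hy1 h
            · exact hm4 y h.le hy2)
          (fun hPl' => by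
            have := hP.eq_of_abs hp hPl' hm3.symm (by omega) (by omega)
            omega)
        exact ⟨q, by simp [hq3]; omega, hq4⟩
      have h1 := Finset.sum_le_sum_of_subset_of_nonneg (f := ω) htot (fun C hC _ => by
        rcases Finset.mem_union.1 hC with hC | hC <;>
        · obtain ⟨x, -, rfl⟩ := Finset.mem_image.1 hC
          exact (hV.pos x).le)
      rw [hV.total] at h1
      have h2 : ∑ C ∈ ((Finset.Icc p e).filter P).image κ ∪ (Finset.Ioo e (p + n)).image κ, ω C ≤
          ∑ C ∈ ((Finset.Icc p e).filter P).image κ, ω C +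
            ∑ C ∈ (Finset.Ioo e (p + n)).image κ, ω C := by
        rw [← Finset.sum_union_inter]
        refine le_add_of_nonneg_right (Finset.sum_nonneg fun C hC => ?_)
        obtain ⟨x, -, rfl⟩ := Finset.mem_image.1 (Finset.mem_inter.1 hC).2
        exact (hV.pos x).le
      have h3 := mul_le_mul_of_nonneg_left (h1.trans h2) (show 0 ≤ n + 1 by omega)
      nlinarith
    · intro x hx y hy hPx hPy hxy
      simp only [Finset.mem_Icc] at hx hy
      exact hP.eq_of_abs hPx hPy hxy (by omega) (by omega)
  refine ⟨hstart, ?_⟩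
  have hstrict : ∀ l l', l < l' → κ l = κ l' →
      (∀ x, l < x → x ≤ l' → κ x = κ l' → ¬ P x) → G l' < G l := by
    intro l l' h1 h3 h4
    obtain ⟨m, hm1, hm2, hm3, hm4⟩ := exists_last_of_periodic (Q := fun y => κ y = κ l') hn
      (hper _) rfl (l' - 1)
    have hlm : l ≤ m := by
      by_contra h
      exact hm4 l (by omega) (by omega) h3
    refine lt_of_lt_of_le (hcons m l' (by omega) (by omega) hm3
        (fun y hy1 hy2 => by rw [hm3]; exact hm4 y hy1 (by omega)) (h4 l' h1 le_rfl rfl)) ?_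
    exact hdec (m - l).toNat l m (by omega) hlm (h3.trans hm3.symm)
        (fun x hx1 hx2 hx3 => h4 x hx1 (by omega) (hx3.trans hm3))
  intro z y hzy hno
  obtain ⟨l, hl1, hl2, hl3, hl4⟩ := exists_last_of_periodic (Q := fun x => κ x = κ y) hn
    (hper _) rfl z
  obtain ⟨l', hm1, hm2, hm3, hm4⟩ := exists_first_of_periodic (Q := fun x => κ x = κ y) hn
    (hper _) rfl (z + 1)
  have hl'y : l' ≤ y := by
    by_contra h
    exact hm4 y (by omega) (by omega) rfl
  have hno' : ∀ x, l < x → x ≤ y → κ x = κ y → ¬ P x := fun x h1 h2 h3 => by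
    rcases le_or_gt x z with h | h
    · exact absurd h3 (hl4 x h1 h)
    · exact hno x h h2 h3
  have hlG : G y < G l := hstrict l y (by omega) hl3 hno'
  -- From `l` to `z` the potential never falls below `G l`: the class of such an `x ≠ l` starts at
  -- some `p` in `(l, x]`, and `G (p - 1) < G x` leads back to an earlier position.
  have key : ∀ (k : ℕ) (x : ℤ), x - l = k → x ≤ z → G l ≤ G x := by
    intro k
    induction k using Nat.strong_induction_on with
    | _ k ih =>
      intro x hk hxz
      rcases Nat.eq_zero_or_pos k with rfl | hkpos
      · rw [show x = l by omega]
      have hκx : κ x ≠ κ y := hl4 x (by omega) hxz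
      obtain ⟨p, hp1, hp2, hp3, hp4⟩ := hgap l l' x (by omega) (by omega) (hl3.trans hm3.symm)
        (fun w hw1 hw2 => by
          rw [hl3]
          rcases le_or_gt w z with h | h
          · exact hl4 w hw1 h
          · exact hm4 w (by omega) hw2)
        (hno l' (by omega) hl'y hm3)
      have h1 := ih (p - 1 - l).toNat (by omega) (p - 1) (by omega) (by omega)
      have h2 := hstart p x hp3 hp4.symm hp2 (by omega)
      omega
  exact lt_of_lt_of_le hlG (key (z - l).toNat z (by omega) le_rfl)

end Engine


section Engine

variable {ι : Type*} {a n : ℤ} {κ : ℤ → ι} {ω : ι → ℤ} {P : ℤ → Prop} {t G : ℤ → ℤ}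

/-- Either a class has no start, or every element has a start of the class at most `n` before it,
and then the potential is smaller just before that start. -/
theorem Fibres.start_cases (hn : 0 < n) (hκ : ∀ x, κ (x + n) = κ x) (hP : Starts n κ P)
    (hF : Fibres n κ P G) (x : ℤ) : (∀ z, κ z = κ x → ¬ P z) ∨
      ∃ p, P p ∧ κ p = κ x ∧ p ≤ x ∧ x < p + n ∧ (∀ y, p < y → y ≤ x → κ y = κ x → ¬ P y) ∧
        G (p - 1) < G x := by
  by_cases h : ∀ z, κ z = κ x → ¬ P z
  · exact Or.inl h
  right
  push Not at h
  obtain ⟨z, hz, hPz⟩ := h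
  obtain ⟨p, h1, h2, ⟨h3, h4⟩, h5⟩ := exists_last_of_periodic (Q := fun y => P y ∧ κ y = κ x) hn
    (fun y => by rw [hP.per, hκ]) ⟨hPz, hz⟩ x
  exact ⟨p, h3, h4, h2, by omega, fun y hy1 hy2 hy3 hy4 => h5 y hy1 hy2 ⟨hy4, hy3⟩,
    hF.start_lt p x h3 h4.symm h2 (by omega)⟩

/-- If no start separates `x` from `z` or `y` from `u`, then `G u < G z < G y`, and this contradicts
the value of `G` just before the later of the two starts. A start of a class lies in at most one of
the two arcs cut out by a pair of its elements, so rotating the four points always leads to this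
case. -/
theorem Fibres.noncross (hn : 0 < n) (hκ : ∀ x, κ (x + n) = κ x) (hP : Starts n κ P)
    (hF : Fibres n κ P G)
    (hfree : ∀ x y, (∀ z, κ z = κ x → ¬ P z) → (∀ z, κ z = κ y → ¬ P z) → κ x = κ y)
    (x y z u : ℤ) (hxy : x < y) (hyz : y < z) (hzu : z < u) (hux : u < x + n) (hxz : κ x = κ z)
    (hyu : κ y = κ u) : κ x = κ y := by
  by_contra hne
  have core : ∀ x y z u : ℤ, x < y → y < z → z < u → κ x = κ z → κ y = κ u → κ x ≠ κ y →
      (∀ v, x < v → v ≤ z → κ v = κ z → ¬ P v) → (∀ v, y < v → v ≤ u → κ v = κ u → ¬ P v) →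
      False := by
    intro x y z u hxy hyz hzu hxz hyu hne hX hY
    have hzy : G z < G y := hF.lt_of_no_start y z hyz fun v h1 h2 h3 => hX v (by omega) h2 h3
    have huz : G u < G z := hF.lt_of_no_start z u hzu fun v h1 h2 h3 => hY v (by omega) h2 h3
    rcases hF.start_cases hn hκ hP z with hfX | ⟨p, hp1, hp2, hp3, hp4, hp5, hp6⟩
    · rcases hF.start_cases hn hκ hP u with hfY | ⟨q, hq1, hq2, hq3, hq4, hq5, hq6⟩
      · exact hne (by rw [hxz, hyu]; exact hfree _ _ hfX hfY)
      · have hqy : q ≤ y := by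
          by_contra h
          exact hY q (by omega) hq3 hq2 hq1
        have := hF.lt_of_no_start (q - 1) z (by omega) fun v _ _ h3 => hfX v h3
        omega
    · have hpx : p ≤ x := by
        by_contra h
        exact hX p (by omega) hp3 hp2 hp1
      rcases hF.start_cases hn hκ hP u with hfY | ⟨q, hq1, hq2, hq3, hq4, hq5, hq6⟩
      · have := hF.lt_of_no_start (p - 1) y (by omega) fun v _ _ h3 => hfY v (h3.trans hyu)
        omega
      · have hqy : q ≤ y := by
          by_contra h
          exact hY q (by omega) hq3 hq2 hq1
        have hpq : p ≠ q := fun h => hne (by rw [hxz, hyu, ← hp2, ← hq2, h])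
        rcases lt_or_gt_of_ne hpq with h | h
        · have := hF.lt_of_no_start (q - 1) z (by omega) fun v h1 h2 h3 =>
            hp5 v (by omega) h2 h3
          omega
        · have := hF.lt_of_no_start (p - 1) y (by omega) fun v h1 h2 h3 =>
            hq5 v (by omega) (by omega) (h3.trans hyu)
          omega
  have free : ∀ x z, x < z → z < x + n → κ x = κ z →
      (∀ v, x < v → v ≤ z → κ v = κ z → ¬ P v) ∨
      (∀ v, z - n < v → v ≤ x → κ v = κ x → ¬ P v) := by
    intro x z hxz hzx hxz'
    by_contra h
    push Not at h
    obtain ⟨⟨v, h1, h2, h3, h4⟩, w, g1, g2, g3, g4⟩ := h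
    have := hP.eq_of_abs h4 g4 (by rw [h3, g3, hxz']) (by omega) (by omega)
    omega
  have hκ' : ∀ x, κ (x - n) = κ x := fun x => by rw [← hκ (x - n), sub_add_cancel]
  have shift : ∀ u y : ℤ, (∀ v, u - n < v → v ≤ y → κ v = κ y → ¬ P v) → κ y = κ u →
      ∀ v, u < v → v ≤ y + n → κ v = κ (y + n) → ¬ P v := by
    intro u y h _ v h1 h2 h3 h4
    refine h (v - n) (by omega) (by omega) (by rw [hκ', h3, hκ]) ?_
    rwa [← hP.per, sub_add_cancel]
  rcases free x z (by omega) (by omega) hxz with h1 | h1 <;>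
    rcases free y u (by omega) (by omega) hyu with h2 | h2
  · exact core x y z u hxy hyz hzu hxz hyu hne h1 h2
  · exact core (u - n) x y z (by omega) hxy hyz (by rw [hκ', hyu]) hxz
      (by rw [hκ', ← hyu]; exact Ne.symm hne) h2 h1
  · refine core y z u (x + n) hyz hzu hux hyu (by rw [hκ, hxz]) (by rw [← hxz]; exact Ne.symm hne)
      h2 (shift z x h1 hxz)
  · exact core (z - n) (u - n) x y (by omega) (by omega) hxy (by rw [hκ', hxz])
      (by rw [hκ', hyu]) (by rw [hκ', hκ', ← hxz, ← hyu]; exact hne) h1 h2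

open scoped Classical in
/-- The fibres of a potential with the right total weight form a valid weighted partition. -/
theorem Fibres.valid (hn : 0 < n) (hκ : ∀ x, κ (x + n) = κ x) (hP : Starts n κ P)
    (hF : Fibres n κ P G)
    (hfree : ∀ x y, (∀ z, κ z = κ x → ¬ P z) → (∀ z, κ z = κ y → ¬ P z) → κ x = κ y)
    (hpos : ∀ x, 0 < ω (κ x)) (htot : ∑ C ∈ (Finset.Ioc 0 n).image κ, ω C = a)
    (ht : ∀ x, t x = if P x then ω (κ x) else 0)
    (hG : ∀ x, G x = G (x - 1) + (n + 1) * t x - a) : Valid a n κ ω := by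
  have hnc := hF.noncross hn hκ hP hfree
  refine ⟨hκ, hnc, hpos, htot, fun l l' hll' hl'n hκll' hcons => ?_⟩
  by_cases hl' : P l'
  · -- the gap before a start
    obtain ⟨y, hy1, hy2, hy3, hy4⟩ := exists_last_of_periodic (Q := fun y => κ y = κ l') hn
      (fun y => by rw [hκ]) rfl (l' - 1)
    have hyl : y = l := by
      rcases lt_trichotomy y l with h | h | h
      · exact absurd hκll' (hy4 l h (by omega))
      · exact h
      · exact absurd (hy3.trans hκll'.symm) (hcons y h (by omega))
    subst hyl
    obtain ⟨p, rfl⟩ : ∃ p, l' = p + n := ⟨l' - n, by ring⟩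
    rw [hP.per] at hl'
    rw [hκ] at hy3 hy4
    have hyp : p ≤ y := by
      by_contra h
      exact hy4 p (by omega) (by omega) rfl
    have hlt := hF.start_lt p y hl' hy3 hyp (by omega)
    have hs := potential_sub hG (show p - 1 ≤ y by omega)
    have hI : Finset.Ioc (p - 1) y = Finset.Icc p y := by
      ext i; simp only [Finset.mem_Ioc, Finset.mem_Icc]; omega
    rw [hI, sum_starts ht] at hs
    -- A class that starts in `[p, y]` and meets the closing gap would cross the class of `p`; so
    -- the two weights add up to at most `a`.
    · have hdisj : Disjoint (((Finset.Icc p y).filter P).image κ)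
          ((Finset.Ioo y (p + n)).image κ) := by
        rw [Finset.disjoint_left]
        intro C hC hC'
        obtain ⟨q, hq, rfl⟩ := Finset.mem_image.1 hC
        obtain ⟨z, hz, hzq⟩ := Finset.mem_image.1 hC'
        rw [Finset.mem_filter, Finset.mem_Icc] at hq
        rw [Finset.mem_Ioo] at hz
        have hzp : κ z ≠ κ p := fun h => hcons z hz.1 hz.2 (h.trans hy3.symm)
        have hqp : q ≠ p := fun h => hzp (by rw [hzq, h])
        have hqy : q ≠ y := fun h => hzp (by rw [hzq, h, hy3])
        exact hzp (by rw [hzq]; exact (hnc p q y z (by omega) (by omega) (by omega) (by omega)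
          hy3.symm hzq.symm).symm)
      have hle : ∑ C ∈ ((Finset.Icc p y).filter P).image κ, ω C +
          ∑ C ∈ (Finset.Ioo y (p + n)).image κ, ω C ≤ a := by
        rw [← Finset.sum_union hdisj, ← htot]
        refine Finset.sum_le_sum_of_subset_of_nonneg ?_ fun C hC _ => ?_
        · rw [← image_window hn hκ p]
          intro C hC
          rw [Finset.mem_union, Finset.mem_image, Finset.mem_image] at hC
          rcases hC with ⟨z, hz, rfl⟩ | ⟨z, hz, rfl⟩
          · rw [Finset.mem_filter, Finset.mem_Icc] at hz
            exact Finset.mem_image_of_mem _ (by rw [Finset.mem_Ico]; omega)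
          · rw [Finset.mem_Ioo] at hz
            exact Finset.mem_image_of_mem _ (by rw [Finset.mem_Ico]; omega)
        · obtain ⟨x, -, rfl⟩ := Finset.mem_image.1 hC
          exact (hpos x).le
      have := mul_le_mul_of_nonneg_left hle (show 0 ≤ n + 1 by omega)
      nlinarith
    · intro x hx z hz hPx hPz hxz
      simp only [Finset.mem_Icc] at hx hz
      exact hP.eq_of_abs hPx hPz hxz (by omega) (by omega)
  -- Now the potential drops from `l` to `l'`. Since each class met in the gap also starts in it
  -- (`hsub`), this drop is the gap inequality.
  · have hlt := hF.lt_of_no_start l l' hll' fun x h1 h2 h3 => by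
      rcases h2.eq_or_lt with rfl | h2
      · exact hl'
      · exact absurd (h3.trans hκll'.symm) (hcons x h1 h2)
    have hs := potential_sub hG hll'.le
    have : Finset.Ioc l l' = insert l' (Finset.Ioo l l') := by
      ext i; simp only [Finset.mem_Ioc, Finset.mem_insert, Finset.mem_Ioo]; omega
    rw [this, Finset.sum_insert (by simp), ht l', if_neg hl', zero_add, sum_starts ht] at hs
    · have hsub : (Finset.Ioo l l').image κ ⊆ ((Finset.Ioo l l').filter P).image κ := by
        intro C hC
        obtain ⟨z, hz, rfl⟩ := Finset.mem_image.1 hC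
        rw [Finset.mem_Ioo] at hz
        have hzl := hcons z hz.1 hz.2
        by_cases hfz : ∀ y, κ y = κ z → ¬ P y
        -- Unless `l` is startless as well, a startless class in the gap gives `G z < G (p - 1) < G
        -- l' < G z`.
        · exfalso
          rcases hF.start_cases hn hκ hP l with hfl | ⟨p, hp1, hp2, hp3, hp4, hp5, hp6⟩
          · exact hzl (hfree _ _ hfz hfl)
          · have hpl' : l' < p + n := by
              by_contra h
              rcases (not_lt.1 h).eq_or_lt with h | h
              · exact hl' (by rw [← h, hP.per]; exact hp1)
              · exact hcons (p + n) (by omega) h (by rw [hκ, hp2])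
            have h1 := hF.lt_of_no_start (p - 1) z (by omega) fun v _ _ h3 => hfz v h3
            have h2 := hF.start_lt p l' hp1 (by rw [hp2, hκll']) (by omega) hpl'
            have h3 := hF.lt_of_no_start z l' hz.2 fun x h1 h2 h3 => by
              rcases h2.eq_or_lt with rfl | h2
              · exact hl'
              · exact absurd (h3.trans hκll'.symm) (hcons x (by omega) h2)
            omega
        push Not at hfz
        obtain ⟨y, hy, hPy⟩ := hfz
        obtain ⟨p, hp1, hp2, ⟨hp3, hp4⟩, -⟩ := exists_first_of_periodic
          (Q := fun y => P y ∧ κ y = κ z) hn (fun y => by rw [hP.per, hκ]) ⟨hPy, hy⟩ l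
        have hpl : p ≠ l := fun h => hzl (by rw [← hp4, h])
        have hpl' : p ≠ l' := fun h => hl' (h ▸ hp3)
        refine Finset.mem_image.2 ⟨p, Finset.mem_filter.2 ⟨Finset.mem_Ioo.2 ⟨by omega, ?_⟩, hp3⟩,
          hp4⟩
        by_contra h
        exact hzl (hnc l z l' p hz.1 hz.2 (by omega) (by omega) hκll' hp4.symm).symm
      have := Finset.sum_le_sum_of_subset_of_nonneg (f := ω) hsub fun C hC _ => by
        obtain ⟨x, -, rfl⟩ := Finset.mem_image.1 hC
        exact (hpos x).le
      have := mul_le_mul_of_nonneg_left this (show 0 ≤ n + 1 by omega)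
      linarith
    · intro x hx y hy hPx hPy hxy
      simp only [Finset.mem_Ioo] at hx hy
      exact hP.eq_of_abs hPx hPy hxy (by omega) (by omega)

end Engine


/-! ### Dyck paths as height functions -/

section Paths

variable (w : List Step)

theorem xCoord_succ (t : ℕ) :
    xCoord w (t + 1) = xCoord w t + if w[t]? = some Step.east then 1 else 0 := by
  rw [xCoord, xCoord, List.take_add_one, List.count_append]
  rcases h : w[t]? with _ | ⟨_ | _⟩ <;> simp

theorem yCoord_succ (t : ℕ) :
    yCoord w (t + 1) = yCoord w t + if w[t]? = some Step.north then 1 else 0 := by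
  rw [yCoord, yCoord, List.take_add_one, List.count_append]
  rcases h : w[t]? with _ | ⟨_ | _⟩ <;> simp

theorem xCoord_mono : Monotone (xCoord w) :=
  monotone_nat_of_le_succ fun t => by rw [xCoord_succ]; exact Nat.le_add_right _ _

theorem yCoord_mono : Monotone (yCoord w) :=
  monotone_nat_of_le_succ fun t => by rw [yCoord_succ]; exact Nat.le_add_right _ _

variable {w}

theorem xCoord_lt {s t : ℕ} (h : w[s]? = some Step.east) (hst : s < t) :
    xCoord w s < xCoord w t := by
  have h1 := xCoord_succ w s
  rw [if_pos h] at h1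
  have := xCoord_mono w (show s + 1 ≤ t from hst)
  omega

theorem exists_east {j t : ℕ} (h : j < xCoord w t) :
    ∃ s < t, w[s]? = some Step.east ∧ xCoord w s = j := by
  classical
  have hex : ∃ s, j < xCoord w s := ⟨t, h⟩
  have hs := Nat.find_spec hex
  have hst := Nat.find_min' hex h
  obtain ⟨s, hs'⟩ : ∃ s, Nat.find hex = s + 1 := Nat.exists_eq_succ_of_ne_zero fun h0 => by
    rw [h0] at hs; simp [xCoord] at hs
  have hmin := Nat.find_min hex (m := s) (by omega)
  rw [hs', xCoord_succ] at hs
  refine ⟨s, by omega, ?_⟩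
  split_ifs at hs with he
  · exact ⟨he, by omega⟩
  · omega

end Paths

/-- The height functions of `a,b`-Dyck paths: `h k` is the height of the `k`-th east step. -/
structure IsHeight (a b : ℕ) (h : ℕ → ℕ) : Prop where
  zero : h 0 = 0
  last : h b = a
  mono : ∀ k < b, h k ≤ h (k + 1)
  above : ∀ k ≤ b, a * k ≤ b * h k

/-- The east steps of `w` have the heights given by `h`. -/
def HasHeight (w : List Step) (h : ℕ → ℕ) : Prop :=
  ∀ t, w[t]? = some Step.east → yCoord w t = h (xCoord w t + 1)

/-- The height of a path, relative to the line through the origin of slope `a / b`. -/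
def level (a b : ℕ) (h : ℕ → ℕ) (x : ℕ) : ℤ := b * h x - a * x

variable {a b : ℕ} {h : ℕ → ℕ}

theorem HasHeight.after_east {w : List Step} (hw : HasHeight w h) {t : ℕ}
    (ht : w[t]? = some Step.east) :
    xCoord w (t + 1) = xCoord w t + 1 ∧ yCoord w (t + 1) = h (xCoord w t + 1) := by
  rw [xCoord_succ, yCoord_succ, if_pos ht, if_neg (by rw [ht]; simp), hw t ht]
  simp

theorem DyckPath.exists_height (hb : 0 < b) (D : DyckPath a b) :
    ∃ h, IsHeight a b h ∧ HasHeight D.steps h := by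
  have hex : ∀ j, ∃ s, j < b → s < D.steps.length ∧ D.steps[s]? = some Step.east ∧
      xCoord D.steps s = j := by
    intro j
    by_cases hj : j < b
    · obtain ⟨s, h1, h2, h3⟩ := exists_east (w := D.steps) (t := D.steps.length)
        (by rw [D.x_end]; exact hj)
      exact ⟨s, fun _ => ⟨h1, h2, h3⟩⟩
    · exact ⟨0, fun h => absurd h hj⟩
  choose σ hσ using hex
  have hh : ∀ t, D.steps[t]? = some Step.east → xCoord D.steps t < b ∧
      σ (xCoord D.steps t) = t := by
    intro t ht
    have hlt : t < D.steps.length := (List.getElem?_eq_some_iff.1 ht).1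
    have hx := xCoord_lt ht hlt
    rw [D.x_end] at hx
    refine ⟨hx, ?_⟩
    obtain ⟨-, h2, h3⟩ := hσ _ hx
    rcases lt_trichotomy (σ (xCoord D.steps t)) t with h | h | h
    · have := xCoord_lt h2 h; omega
    · exact h
    · have := xCoord_lt ht h; omega
  -- The `k`-th east step leaves from `x = k - 1`, whence the shift; `h 0 = 0` is a convention.
  set h : ℕ → ℕ := fun k => if k = 0 then 0 else yCoord D.steps (σ (k - 1)) with hdef
  have hH : HasHeight D.steps h := by
    intro t ht
    rw [hdef]
    simp only [Nat.add_eq_zero_iff, one_ne_zero, and_false, if_false, Nat.add_sub_cancel]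
    rw [(hh t ht).2]
  have habove : ∀ k ≤ b, a * k ≤ b * h k := by
    intro k hk
    rcases Nat.eq_zero_or_pos k with rfl | hk0
    · simp
    obtain ⟨h1, h2, h3⟩ := hσ (k - 1) (by omega)
    have := D.above (σ (k - 1) + 1) h1
    rw [(hH.after_east h2).1, (hH.after_east h2).2, h3, Nat.sub_add_cancel hk0] at this
    exact this
  refine ⟨h, ⟨by simp [hdef], ?_, ?_, habove⟩, hH⟩
  · have h1 : a ≤ h b :=
      le_of_mul_le_mul_left (by rw [mul_comm b a]; exact habove b le_rfl) hb
    refine le_antisymm ?_ h1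
    obtain ⟨h1, h2, h3⟩ := hσ (b - 1) (by omega)
    have := yCoord_mono D.steps h1.le
    rw [D.y_end, hH _ h2, h3, Nat.sub_add_cancel hb] at this
    exact this
  · intro k hk
    rcases Nat.eq_zero_or_pos k with rfl | hk0
    · simp [hdef]
    obtain ⟨h1, h2, h3⟩ := hσ (k - 1) (by omega)
    obtain ⟨g1, g2, g3⟩ := hσ k hk
    have e1 := hH _ h2
    have e2 := hH _ g2
    rw [h3, Nat.sub_add_cancel hk0] at e1
    rw [g3] at e2
    rw [← e1, ← e2]
    refine yCoord_mono _ ?_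
    by_contra hc
    have := xCoord_lt g2 (not_le.1 hc)
    omega

/-- The path has `h (k + 1) - h k` north steps before the east step from `x = k`. The induction also
records that each point is at least as high as the last east step, which is enough to stay above the
line. -/
theorem IsHeight.exists_dyckPath (hh : IsHeight a b h) :
    ∃ D : DyckPath a b, HasHeight D.steps h := by
  have key : ∀ k ≤ b, ∃ w : List Step, xCoord w w.length = k ∧ yCoord w w.length = h k ∧
      (∀ t ≤ w.length, h (xCoord w t) ≤ yCoord w t) ∧ HasHeight w h := by
    intro k
    induction k with
    | zero =>
      intro _
      exact ⟨[], by simp [xCoord], by simp [yCoord, hh.zero], by simp [xCoord, hh.zero],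
        fun t ht => by simp at ht⟩
    | succ k ih =>
      intro hk
      obtain ⟨w, h1, h2, h3, h4⟩ := ih (by omega)
      have hmono := hh.mono k hk
      set v := List.replicate (h (k + 1) - h k) Step.north with hv
      have hvl : v.length = h (k + 1) - h k := by simp [hv]
      have hcx : ∀ i, (v.take i).count Step.east = 0 := fun i => by
        simp [hv, List.take_replicate, List.count_replicate]
      have hcy : ∀ i, i ≤ v.length → (v.take i).count Step.north = i := fun i hi => by
        rw [hvl] at hi
        simp [hv, List.take_replicate, hi]
      set u := w ++ v ++ [Step.east] with hu
      have hul : u.length = w.length + v.length + 1 := by simp [hu]; omega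
      have hx1 : ∀ t ≤ w.length, xCoord u t = xCoord w t ∧ yCoord u t = yCoord w t := by
        intro t ht
        simp only [xCoord, yCoord, hu, List.append_assoc, List.take_append_of_le_length ht,
          and_self]
      have hx2 : ∀ i ≤ v.length, xCoord u (w.length + i) = k ∧
          yCoord u (w.length + i) = h k + i := by
        intro i hi
        have : u.take (w.length + i) = w ++ v.take i := by
          rw [hu, List.append_assoc, List.take_length_add_append,
            List.take_append_of_le_length hi]
        rw [xCoord, yCoord, this, List.count_append, List.count_append, hcx, hcy i hi]
        simp only [xCoord, yCoord, List.take_length] at h1 h2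
        omega
      have heast : u[w.length + v.length]? = some Step.east := by
        rw [hu, ← List.length_append]; simp
      have hx3 : xCoord u u.length = k + 1 ∧ yCoord u u.length = h (k + 1) := by
        rw [hul, xCoord_succ, yCoord_succ, if_pos heast, if_neg (by rw [heast]; simp),
          (hx2 _ le_rfl).1, (hx2 _ le_rfl).2]
        omega
      refine ⟨u, hx3.1, hx3.2, ?_, ?_⟩
      · intro t ht
        rcases le_or_gt t w.length with h' | h'
        · rw [(hx1 t h').1, (hx1 t h').2]; exact h3 t h'
        rcases ht.eq_or_lt with rfl | ht
        · rw [hx3.1, hx3.2]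
        · have := hx2 (t - w.length) (by omega)
          rw [show w.length + (t - w.length) = t by omega] at this
          rw [this.1, this.2]; omega
      · intro t ht
        rcases lt_or_ge t w.length with h' | h'
        · rw [(hx1 t h'.le).1, (hx1 t h'.le).2]
          refine h4 t ?_
          rw [← ht, hu, List.append_assoc, List.getElem?_append_left h']
        rcases lt_or_ge t (w.length + v.length) with h'' | h''
        · exfalso
          rw [hu, List.getElem?_append_left (by simp; omega), List.getElem?_append_right h',
            hv, List.getElem?_replicate] at ht
          split_ifs at ht
          all_goals simp at ht
        · have hlt : t < u.length := (List.getElem?_eq_some_iff.1 ht).1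
          rw [show t = w.length + v.length by omega, (hx2 _ le_rfl).1, (hx2 _ le_rfl).2]
          omega
  obtain ⟨w, h1, h2, h3, h4⟩ := key b le_rfl
  refine ⟨⟨w, h1, h2.trans hh.last, fun t ht => ?_⟩, h4⟩
  have hxt : xCoord w t ≤ b := h1 ▸ xCoord_mono w ht
  exact (hh.above _ hxt).trans (Nat.mul_le_mul_left _ (h3 t ht))

/-! ### Lasers and visibility in terms of levels -/

/-- The laser fired at `x = i` runs above the position `x = k`. -/
def Covers (a b : ℕ) (h : ℕ → ℕ) (i k : ℕ) : Prop :=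
  i < k ∧ ∀ y, i < y → y ≤ k → level a b h i < level a b h y

theorem level_nonneg (hh : IsHeight a b h) {k : ℕ} (hk : k ≤ b) : 0 ≤ level a b h k := by
  have := hh.above k hk
  rw [level]
  zify at this
  linarith

/-- Measured by levels, lasers are horizontal: the one from `i` stops at the first later east step
whose east end is not above `level i`. The valley condition becomes a strict rise of the level from
`i` to `i + 1`, since a north step there contributes at least `b - a > 0`. -/
theorem DyckPath.lasers_eq (ha : 0 < a) (hab : a < b) (hh : IsHeight a b h) (D : DyckPath a b)
    (hD : HasHeight D.steps h) : D.lasers = {p | 1 ≤ p.1 ∧ p.1 < p.2 ∧ p.2 < b ∧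
      Covers a b h p.1 p.2 ∧ level a b h (p.2 + 1) ≤ level a b h p.1} := by
  have hmono : ∀ k < b, (h k : ℤ) ≤ h (k + 1) := fun k hk => by exact_mod_cast hh.mono k hk
  have east : ∀ j < b, ∃ s, D.steps[s]? = some Step.east ∧ xCoord D.steps s = j := by
    intro j hj
    obtain ⟨s, -, h2, h3⟩ := exists_east (w := D.steps) (t := D.steps.length)
      (by rw [D.x_end]; exact hj)
    exact ⟨s, h2, h3⟩
  have ha' : (0 : ℤ) < a := by exact_mod_cast ha
  have hb' : (0 : ℤ) < b := by exact_mod_cast ha.trans hab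
  have hab' : (a : ℤ) < b := by exact_mod_cast hab
  have meets : ∀ t s i j, xCoord D.steps t = i → yCoord D.steps t = h i →
      D.steps[s]? = some Step.east → xCoord D.steps s = j →
      (D.Meets t s ↔ (a : ℤ) * (j - i) ≤ b * (h (j + 1) - h i) ∧
        level a b h (j + 1) ≤ level a b h i) := by
    rintro t s i j h1 h2 h3 h4
    have := hD s h3
    rw [h4] at this
    rw [DyckPath.Meets, h1, h2, h4, this, level, level]
    simp only [h3, true_and]
    push_cast
    constructor <;> rintro ⟨h5, h6⟩ <;> exact ⟨h5, by linarith⟩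
  have lower : ∀ i j, j < b → level a b h i ≤ level a b h j →
      (a : ℤ) * (j - i) ≤ b * (h (j + 1) - h i) := by
    intro i j hj h1
    rw [level, level] at h1
    have := mul_le_mul_of_nonneg_left (hmono j hj) hb'.le
    linarith
  ext ⟨i, j⟩
  simp only [DyckPath.lasers, Set.mem_ofPred_eq]
  constructor
  · rintro ⟨t, s, ⟨ht0, hte, htn⟩, hts, hm, hmin, hp⟩
    rw [Prod.mk.injEq] at hp
    obtain ⟨rfl, rfl⟩ := hp
    obtain ⟨t, rfl⟩ : ∃ t', t = t' + 1 := ⟨t - 1, by omega⟩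
    rw [Nat.add_sub_cancel] at hte
    obtain ⟨hx, hy⟩ := hD.after_east hte
    set i := xCoord D.steps (t + 1) with hi
    set j := xCoord D.steps s with hj
    rw [← hx] at hy
    have hse : D.steps[s]? = some Step.east := hm.1
    have hjb : j < b := by
      have := xCoord_lt hse (List.getElem?_eq_some_iff.1 hse).1
      rwa [D.x_end] at this
    have hij : i ≤ j := xCoord_mono _ hts
    obtain ⟨hm1, hm2⟩ := (meets (t + 1) s i j rfl hy hse rfl).1 hm
    have hvalley : level a b h i < level a b h (i + 1) := by
      obtain ⟨r, hr1, hr2⟩ := east i (hij.trans_lt hjb)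
      have hrt : t + 2 ≤ r := by
        by_contra hc
        rcases (show r = t + 1 ∨ r < t + 1 by omega) with rfl | hc
        · rw [htn] at hr1; simp at hr1
        · have := xCoord_lt hr1 hc
          omega
      have h1 := yCoord_mono D.steps hrt
      rw [yCoord_succ, if_pos htn, hD r hr1, hr2, hy] at h1
      rw [level, level]
      have h2 : (h i : ℤ) + 1 ≤ h (i + 1) := by exact_mod_cast h1
      have := mul_le_mul_of_nonneg_left h2 hb'.le
      push_cast
      linarith
    have hcov : ∀ y, i < y → y ≤ j → level a b h i < level a b h y := by
      intro y
      induction y with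
      | zero => intro h1; omega
      | succ y ih =>
        intro h1 h2
        rcases (show i = y ∨ i < y by omega) with rfl | h3
        · exact hvalley
        by_contra hc
        obtain ⟨r, hr1, hr2⟩ := east y (by omega)
        refine hmin r ?_ ?_ ((meets (t + 1) r i y rfl hy hr1 hr2).2
          ⟨lower i y (by omega) (ih h3 (by omega)).le, not_lt.1 hc⟩)
        · by_contra hc
          have := xCoord_lt hr1 (not_le.1 hc)
          omega
        · by_contra hc
          have := xCoord_mono D.steps (not_lt.1 hc)
          omega
    have hlt : i < j := by
      rcases hij.eq_or_lt with h1 | h1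
      · rw [← h1] at hm2; omega
      · exact h1
    exact ⟨by omega, hlt, hjb, ⟨hlt, hcov⟩, hm2⟩
  · rintro ⟨h1, h2, h3, ⟨-, h4⟩, h5⟩
    obtain ⟨t, ht1, ht2⟩ := east (i - 1) (by omega)
    obtain ⟨s, hs1, hs2⟩ := east j h3
    obtain ⟨hx, hy⟩ := hD.after_east ht1
    rw [ht2, Nat.sub_add_cancel h1] at hx hy
    have hts : ∀ r, D.steps[r]? = some Step.east → i ≤ xCoord D.steps r → t + 1 ≤ r := by
      intro r hr1 hr2
      by_contra hc
      have := xCoord_mono D.steps (show r ≤ t by omega)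
      omega
    refine ⟨t + 1, s, ⟨by omega, ht1, ?_⟩, hts s hs1 (by omega), ?_, ?_, by rw [hx, hs2]⟩
    · rcases hn : D.steps[t + 1]? with _ | ⟨_ | _⟩
      · rw [List.getElem?_eq_none_iff] at hn
        have := xCoord_mono D.steps hn
        have h6 := D.x_end
        have h7 := xCoord_mono D.steps (List.getElem?_eq_some_iff.1 ht1).1
        rw [Nat.succ_eq_add_one] at h7
        omega
      · rfl
      · exfalso
        have h6 := hD _ hn
        rw [hx, hy] at h6
        have h7 := h4 (i + 1) (by omega) (by omega)
        rw [level, level, ← h6] at h7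
        push_cast at h7
        linarith
    · exact (meets (t + 1) s i j hx hy hs1 hs2).2
        ⟨lower i j h3 (h4 j h2 le_rfl).le, h5⟩
    · intro r hr1 hr2 hm
      have hrj := xCoord_lt hm.1 hr2
      have hri := xCoord_mono D.steps hr1
      have := ((meets (t + 1) r i _ hx hy hm.1 rfl).1 hm).2
      have h6 := h4 (xCoord D.steps r + 1) (by omega) (by omega)
      omega

/-- A laser separates exactly the labels that its source covers, and every source `i ≥ 1` that
covers a label fires a laser, because the path ends at level `0` and must come down to the level of
`i`. -/
theorem DyckPath.visible_iff (ha : 0 < a) (hab : a < b) (hh : IsHeight a b h) (D : DyckPath a b)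
    (hD : HasHeight D.steps h) {k l : ℕ} (hk : k < b) (hl : l < b) :
    D.visible k l ↔ ∀ i, 1 ≤ i → (Covers a b h i k ↔ Covers a b h i l) := by
  have key : ∀ i j, 1 ≤ i → Covers a b h i j → level a b h (j + 1) ≤ level a b h i → ∀ k,
      ((i < k ∧ k ≤ j) ↔ Covers a b h i k) := by
    intro i j _ hc hj k
    constructor
    · rintro ⟨h1, h2⟩
      exact ⟨h1, fun y hy1 hy2 => hc.2 y hy1 (hy2.trans h2)⟩
    · rintro ⟨h1, h2⟩
      refine ⟨h1, ?_⟩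
      by_contra hkj
      have := h2 (j + 1) (by have := hc.1; omega) (by omega)
      omega
  have ex : ∀ i k, 1 ≤ i → k < b → Covers a b h i k → ∃ j, k ≤ j ∧ j < b ∧ Covers a b h i j ∧
      level a b h (j + 1) ≤ level a b h i := by
    intro i k hi hk hc
    have hlast : level a b h b = 0 := by rw [level, hh.last]; ring
    have hex : ∃ y, i < y ∧ level a b h y ≤ level a b h i :=
      ⟨b, hc.1.trans hk, by rw [hlast]; exact level_nonneg hh (hc.1.trans hk).le⟩
    classical
    obtain ⟨h1, h2⟩ := Nat.find_spec hex
    have h3 : Nat.find hex ≤ b := Nat.find_min' hex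
      ⟨hc.1.trans hk, by rw [hlast]; exact level_nonneg hh (hc.1.trans hk).le⟩
    have h4 : k < Nat.find hex := by
      by_contra hcon
      have := hc.2 _ h1 (not_lt.1 hcon)
      omega
    refine ⟨Nat.find hex - 1, by omega, by omega, ⟨by have := hc.1; omega, fun y hy1 hy2 => ?_⟩, ?_⟩
    · have := Nat.find_min hex (m := y) (by omega)
      push Not at this
      exact this hy1
    · rw [Nat.sub_add_cancel (by omega)]; exact h2
  change (∀ p ∈ D.lasers, (p.1 < k ∧ k ≤ p.2) ↔ (p.1 < l ∧ l ≤ p.2)) ↔ _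
  rw [D.lasers_eq ha hab hh hD]
  constructor
  · intro H i hi
    constructor
    · intro hc
      obtain ⟨j, h1, h2, h3, h4⟩ := ex i k hi hk hc
      exact (key i j hi h3 h4 l).1 ((H (i, j) ⟨hi, h3.1, h2, h3, h4⟩).1 ⟨hc.1, h1⟩)
    · intro hc
      obtain ⟨j, h1, h2, h3, h4⟩ := ex i l hi hl hc
      exact (key i j hi h3 h4 k).1 ((H (i, j) ⟨hi, h3.1, h2, h3, h4⟩).2 ⟨hc.1, h1⟩)
  · rintro H ⟨i, j⟩ ⟨h1, h2, h3, h4, h5⟩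
    rw [key i j h1 h4 h5 k, key i j h1 h4 h5 l]
    exact H i h1


theorem blockMin_mem {B : Finset ℕ} (hB : B.Nonempty) : blockMin B ∈ B := by
  exact_mod_cast Nat.sInf_mem (s := (B : Set ℕ)) (Finset.coe_nonempty.mpr hB)

theorem blockMax_mem {B : Finset ℕ} (hB : B.Nonempty) : blockMax B ∈ B := by
  exact_mod_cast Nat.sSup_mem (s := (B : Set ℕ)) (Finset.coe_nonempty.mpr hB) B.bddAbove

theorem blockMin_le {B : Finset ℕ} {k : ℕ} (hk : k ∈ B) : blockMin B ≤ k :=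
  Nat.sInf_le (by exact_mod_cast hk)

theorem le_blockMax {B : Finset ℕ} {k : ℕ} (hk : k ∈ B) : k ≤ blockMax B :=
  le_csSup B.bddAbove (by exact_mod_cast hk)

/-! ### Blocks and ranks read off from the levels -/

section Linear

variable {a b : ℕ} {h : ℕ → ℕ}

/-- The last position before `k` with a smaller value of `g` is `x`. -/
def IsPrev (g : ℕ → ℤ) (x k : ℕ) : Prop :=
  x < k ∧ g x < g k ∧ ∀ y, x < y → y < k → g k ≤ g y

theorem IsPrev.unique {g : ℕ → ℤ} {x x' k : ℕ} (h : IsPrev g x k) (h' : IsPrev g x' k) :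
    x = x' := by
  rcases lt_trichotomy x x' with h1 | h1 | h1
  · have := h.2.2 x' h1 h'.1; have := h'.2.1; omega
  · exact h1
  · have := h'.2.2 x h1 h.1; have := h.2.1; omega

theorem level_zero (hh : IsHeight a b h) : level a b h 0 = 0 := by
  rw [level, hh.zero]; simp

theorem level_last (hh : IsHeight a b h) : level a b h b = 0 := by
  rw [level, hh.last]; ring

theorem level_ne (hcop : Nat.Coprime a b) {x y : ℕ} (hxy : x < y) (hyb : y < x + b) :
    level a b h x ≠ level a b h y := by
  intro he
  rw [level, level] at he
  have h1 : (b : ℤ) ∣ a * (y - x) := ⟨h y - h x, by linarith⟩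
  have h2 : (b : ℤ) ∣ y - x :=
    (Int.isCoprime_iff_gcd_eq_one.2 (by simpa [Nat.coprime_comm] using hcop)).dvd_of_dvd_mul_left h1
  have := Int.le_of_dvd (by omega) h2
  omega

theorem level_pos (hcop : Nat.Coprime a b) (hh : IsHeight a b h) {k : ℕ} (hk : 1 ≤ k)
    (hkb : k < b) : 0 < level a b h k := by
  have h1 := level_nonneg hh hkb.le
  have h2 := level_ne (h := h) hcop (x := 0) (y := k) (by omega) (by omega)
  rw [level_zero hh] at h2
  omega

theorem level_succ (k : ℕ) :
    level a b h (k + 1) = level a b h k + b * ((h (k + 1) : ℤ) - h k) - a := by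
  rw [level, level]; push_cast; ring

theorem exists_isPrev (hcop : Nat.Coprime a b) (hh : IsHeight a b h) {k : ℕ} (hk : 1 ≤ k)
    (hkb : k < b) : ∃ x, IsPrev (level a b h) x k := by
  classical
  have h0 : level a b h 0 < level a b h k := by
    rw [level_zero hh]; exact level_pos hcop hh hk hkb
  obtain ⟨h1, h2⟩ := Nat.findGreatest_spec (P := fun x => x < k ∧ level a b h x < level a b h k)
    (Nat.zero_le k) ⟨hk, h0⟩
  refine ⟨_, h1, h2, fun y hy1 hy2 => ?_⟩
  by_contra hc
  exact Nat.findGreatest_is_greatest hy1 hy2.le ⟨hy2, not_le.1 hc⟩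

theorem IsPrev.covers_le {x i k : ℕ} (hx : IsPrev (level a b h) x k) (hc : Covers a b h i k) :
    i ≤ x := by
  by_contra hxi
  have h1 := hx.2.2 i (by omega) hc.1
  have h2 := hc.2 k hc.1 le_rfl
  omega

theorem IsPrev.covers {x k : ℕ} (hx : IsPrev (level a b h) x k) : Covers a b h x k := by
  refine ⟨hx.1, fun y h1 h2 => ?_⟩
  rcases h2.eq_or_lt with rfl | h2
  · exact hx.2.1
  · exact lt_of_lt_of_le hx.2.1 (hx.2.2 y h1 h2)

theorem IsPrev.covers_of_covers {x i k l : ℕ} (hk : IsPrev (level a b h) x k)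
    (hl : IsPrev (level a b h) x l) (hc : Covers a b h i k) : Covers a b h i l := by
  have hix := hk.covers_le hc
  have hgx : level a b h i ≤ level a b h x := by
    rcases hix.eq_or_lt with rfl | h1
    · rfl
    · exact (hc.2 x h1 hk.1.le).le
  refine ⟨hix.trans_lt hl.1, fun y h1 h2 => ?_⟩
  rcases le_or_gt y x with h3 | h3
  · exact hc.2 y h1 (h3.trans hk.1.le)
  · exact lt_of_le_of_lt hgx (hl.covers.2 y h3 h2)

/-- The previous smaller position is the largest source covering a label and determines all the
others. Position `0` fires no laser, but the labels with previous position `0` are just those that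
no laser covers. -/
theorem DyckPath.visible_iff_isPrev (ha : 0 < a) (hab : a < b)
    (hh : IsHeight a b h) (D : DyckPath a b) (hD : HasHeight D.steps h) {k l x y : ℕ}
    (hk : k < b) (hl : l < b) (hx : IsPrev (level a b h) x k) (hy : IsPrev (level a b h) y l) :
    D.visible k l ↔ x = y := by
  rw [D.visible_iff ha hab hh hD hk hl]
  constructor
  · intro H
    apply le_antisymm
    · rcases Nat.eq_zero_or_pos x with rfl | h1
      · exact Nat.zero_le _
      · exact hy.covers_le ((H x h1).1 hx.covers)
    · rcases Nat.eq_zero_or_pos y with rfl | h1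
      · exact Nat.zero_le _
      · exact hx.covers_le ((H y h1).2 hy.covers)
  · rintro rfl i _
    exact ⟨hx.covers_of_covers hy, hy.covers_of_covers hx⟩

/-- The classes of `π` are the fibres of the map `k ↦ x`, where `x` is the last position before
`k` with a smaller level. -/
def HasLevel (a b : ℕ) (π : Finpartition (Finset.Icc 1 (b - 1))) (h : ℕ → ℕ) : Prop :=
  ∀ k ∈ Finset.Icc 1 (b - 1), 1 ≤ blockMin (π.part k) ∧
    IsPrev (level a b h) (blockMin (π.part k) - 1) k

theorem part_eq_of_blockMin_eq {s : Finset ℕ} (π : Finpartition s) {k l : ℕ} (hk : k ∈ s)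
    (hl : l ∈ s) (h : blockMin (π.part k) = blockMin (π.part l)) : π.part k = π.part l := by
  refine π.eq_of_mem_parts (π.part_mem.2 hk) (π.part_mem.2 hl)
    (blockMin_mem (π.part_nonempty.2 hk)) ?_
  rw [h]
  exact blockMin_mem (π.part_nonempty.2 hl)

theorem eq_of_part_eq_iff {s : Finset ℕ} {π π' : Finpartition s}
    (h : ∀ k ∈ s, ∀ l ∈ s, π.part k = π.part l ↔ π'.part k = π'.part l) : π = π' := by
  have hpart : ∀ k ∈ s, π.part k = π'.part k := by
    intro k hk
    ext l
    by_cases hl : l ∈ s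
    · rw [Finpartition.mem_part_iff_part_eq_part _ hl hk,
        Finpartition.mem_part_iff_part_eq_part _ hl hk, h l hl k hk]
    · exact iff_of_false (fun h => hl (Finpartition.part_subset _ _ h))
        (fun h => hl (Finpartition.part_subset _ _ h))
  ext1
  ext B
  constructor
  · intro hB
    obtain ⟨k, hk, rfl⟩ := π.part_surjOn hB
    rw [hpart k hk]; exact π'.part_mem.2 hk
  · intro hB
    obtain ⟨k, hk, rfl⟩ := π'.part_surjOn hB
    rw [← hpart k hk]; exact π.part_mem.2 hk

theorem DyckPath.mem_part_iff (D : DyckPath a b) {k l : ℕ} : l ∈ D.partition.part k ↔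
    k ∈ Finset.Icc 1 (b - 1) ∧ l ∈ Finset.Icc 1 (b - 1) ∧ D.visible k l := by
  classical
  rw [DyckPath.partition, Finpartition.mem_part_ofSetSetoid_iff_rel]

theorem DyckPath.partition_hasLevel (ha : 0 < a) (hab : a < b) (hcop : Nat.Coprime a b)
    (hh : IsHeight a b h) (D : DyckPath a b) (hD : HasHeight D.steps h) :
    HasLevel a b D.partition h := by
  intro k hk
  have hk' := Finset.mem_Icc.1 hk
  obtain ⟨x, hx⟩ := exists_isPrev hcop hh hk'.1 (show k < b by omega)
  -- The label `x + 1` has previous position `x`, so it is the least label of its block.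
  have hx1 : IsPrev (level a b h) x (x + 1) := by
    refine ⟨by omega, ?_, fun y h1 h2 => by omega⟩
    rcases (show x + 1 = k ∨ x + 1 < k by have := hx.1; omega) with h1 | h1
    · rw [h1]; exact hx.2.1
    · exact lt_of_lt_of_le hx.2.1 (hx.2.2 _ (by omega) h1)
  have hmin : blockMin (D.partition.part k) = x + 1 := by
    have hxk := hx.1
    apply le_antisymm
    · refine blockMin_le (D.mem_part_iff.2 ⟨hk, by rw [Finset.mem_Icc]; omega, ?_⟩)
      exact (D.visible_iff_isPrev ha hab hh hD (by omega) (by omega) hx hx1).2 rfl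
    · obtain ⟨-, h1, h2⟩ := D.mem_part_iff.1 (blockMin_mem (D.partition.part_nonempty.2 hk))
      rw [Finset.mem_Icc] at h1
      obtain ⟨y, hy⟩ := exists_isPrev hcop hh h1.1
        (show blockMin (D.partition.part k) < b by omega)
      have := (D.visible_iff_isPrev ha hab hh hD (by omega) (by omega) hx hy).1 h2
      have := hy.1
      omega
  rw [hmin]
  exact ⟨by omega, by simpa using hx⟩

theorem HasLevel.part_eq_iff {π : Finpartition (Finset.Icc 1 (b - 1))} (hπ : HasLevel a b π h)
    {k l x y : ℕ} (hk : k ∈ Finset.Icc 1 (b - 1)) (hl : l ∈ Finset.Icc 1 (b - 1))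
    (hx : IsPrev (level a b h) x k) (hy : IsPrev (level a b h) y l) :
    π.part k = π.part l ↔ x = y := by
  obtain ⟨h1, h2⟩ := hπ k hk
  obtain ⟨h3, h4⟩ := hπ l hl
  rw [hx.unique h2, hy.unique h4]
  constructor
  · intro h; rw [h]
  · intro h; exact part_eq_of_blockMin_eq π hk hl (by omega)

theorem HasLevel.mem_NC (ha : 0 < a) (hab : a < b) (hcop : Nat.Coprime a b)
    (hh : IsHeight a b h) {π : Finpartition (Finset.Icc 1 (b - 1))} (hπ : HasLevel a b π h) :
    π ∈ NC a b := by
  obtain ⟨D, hD⟩ := hh.exists_dyckPath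
  refine ⟨D, ?_⟩
  have hDl := D.partition_hasLevel ha hab hcop hh hD
  refine eq_of_part_eq_iff fun k hk l hl => ?_
  rw [hDl.part_eq_iff hk hl (hπ k hk).2 (hπ l hl).2, hπ.part_eq_iff hk hl (hπ k hk).2 (hπ l hl).2]

/-- Off the block minima the previous smaller position lies before `k - 1`, so the level does not
rise at `k`, whereas a single north step would raise it by at least `b - a > 0`. -/
theorem HasLevel.height_eq (ha : 0 < a) (hab : a < b) (hh : IsHeight a b h)
    {π : Finpartition (Finset.Icc 1 (b - 1))} (hπ : HasLevel a b π h) {k : ℕ}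
    (hk : k ∈ Finset.Icc 1 (b - 1)) (hne : blockMin (π.part k) ≠ k) : h k = h (k - 1) := by
  obtain ⟨h1, h2⟩ := hπ k hk
  rw [Finset.mem_Icc] at hk
  have hlt : blockMin (π.part k) - 1 < k - 1 := by have := h2.1; omega
  have h3 := h2.2.2 (k - 1) hlt (by omega)
  have h4 := level_succ (a := a) (b := b) (h := h) (k - 1)
  rw [Nat.sub_add_cancel hk.1] at h4
  have h5 := hh.mono (k - 1) (by omega)
  rw [Nat.sub_add_cancel hk.1] at h5
  by_contra hc
  have h6 : (1 : ℤ) ≤ (h k : ℤ) - h (k - 1) := by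
    have : h (k - 1) + 1 ≤ h k := by omega
    have : (h (k - 1) : ℤ) + 1 ≤ h k := by exact_mod_cast this
    linarith
  have hab' : (a : ℤ) < b := by exact_mod_cast hab
  have := mul_le_mul_of_nonneg_left h6 (show (0 : ℤ) ≤ b by omega)
  linarith

/-- With `m` and `M` the extreme labels, the ceiling is pinned by `level (m - 1) < level M ≤ level
(m - 1) + a`. If the second inequality failed, the first later `y` with `level y < level M` would
still be above `level (m - 1)`, as a step lowers the level by at most `a`. Then `y` would be a label
of `B` beyond `M`, or `y = b`, whose level is `0`. -/
theorem HasLevel.height_sub_eq (ha : 0 < a) (hab : a < b)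
    (hh : IsHeight a b h) {π : Finpartition (Finset.Icc 1 (b - 1))} (hπ : HasLevel a b π h)
    {B : Finset ℕ} (hB : B ∈ π.parts) :
    ⌈((blockMax B : ℚ) - (blockMin B : ℚ) + 1) * ((a : ℚ) / b)⌉ =
      (h (blockMax B) : ℤ) - h (blockMin B - 1) := by
  have hne := π.nonempty_of_mem_parts hB
  have hMB := blockMax_mem hne
  have hM : blockMax B ∈ Finset.Icc 1 (b - 1) := π.le hB hMB
  have hpM : π.part (blockMax B) = B := π.part_eq_of_mem hB hMB
  obtain ⟨h1, h2⟩ := hπ _ hM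
  rw [hpM] at h1 h2
  set m := blockMin B with hm
  set M := blockMax B with hMdef
  have hM' := Finset.mem_Icc.1 hM
  have hup : level a b h M ≤ level a b h (m - 1) + a := by
    by_contra hc
    classical
    have hmb := level_nonneg hh (show m - 1 ≤ b by have := h2.1; omega)
    have hex : ∃ y, M < y ∧ level a b h y < level a b h M :=
      ⟨b, by omega, by rw [level_last hh]; omega⟩
    obtain ⟨h3, h4⟩ := Nat.find_spec hex
    have h5 : Nat.find hex ≤ b :=
      Nat.find_min' hex ⟨by omega, by rw [level_last hh]; omega⟩
    set y := Nat.find hex with hy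
    have h6 : level a b h M ≤ level a b h (y - 1) := by
      rcases (show y - 1 = M ∨ M < y - 1 by omega) with h | h
      · rw [h]
      · by_contra h7
        exact Nat.find_min hex (m := y - 1) (by omega) ⟨h, not_le.1 h7⟩
    have h7 : level a b h (m - 1) < level a b h y := by
      have h8 := level_succ (a := a) (b := b) (h := h) (y - 1)
      have h9 := hh.mono (y - 1) (by omega)
      rw [Nat.sub_add_cancel (by omega)] at h8 h9
      have : (0 : ℤ) ≤ b * ((h y : ℤ) - h (y - 1)) :=
        mul_nonneg (by omega) (by have : (h (y - 1) : ℤ) ≤ h y := by exact_mod_cast h9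
                                  linarith)
      linarith
    rcases h5.eq_or_lt with h8 | h8
    · rw [h8, level_last hh] at h7; omega
    · have hyI : y ∈ Finset.Icc 1 (b - 1) := Finset.mem_Icc.2 ⟨by omega, by omega⟩
      have hpy : IsPrev (level a b h) (m - 1) y := by
        refine ⟨by have := h2.1; omega, h7, fun z hz1 hz2 => ?_⟩
        rcases lt_trichotomy z M with h9 | h9 | h9
        · exact h4.le.trans (h2.2.2 z hz1 h9)
        · rw [h9]; exact h4.le
        · by_contra h10
          exact Nat.find_min hex hz2 ⟨h9, by omega⟩
      have := (hπ.part_eq_iff hM hyI h2 hpy).2 rfl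
      rw [hpM] at this
      have := le_blockMax (B := B) (k := y) (by rw [this]; exact π.mem_part_self.2 hyI)
      omega
  have hlo := h2.2.1
  rw [level, level] at hup hlo
  have hb : (0 : ℚ) < b := by exact_mod_cast ha.trans hab
  have hcast : ((m - 1 : ℕ) : ℤ) = m - 1 := by omega
  rw [hcast] at hup hlo
  rw [Int.ceil_eq_iff]
  have hab' : (a : ℚ) < b := by exact_mod_cast hab
  have hup' : (b : ℚ) * h M - a * M ≤ b * h (m - 1) - a * (m - 1) + a := by exact_mod_cast hup
  have hlo' : (b : ℚ) * h (m - 1) - a * (m - 1) < b * h M - a * M := by exact_mod_cast hlo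
  push_cast
  constructor
  · rw [← mul_div_assoc, lt_div_iff₀ hb]; linarith
  · rw [← mul_div_assoc, div_le_iff₀ hb]; linarith

/-- The rank of a block is the length of the vertical run of the path just before its minimum. -/
theorem HasLevel.rank_eq (ha : 0 < a) (hab : a < b)
    (hh : IsHeight a b h) {π : Finpartition (Finset.Icc 1 (b - 1))} (hπ : HasLevel a b π h)
    {B : Finset ℕ} (hB : B ∈ π.parts) :
    rank a b π B = (h (blockMin B) : ℤ) - h (blockMin B - 1) := by
  have key : ∀ (c : ℕ) (B : Finset ℕ), B ∈ π.parts → (hull B).card = c →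
      rank a b π B = (h (blockMin B) : ℤ) - h (blockMin B - 1) := by
    intro c
    induction c using Nat.strong_induction_on with
    | _ c ih =>
      intro B hB hc
      have hne := π.nonempty_of_mem_parts hB
      have h1 := sum_rank a b π hB
      rw [hπ.height_sub_eq ha hab hh hB] at h1
      have hMI := Finset.mem_Icc.1 (π.le hB (blockMax_mem hne))
      have hmI := Finset.mem_Icc.1 (π.le hB (blockMin_mem hne))
      have hmM := blockMin_le (blockMax_mem hne)
      have hpM : π.part (blockMax B) = B := π.part_eq_of_mem hB (blockMax_mem hne)
      -- Telescoping: within the hull of `B` the path rises only at block minima, and a block with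
      -- its minimum there has its whole hull there.
      have h2 : ∑ B' ∈ π.parts with hull B' ⊆ hull B,
          ((h (blockMin B') : ℤ) - h (blockMin B' - 1)) =
          h (blockMax B) - h (blockMin B - 1) := by
        have hinj : ∀ C ∈ π.parts.filter fun B' => hull B' ⊆ hull B,
            ∀ C' ∈ π.parts.filter fun B' => hull B' ⊆ hull B, blockMin C = blockMin C' →
              C = C' := by
          intro C hC C' hC' he
          have hC := (Finset.mem_filter.1 hC).1
          have hC' := (Finset.mem_filter.1 hC').1
          exact π.eq_of_mem_parts hC hC' (blockMin_mem (π.nonempty_of_mem_parts hC))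
            (he ▸ blockMin_mem (π.nonempty_of_mem_parts hC'))
        rw [← Finset.sum_image (f := fun k : ℕ => (h k : ℤ) - h (k - 1)) (g := blockMin) hinj]
        have htel : ∑ k ∈ Finset.Icc (blockMin B) (blockMax B), ((h k : ℤ) - h (k - 1)) =
            h (blockMax B) - h (blockMin B - 1) := by
          have : ∀ M, blockMin B ≤ M → ∑ k ∈ Finset.Icc (blockMin B) M, ((h k : ℤ) - h (k - 1)) =
            h M - h (blockMin B - 1) := by
            intro M hM
            induction M, hM using Nat.le_induction with
            | base => simp
            | succ M hM ih =>
              rw [← Finset.insert_Icc_right_eq_Icc_add_one (by omega), Finset.sum_insert (by simp),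
                ih, Nat.add_sub_cancel]
              ring
          exact this _ hmM
        rw [← htel]
        refine Finset.sum_subset ?_ ?_
        · intro k hk
          obtain ⟨C, hC, rfl⟩ := Finset.mem_image.1 hk
          obtain ⟨hC, hCB⟩ := Finset.mem_filter.1 hC
          exact hCB (Finset.left_mem_Icc.2 (blockMin_le (blockMax_mem
            (π.nonempty_of_mem_parts hC))))
        · intro k hk hk'
          rw [Finset.mem_Icc] at hk
          have hkI : k ∈ Finset.Icc 1 (b - 1) := Finset.mem_Icc.2 ⟨by omega, by omega⟩
          rw [hπ.height_eq ha hab hh hkI, sub_self]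
          intro hmin
          apply hk'
          refine Finset.mem_image.2 ⟨π.part k, Finset.mem_filter.2 ⟨π.part_mem.2 hkI, ?_⟩, hmin⟩
          rw [hull, hull, hmin]
          refine Finset.Icc_subset_Icc hk.1 ?_
          by_contra hlt
          have hlI := π.part_subset k (blockMax_mem (π.part_nonempty.2 hkI))
          have hpl : π.part (blockMax (π.part k)) = π.part k :=
            π.part_eq_of_mem (π.part_mem.2 hkI) (blockMax_mem (π.part_nonempty.2 hkI))
          obtain ⟨-, h3⟩ := hπ _ hlI
          obtain ⟨-, h4⟩ := hπ _ (π.le hB (blockMax_mem hne))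
          rw [hpl, hmin] at h3
          rw [hpM] at h4
          have h5 := h3.2.2 (blockMax B) (by omega) (by omega)
          have h6 := h3.2.1
          rcases hk.1.eq_or_lt with h7 | h7
          · have hBk : π.part k = B := π.part_eq_of_mem hB (h7 ▸ blockMin_mem hne)
            rw [hBk] at hlt
            omega
          · have := h4.2.2 (k - 1) (by omega) (by omega)
            omega
      rw [← h2] at h1
      have hmem : B ∈ π.parts.filter fun B' => hull B' ⊆ hull B :=
        Finset.mem_filter.2 ⟨hB, subset_rfl⟩
      rw [← Finset.add_sum_erase _ _ hmem, ← Finset.add_sum_erase _ _ hmem] at h1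
      have h3 : ∑ B' ∈ (π.parts.filter fun B' => hull B' ⊆ hull B).erase B, rank a b π B' =
          ∑ B' ∈ (π.parts.filter fun B' => hull B' ⊆ hull B).erase B,
            ((h (blockMin B') : ℤ) - h (blockMin B' - 1)) := by
        refine Finset.sum_congr rfl fun C hC => ?_
        obtain ⟨hCne, hC⟩ := Finset.mem_erase.1 hC
        obtain ⟨hC, hCB⟩ := Finset.mem_filter.1 hC
        refine ih _ ?_ C hC rfl
        rw [← hc]
        exact Finset.card_lt_card (lt_of_le_of_ne hCB fun he => hCne (hull_injOn π hC hB he))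
      linarith
  exact key _ B hB rfl

end Linear


/-! ### Potentials of periodic sequences and labels modulo `n` -/

section Potential

variable {a c n : ℤ} {t G : ℤ → ℤ}

theorem exists_potential (a c : ℤ) (t : ℤ → ℤ) :
    ∃ G : ℤ → ℤ, G 0 = 0 ∧ ∀ x, G x = G (x - 1) + c * t x - a := by
  refine ⟨fun x => c * (∑ i ∈ Finset.Ioc 0 x, t i - ∑ i ∈ Finset.Ioc x 0, t i) - a * x,
    by simp, fun x => ?_⟩
  rcases le_or_gt x 0 with hx | hx
  · have h1 : Finset.Ioc (x - 1) 0 = insert x (Finset.Ioc x 0) := by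
      ext i; simp only [Finset.mem_Ioc, Finset.mem_insert]; omega
    have h2 : Finset.Ioc 0 x = ∅ := Finset.Ioc_eq_empty (by omega)
    have h3 : Finset.Ioc 0 (x - 1) = ∅ := Finset.Ioc_eq_empty (by omega)
    simp only [h1, h2, h3, Finset.sum_empty]
    rw [Finset.sum_insert (by simp)]
    ring
  · have h1 : Finset.Ioc 0 x = insert x (Finset.Ioc 0 (x - 1)) := by
      ext i; simp only [Finset.mem_Ioc, Finset.mem_insert]; omega
    have h2 : Finset.Ioc x 0 = ∅ := Finset.Ioc_eq_empty (by omega)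
    have h3 : Finset.Ioc (x - 1) 0 = ∅ := Finset.Ioc_eq_empty (by omega)
    simp only [h1, h2, h3, Finset.sum_empty]
    rw [Finset.sum_insert (by simp)]
    ring

theorem eq_of_pred_eq {F : ℤ → ℤ} (hF : ∀ x, F x = F (x - 1)) (x : ℤ) : F x = F 0 := by
  induction x with
  | zero => rfl
  | succ i ih => rw [hF, add_sub_cancel_right, ih]
  | pred i ih => rw [← hF, ih]

theorem potential_add (hG : ∀ x, G x = G (x - 1) + c * t x - a) (ht : ∀ x, t (x + n) = t x)
    (x : ℤ) : G (x + n) = G x + (G n - G 0) := by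
  have := eq_of_pred_eq (F := fun x => G (x + n) - G x) (fun x => by
    rw [hG (x + n), hG x, ht, show x + n - 1 = x - 1 + n by ring]
    ring) x
  simp only [zero_add] at this
  linarith

theorem potential_add_mul (hG : ∀ x, G x = G (x - 1) + c * t x - a) (ht : ∀ x, t (x + n) = t x)
    (x k : ℤ) : G (x + k * n) = G x + k * (G n - G 0) := by
  induction k with
  | zero => simp
  | succ i ih =>
    rw [show x + ((i : ℤ) + 1) * n = x + i * n + n by ring, potential_add hG ht, ih]; ring
  | pred i ih =>
    have := potential_add hG ht (x + (-(i : ℤ) - 1) * n)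
    rw [show x + (-(i : ℤ) - 1) * n + n = x + -i * n by ring, ih] at this
    linarith

end Potential

open scoped Classical in
theorem Starts.sum_eq {ι : Type*} {n : ℤ} {κ : ℤ → ι} {ω : ι → ℤ} {P : ℤ → Prop} {t : ℤ → ℤ}
    (hS : Starts n κ P) (ht : ∀ x, t x = if P x then ω (κ x) else 0)
    (hall : ∀ x ∈ Finset.Ioc 0 n, ∃ p ∈ Finset.Ioc 0 n, P p ∧ κ p = κ x) :
    ∑ x ∈ Finset.Ioc 0 n, t x = ∑ C ∈ (Finset.Ioc 0 n).image κ, ω C := by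
  rw [sum_starts ht]
  · congr 1
    refine (Finset.image_subset_image (Finset.filter_subset _ _)).antisymm fun C hC => ?_
    obtain ⟨x, hx, rfl⟩ := Finset.mem_image.1 hC
    obtain ⟨p, hp, hPp, hpx⟩ := hall x hx
    exact Finset.mem_image.2 ⟨p, Finset.mem_filter.2 ⟨hp, hPp⟩, hpx⟩
  · intro x hx y hy hPx hPy hxy
    simp only [Finset.mem_Ioc] at hx hy
    exact hS.eq_of_abs hPx hPy hxy (by omega) (by omega)

/-- The representative in `{1, …, n}` of an integer modulo `n`. -/
def label (n : ℕ) (x : ℤ) : ℕ := ((x - 1) % n).toNat + 1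

theorem label_spec {n : ℕ} (hn : 0 < n) (x : ℤ) :
    1 ≤ label n x ∧ label n x ≤ n ∧ ∃ k : ℤ, x = label n x + k * n := by
  have h1 := Int.emod_nonneg (x - 1) (show (n : ℤ) ≠ 0 by omega)
  have h2 := Int.emod_lt_of_pos (x - 1) (show (0 : ℤ) < n by omega)
  have h3 := Int.emod_add_ediv_mul (x - 1) n
  refine ⟨by rw [label]; omega, by rw [label]; omega, (x - 1) / n, ?_⟩
  rw [label]
  push_cast
  rw [Int.toNat_of_nonneg h1]
  linarith

theorem label_mem {n : ℕ} (hn : 0 < n) (x : ℤ) : label n x ∈ Finset.Icc 1 n :=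
  Finset.mem_Icc.2 ⟨(label_spec hn x).1, (label_spec hn x).2.1⟩

theorem label_add_mul (n : ℕ) (x k : ℤ) : label n (x + k * n) = label n x := by
  rw [label, label, show x + k * n - 1 = x - 1 + k * n by ring, Int.add_mul_emod_self_right]

theorem label_add (n : ℕ) (x : ℤ) : label n (x + n) = label n x := by
  simpa using label_add_mul n x 1

theorem label_natCast {n k : ℕ} (hk : k ∈ Finset.Icc 1 n) : label n k = k := by
  rw [Finset.mem_Icc] at hk
  rw [label, Int.emod_eq_of_lt (by omega) (by omega)]
  omega

theorem label_eq_iff {n : ℕ} (hn : 0 < n) {x y : ℤ} :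
    label n x = label n y ↔ ∃ k : ℤ, y = x + k * n := by
  constructor
  · intro h
    obtain ⟨-, -, j, hj⟩ := label_spec hn x
    obtain ⟨-, -, k, hk⟩ := label_spec hn y
    exact ⟨k - j, by rw [hk, ← h]; nth_rewrite 2 [hj]; ring⟩
  · rintro ⟨k, rfl⟩
    rw [label_add_mul]

/-- The block of `π` containing the label `x`, taken modulo `n`. -/
def cyc {n : ℕ} (π : Finpartition (Finset.Icc 1 n)) (x : ℤ) : Finset ℕ := π.part (label n x)

section Cyc

variable {n : ℕ} {π : Finpartition (Finset.Icc 1 n)}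

theorem cyc_add (x : ℤ) : cyc π (x + n) = cyc π x := by rw [cyc, cyc, label_add]

theorem cyc_add_mul (x k : ℤ) : cyc π (x + k * n) = cyc π x := by
  rw [cyc, cyc, label_add_mul]

theorem cyc_mem_parts (hn : 0 < n) (x : ℤ) : cyc π x ∈ π.parts := π.part_mem.2 (label_mem hn x)

theorem label_mem_cyc (hn : 0 < n) (x : ℤ) : label n x ∈ cyc π x := π.mem_part (label_mem hn x)

theorem cyc_natCast {k : ℕ} (hk : k ∈ Finset.Icc 1 n) : cyc π k = π.part k := by
  rw [cyc, label_natCast hk]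

theorem cyc_of_mem {B : Finset ℕ} (hB : B ∈ π.parts) {k : ℕ} (hk : k ∈ B) : cyc π k = B := by
  rw [cyc_natCast (π.le hB hk)]; exact π.part_eq_of_mem hB hk

theorem mem_cyc_iff (hn : 0 < n) {k : ℕ} (hk : k ∈ Finset.Icc 1 n) (x : ℤ) :
    k ∈ cyc π x ↔ cyc π k = cyc π x := by
  rw [cyc_natCast hk, cyc, Finpartition.mem_part_iff_part_eq_part _ hk (label_mem hn x)]

/-- The label `x` is the minimum of its block. -/
def IsFirst (π : Finpartition (Finset.Icc 1 n)) (x : ℤ) : Prop := blockMin (cyc π x) = label n x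

/-- Works in the translate of `{1, …, n}` that contains `x`, where the minimum of the block sits at
or before `x`. -/
theorem exists_isFirst (hn : 0 < n) (x : ℤ) : ∃ k : ℤ, x = label n x + k * n ∧
    IsFirst π (blockMin (cyc π x) + k * n) ∧ cyc π (blockMin (cyc π x) + k * n) = cyc π x ∧
    1 ≤ blockMin (cyc π x) ∧ blockMin (cyc π x) ≤ label n x := by
  obtain ⟨h1, h2, k, hk⟩ := label_spec hn x
  have hB := cyc_mem_parts (π := π) hn x
  have hm := blockMin_mem (π.nonempty_of_mem_parts hB)
  have hmI := π.le hB hm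
  have hc := cyc_of_mem hB hm
  refine ⟨k, hk, ?_, ?_, (Finset.mem_Icc.1 hmI).1, blockMin_le (label_mem_cyc hn x)⟩
  · rw [IsFirst, cyc_add_mul, label_add_mul, hc, label_natCast hmI]
  · rw [cyc_add_mul, hc]

theorem starts_isFirst (hn : 0 < n) : Starts (n : ℤ) (cyc π) (IsFirst π) := by
  refine ⟨fun x => by rw [IsFirst, IsFirst, cyc_add, label_add], fun x y hx hy h hxy => ?_⟩
  rw [IsFirst] at hx hy
  obtain ⟨k, rfl⟩ := (label_eq_iff hn).1 (hx.symm.trans ((congrArg blockMin h).trans hy))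
  have hn' : (0 : ℤ) < n := by omega
  have : 0 < k := by
    by_contra hk
    have := mul_nonpos_of_nonpos_of_nonneg (not_lt.1 hk) hn'.le
    omega
  have := mul_le_mul_of_nonneg_right (show 1 ≤ k by omega) hn'.le
  omega

theorem exists_isFirst_Ioc (hn : 0 < n) (x : ℤ) :
    ∃ p ∈ Finset.Ioc (0 : ℤ) n, IsFirst π p ∧ cyc π p = cyc π x := by
  have hB := cyc_mem_parts (π := π) hn x
  have hm := blockMin_mem (π.nonempty_of_mem_parts hB)
  have hmI := π.le hB hm
  have hmI' := Finset.mem_Icc.1 hmI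
  refine ⟨blockMin (cyc π x), Finset.mem_Ioc.2 ⟨by omega, by omega⟩, ?_, cyc_of_mem hB hm⟩
  rw [IsFirst, cyc_of_mem hB hm, label_natCast hmI]

end Cyc

/-! ### `NC a b` as the valid weighted partitions of the cycle -/

section Characterization

variable {a b : ℕ} {h : ℕ → ℕ} {π : Finpartition (Finset.Icc 1 (b - 1))}

/-- The point `(b - 1, a - 1)` is below the line since `a < b`. Consequently the level at `b - 1` is
`a`, which is the drift of the potential per turn of the cycle. -/
theorem IsHeight.last_pred (ha : 0 < a) (hab : a < b) (hh : IsHeight a b h) : h (b - 1) = a := by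
  have h1 := hh.above (b - 1) (by omega)
  have h2 := hh.mono (b - 1) (by omega)
  rw [Nat.sub_add_cancel (by omega), hh.last] at h2
  refine le_antisymm h2 ?_
  by_contra hc
  obtain ⟨c, rfl⟩ : ∃ c, b = c + 1 := ⟨b - 1, by omega⟩
  obtain ⟨e, rfl⟩ : ∃ e, a = e + 1 := ⟨a - 1, by omega⟩
  rw [Nat.add_sub_cancel] at *
  have := Nat.mul_le_mul_left (c + 1) (show h c ≤ e by omega)
  nlinarith

open scoped Classical in
-- With block minima as starts, the potential agrees with the level on `[0, b - 1]` and gains `a`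
-- per turn. So the description by last smaller positions becomes `Fibres`, and `Fibres.valid`
-- applies.
theorem HasLevel.valid (ha : 0 < a) (hab : a < b) (hcop : Nat.Coprime a b)
    (hh : IsHeight a b h) (hπ : HasLevel a b π h) :
    Valid (a : ℤ) ((b - 1 : ℕ) : ℤ) (cyc π) (rank a b π) := by
  have hn0 : 0 < b - 1 := by omega
  have hnb : ((b - 1 : ℕ) : ℤ) + 1 = b := by omega
  have hn0' : (0 : ℤ) < ((b - 1 : ℕ) : ℤ) := by omega
  set t : ℤ → ℤ := fun x => if IsFirst π x then rank a b π (cyc π x) else 0 with ht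
  have hper : ∀ x, cyc π (x + ((b - 1 : ℕ) : ℤ)) = cyc π x := cyc_add
  have hS := starts_isFirst (π := π) hn0
  have htper : ∀ x, t (x + ((b - 1 : ℕ) : ℤ)) = t x := fun x => by
    simp only [ht, hper, hS.per]
  obtain ⟨G, hG0, hG⟩ := exists_potential (a : ℤ) (((b - 1 : ℕ) : ℤ) + 1) t
  have htk : ∀ k ∈ Finset.Icc 1 (b - 1), t k = (h k : ℤ) - h (k - 1) := by
    intro k hk
    simp only [ht, IsFirst, label_natCast hk, cyc_natCast hk]
    split_ifs with hmin
    · rw [hπ.rank_eq ha hab hh (π.part_mem.2 hk), hmin]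
    · rw [hπ.height_eq ha hab hh hk hmin, sub_self]
  have hGk : ∀ k : ℕ, k ≤ b - 1 → G k = level a b h k := by
    intro k
    induction k with
    | zero => intro _; rw [level_zero hh]; exact_mod_cast hG0
    | succ k ih =>
      intro hk
      rw [hG, htk (k + 1) (Finset.mem_Icc.2 ⟨by omega, hk⟩), level_succ, hnb,
        show ((k + 1 : ℕ) : ℤ) - 1 = k by push_cast; ring, ih (by omega), Nat.add_sub_cancel]
  have hGn : G ((b - 1 : ℕ) : ℤ) = a := by
    rw [hGk _ le_rfl, level, hh.last_pred ha hab, ← hnb]; ring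
  have hGmul : ∀ x k : ℤ, G (x + k * ((b - 1 : ℕ) : ℤ)) = G x + k * a := by
    intro x k
    rw [potential_add_mul hG htper, hGn, hG0, sub_zero]
  have hlev : ∀ x, 1 ≤ blockMin (cyc π x) ∧
      IsPrev (level a b h) (blockMin (cyc π x) - 1) (label (b - 1) x) :=
    fun x => hπ _ (label_mem hn0 x)
  have hF : Fibres ((b - 1 : ℕ) : ℤ) (cyc π) (IsFirst π) G := by
    refine ⟨fun p y hp hy hpy hyn => ?_, fun z y hzy hno => ?_⟩
    · obtain ⟨-, -, j, hj⟩ := label_spec hn0 y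
      obtain ⟨p1, p2, k, hk⟩ := label_spec hn0 p
      obtain ⟨h1, h2⟩ := hlev y
      rw [IsFirst] at hp
      rw [hy, hp] at h1 h2
      have hlt := h2.1
      have hyn' := (label_spec hn0 y).2.1
      have hjk : j = k := by
        have e : y - p = (label (b - 1) y : ℤ) - label (b - 1) p +
            (j - k) * ((b - 1 : ℕ) : ℤ) := by
          nth_rewrite 1 [hj, hk]; ring
        rcases lt_trichotomy j k with h | h | h
        · have := mul_le_mul_of_nonneg_right (show j - k ≤ -1 by omega) hn0'.le
          omega
        · exact h
        · have := mul_le_mul_of_nonneg_right (show 1 ≤ j - k by omega) hn0'.le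
          omega
      subst hjk
      rw [hj, hk, show (label (b - 1) p : ℤ) + j * ((b - 1 : ℕ) : ℤ) - 1 =
        ((label (b - 1) p - 1 : ℕ) : ℤ) + j * ((b - 1 : ℕ) : ℤ) by omega, hGmul, hGmul,
        hGk _ (by omega), hGk _ hyn']
      linarith [h2.2.1]
    · obtain ⟨j, hj, hf, hc, h1, h2⟩ := exists_isFirst (π := π) hn0 y
      have hyn' := (label_spec hn0 y).2.1
      have hmz : (blockMin (cyc π y) : ℤ) + j * ((b - 1 : ℕ) : ℤ) ≤ z := by
        by_contra hcon
        exact hno _ (not_le.1 hcon) (by omega) hc hf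
      obtain ⟨z', hz'⟩ : ∃ z' : ℕ, z = z' + j * ((b - 1 : ℕ) : ℤ) :=
        ⟨(z - j * ((b - 1 : ℕ) : ℤ)).toNat, by omega⟩
      have hzlt : z' < label (b - 1) y := by omega
      have h3 := (hlev y).2.2.2 z' (by omega) hzlt
      -- Coprimality turns the weak inequality of `IsPrev` into the strict one of `Fibres`.
      have h4 := level_ne (h := h) hcop hzlt (by omega)
      rw [hj, hz', hGmul, hGmul, hGk _ hyn', hGk z' (by omega)]
      omega
  refine hF.valid (t := t) hn0' hper hS (fun x _ hx _ => ?_) (fun x => ?_) ?_ (fun x => rfl) hG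
  · obtain ⟨j, -, hf, hc, -⟩ := exists_isFirst (π := π) hn0 x
    exact absurd hf (hx _ hc)
  · have hB := cyc_mem_parts (π := π) hn0 x
    have hm := blockMin_mem (π.nonempty_of_mem_parts hB)
    have hmI := π.le hB hm
    rw [hπ.rank_eq ha hab hh hB]
    obtain ⟨h1, h2⟩ := hlev (blockMin (cyc π x))
    rw [cyc_of_mem hB hm, label_natCast hmI] at h2
    rw [cyc_of_mem hB hm] at h1
    have h3 := level_succ (a := a) (b := b) (h := h) (blockMin (cyc π x) - 1)
    rw [Nat.sub_add_cancel h1] at h3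
    have h4 := h2.2.1
    by_contra hc
    have := mul_nonpos_of_nonneg_of_nonpos (show (0 : ℤ) ≤ b by omega) (not_lt.1 hc)
    omega
  · have h1 := potential_sub hG hn0'.le
    rw [hGn, hG0, hS.sum_eq (t := t) (ω := rank a b π) (fun x => rfl)
      fun x _ => exists_isFirst_Ioc hn0 x] at h1
    have hb : (((b - 1 : ℕ) : ℤ) + 1) ≠ 0 := by omega
    refine mul_left_cancel₀ hb ?_
    linarith

open scoped Classical in
-- For block minima, the compatibility of starts needed by `Valid.fibres` follows from noncrossing.
-- The height is the running sum of the weights placed at the minima.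
theorem Valid.exists_hasLevel (ha : 0 < a) (hab : a < b) {ω : Finset ℕ → ℤ}
    (hV : Valid (a : ℤ) ((b - 1 : ℕ) : ℤ) (cyc π) ω) :
    ∃ h, IsHeight a b h ∧ HasLevel a b π h ∧
      ∀ B ∈ π.parts, ω B = (h (blockMin B) : ℤ) - h (blockMin B - 1) := by
  have hn0 : 0 < b - 1 := by omega
  have hnb : ((b - 1 : ℕ) : ℤ) + 1 = b := by omega
  have hn0' : (0 : ℤ) < ((b - 1 : ℕ) : ℤ) := by omega
  set t : ℤ → ℤ := fun x => if IsFirst π x then ω (cyc π x) else 0 with ht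
  have hS := starts_isFirst (π := π) hn0
  obtain ⟨G, hG0, hG⟩ := exists_potential (a : ℤ) (((b - 1 : ℕ) : ℤ) + 1) t
  have hF : Fibres ((b - 1 : ℕ) : ℤ) (cyc π) (IsFirst π) G := by
    refine hV.fibres (t := t) hn0' hS (fun l l' z hlz hzl' hll' hcons hl' => ?_) (fun x => rfl) hG
    obtain ⟨j, hj, hf, hc, h1, h2⟩ := exists_isFirst (π := π) hn0 l'
    have hne : blockMin (cyc π l') ≠ label (b - 1) l' := hl'
    have hml : (blockMin (cyc π l') : ℤ) + j * ((b - 1 : ℕ) : ℤ) ≤ l := by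
      by_contra hcon
      exact hcons _ (not_le.1 hcon) (by omega) (hc.trans hll'.symm)
    obtain ⟨k, hk, gf, gc, g1, g2⟩ := exists_isFirst (π := π) hn0 z
    have hl'n := (label_spec hn0 l').2.1
    have hzn := (label_spec hn0 z).2.1
    have hjk : k = j := by
      have e : l' - z = (label (b - 1) l' : ℤ) - label (b - 1) z +
          (j - k) * ((b - 1 : ℕ) : ℤ) := by
        nth_rewrite 1 [hj, hk]; ring
      rcases lt_trichotomy j k with h | h | h
      · have := mul_le_mul_of_nonneg_right (show j - k ≤ -1 by omega) hn0'.le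
        omega
      · exact h.symm
      · have := mul_le_mul_of_nonneg_right (show k ≤ j - 1 by omega) hn0'.le
        have e2 : (j - 1) * ((b - 1 : ℕ) : ℤ) = j * ((b - 1 : ℕ) : ℤ) - ((b - 1 : ℕ) : ℤ) := by
          ring
        omega
    subst hjk
    have hzl := hcons z hlz hzl'
    refine ⟨_, ?_, by omega, gf, gc⟩
    by_contra hcon
    have hpl : (blockMin (cyc π z) : ℤ) + k * ((b - 1 : ℕ) : ℤ) ≠ l := fun h => hzl (by
      rw [← gc, h])
    exact hzl (gc.symm.trans (hV.noncross _ l z l' (by omega) hlz hzl' (by omega) gc hll'))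
  have htn : ∀ x, 0 ≤ t x := fun x => by
    simp only [ht]
    split_ifs
    · exact (hV.pos x).le
    · rfl
  have htot : ∑ x ∈ Finset.Ioc (0 : ℤ) ((b - 1 : ℕ) : ℤ), t x = a := by
    rw [hS.sum_eq (t := t) (ω := ω) (fun x => rfl) fun x _ => exists_isFirst_Ioc hn0 x, hV.total]
  -- The truncation at `b - 1` keeps the height constant at the last east step, which carries no
  -- label.
  set h : ℕ → ℕ := fun k =>
    (∑ x ∈ Finset.Ioc (0 : ℤ) ((min k (b - 1) : ℕ) : ℤ), t x).toNat with hdef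
  have hh : ∀ k ≤ b - 1, (h k : ℤ) = ∑ x ∈ Finset.Ioc (0 : ℤ) k, t x := by
    intro k hk
    simp only [hdef]
    rw [min_eq_left hk, Int.toNat_of_nonneg (Finset.sum_nonneg fun x _ => htn x)]
  have hGk : ∀ k : ℕ, k ≤ b - 1 → G k = level a b h k := by
    intro k hk
    have := potential_sub hG (show (0 : ℤ) ≤ k by omega)
    rw [hG0, ← hh k hk, hnb] at this
    rw [level]; linarith
  have hlast : h b = a := by
    have h1 := hh (b - 1) le_rfl
    rw [htot] at h1
    have h2 : h b = h (b - 1) := by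
      simp only [hdef]; rw [min_eq_right (by omega), min_self]
    omega
  have hfirst : ∀ k ∈ Finset.Icc 1 (b - 1), 1 ≤ blockMin (π.part k) ∧ blockMin (π.part k) ≤ k ∧
      IsFirst π (blockMin (π.part k)) ∧ cyc π (blockMin (π.part k)) = cyc π k := by
    intro k hk
    have hB := π.part_mem.2 hk
    have hm := blockMin_mem (π.nonempty_of_mem_parts hB)
    have hmI := π.le hB hm
    refine ⟨(Finset.mem_Icc.1 hmI).1, blockMin_le (π.mem_part hk), ?_, ?_⟩
    · rw [IsFirst, cyc_of_mem hB hm, label_natCast hmI]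
    · rw [cyc_of_mem hB hm, cyc_natCast hk]
  have hstart : ∀ k ∈ Finset.Icc 1 (b - 1),
      level a b h (blockMin (π.part k) - 1) < level a b h k := by
    intro k hk
    obtain ⟨h1, h2, h3, h4⟩ := hfirst k hk
    rw [Finset.mem_Icc] at hk
    have := hF.start_lt _ k h3 h4.symm (by omega) (by omega)
    rw [hGk k hk.2, show (blockMin (π.part k) : ℤ) - 1 = ((blockMin (π.part k) - 1 : ℕ) : ℤ) by
      omega, hGk _ (by omega)] at this
    exact this
  have hh0 : h 0 = 0 := by simp [hdef]
  have hnonneg : ∀ k ≤ b - 1, 0 ≤ level a b h k := by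
    intro k
    induction k using Nat.strong_induction_on with
    | _ k ih =>
      intro hk
      rcases Nat.eq_zero_or_pos k with rfl | hk0
      · rw [level, hh0]; simp
      · have hkI := Finset.mem_Icc.2 ⟨hk0, hk⟩
        obtain ⟨h1, h2, -⟩ := hfirst k hkI
        exact (ih (blockMin (π.part k) - 1) (by omega) (by omega)).trans (hstart k hkI).le
  have hstep : ∀ k, k + 1 ≤ b - 1 → (h (k + 1) : ℤ) = h k + t ((k + 1 : ℕ) : ℤ) := by
    intro k hk
    have : Finset.Ioc (0 : ℤ) ((k + 1 : ℕ) : ℤ) = insert ((k + 1 : ℕ) : ℤ)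
        (Finset.Ioc (0 : ℤ) k) := by
      ext i; simp only [Finset.mem_Ioc, Finset.mem_insert]; omega
    rw [hh _ hk, hh k (by omega), this, Finset.sum_insert (by simp)]
    ring
  refine ⟨h, ⟨hh0, hlast, fun k hk => ?_, fun k hk => ?_⟩, fun k hk => ?_, fun B hB => ?_⟩
  · rcases (show k + 1 ≤ b - 1 ∨ k + 1 = b by omega) with h1 | h1
    · have := hstep k h1
      have := htn ((k + 1 : ℕ) : ℤ)
      omega
    · have : k = b - 1 := by omega
      rw [h1, this]
      simp only [hdef]; rw [min_eq_right (a := b) (by omega), min_self]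
  · rcases (show k ≤ b - 1 ∨ k = b by omega) with h1 | h1
    · have := hnonneg k h1
      rw [level] at this
      zify
      linarith
    · rw [h1, hlast, mul_comm]
  · obtain ⟨h1, h2, h3, h4⟩ := hfirst k hk
    refine ⟨h1, by omega, hstart k hk, fun y hy1 hy2 => ?_⟩
    rw [Finset.mem_Icc] at hk
    have := hF.lt_of_no_start y k (by omega) fun x hx1 hx2 hx3 hx4 => by
      rw [IsFirst, hx3, cyc_natCast (Finset.mem_Icc.2 hk)] at hx4
      obtain ⟨x', rfl⟩ : ∃ x' : ℕ, x = x' := ⟨x.toNat, by omega⟩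
      rw [label_natCast (Finset.mem_Icc.2 ⟨by omega, by omega⟩)] at hx4
      omega
    rw [hGk k hk.2, hGk y (by omega)] at this
    exact this.le
  · have hm := blockMin_mem (π.nonempty_of_mem_parts hB)
    have hmI := π.le hB hm
    have hmI' := Finset.mem_Icc.1 hmI
    have h1 := hstep (blockMin B - 1) (by omega)
    rw [Nat.sub_add_cancel hmI'.1] at h1
    have h2 : t (blockMin B) = ω B := by
      have hf : IsFirst π (blockMin B) := by
        rw [IsFirst, cyc_of_mem hB hm, label_natCast hmI]
      simp only [ht]
      rw [if_pos hf, cyc_of_mem hB hm]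
    rw [h2] at h1
    omega

/-- A partition in `NC(a,b)`, weighted by its ranks, is valid. -/
theorem valid_of_mem_NC (ha : 0 < a) (hab : a < b) (hcop : Nat.Coprime a b) (hπ : π ∈ NC a b) :
    Valid (a : ℤ) ((b - 1 : ℕ) : ℤ) (cyc π) (rank a b π) := by
  obtain ⟨D, rfl⟩ := hπ
  obtain ⟨h, hh, hD⟩ := D.exists_height (ha.trans hab)
  exact (D.partition_hasLevel ha hab hcop hh hD).valid ha hab hcop hh

/-- A partition that is valid for some weights is in `NC(a,b)`, and the weights are its ranks. -/
theorem Valid.mem_NC (ha : 0 < a) (hab : a < b) (hcop : Nat.Coprime a b) {ω : Finset ℕ → ℤ}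
    (hV : Valid (a : ℤ) ((b - 1 : ℕ) : ℤ) (cyc π) ω) :
    π ∈ NC a b ∧ ∀ B ∈ π.parts, rank a b π B = ω B := by
  obtain ⟨h, hh, hl, hω⟩ := hV.exists_hasLevel ha hab
  exact ⟨hl.mem_NC ha hab hcop hh, fun B hB => by rw [hl.rank_eq ha hab hh hB, hω B hB]⟩

end Characterization


/-! ### Relabelling and rotating valid partitions -/

section Congruence

variable {ι ι' : Type*} {a n : ℤ} {κ : ℤ → ι} {κ' : ℤ → ι'} {ω : ι → ℤ} {ω' : ι' → ℤ}

open scoped Classical in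
theorem sum_image_congr (hκ : ∀ x y, κ x = κ y ↔ κ' x = κ' y) (hω : ∀ x, ω (κ x) = ω' (κ' x))
    (S : Finset ℤ) : ∑ C ∈ S.image κ, ω C = ∑ C ∈ S.image κ', ω' C := by
  have h1 : ∀ C ∈ S.image κ, ∃ x ∈ S, κ x = C := fun C hC => Finset.mem_image.1 hC
  refine Finset.sum_bij (fun C hC => κ' (h1 C hC).choose) (fun C hC => ?_) (fun C hC C' hC' h => ?_)
    (fun C hC => ?_) (fun C hC => ?_)
  · exact Finset.mem_image_of_mem _ (h1 C hC).choose_spec.1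
  · rw [← (h1 C hC).choose_spec.2, ← (h1 C' hC').choose_spec.2]
    exact (hκ _ _).2 h
  · obtain ⟨x, hx, rfl⟩ := Finset.mem_image.1 hC
    have hx' := Finset.mem_image_of_mem κ hx
    exact ⟨κ x, hx', (hκ _ _).1 (h1 _ hx').choose_spec.2⟩
  · rw [← hω, (h1 C hC).choose_spec.2]

theorem Valid.congr (hV : Valid a n κ ω) (hκ : ∀ x y, κ x = κ y ↔ κ' x = κ' y)
    (hω : ∀ x, ω (κ x) = ω' (κ' x)) : Valid a n κ' ω' := by
  refine ⟨fun x => (hκ _ _).1 (hV.per x), fun x y z u h1 h2 h3 h4 h5 h6 => ?_, fun x => ?_, ?_,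
    fun l l' h1 h2 h3 h4 => ?_⟩
  · exact (hκ _ _).1 (hV.noncross x y z u h1 h2 h3 h4 ((hκ _ _).2 h5) ((hκ _ _).2 h6))
  · rw [← hω]; exact hV.pos x
  · rw [← sum_image_congr hκ hω]; exact hV.total
  · rw [← sum_image_congr hκ hω]
    exact hV.gap l l' h1 h2 ((hκ _ _).2 h3) fun y hy1 hy2 h => h4 y hy1 hy2 ((hκ _ _).1 h)

/-- No clause of `Valid` depends on the cut; only the window in the total weight has to be moved
back. -/
theorem Valid.shift (hn : 0 < n) (hV : Valid a n κ ω) (e : ℤ) :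
    Valid a n (fun x => κ (x + e)) ω := by
  classical
  have himg : ∀ S : Finset ℤ, S.image (fun x => κ (x + e)) = (S.image (· + e)).image κ := by
    intro S; rw [Finset.image_image]; rfl
  refine ⟨fun x => ?_, fun x y z u h1 h2 h3 h4 h5 h6 => ?_, fun x => hV.pos _, ?_,
    fun l l' h1 h2 h3 h4 => ?_⟩
  · rw [← hV.per (x + e)]; ring_nf
  · exact hV.noncross (x + e) (y + e) (z + e) (u + e) (by omega) (by omega) (by omega) (by omega)
      h5 h6
  · have : (Finset.Ioc 0 n).image (· + e) = Finset.Ico (e + 1) (e + 1 + n) := by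
      rw [Finset.image_add_right_Ioc]
      ext i; simp only [Finset.mem_Ioc, Finset.mem_Ico]; omega
    rw [← hV.total, himg, this, image_window hn hV.per]
  · have := hV.gap (l + e) (l' + e) (by omega) (by omega) h3 fun y hy1 hy2 h =>
      h4 (y - e) (by omega) (by omega) (by simpa using h)
    rw [himg, Finset.image_add_right_Ioo]
    convert this using 2
    ring

end Congruence

/-! ### Starts adapted to the rotation by `d` -/

section RotationalStarts

variable {ι : Type*} {a n d : ℤ} {κ : ℤ → ι} {ω : ι → ℤ}

/-- The class of `x` has no element among the `d` labels before `x`. -/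
def IsStart (d : ℤ) (κ : ℤ → ι) (x : ℤ) : Prop := ∀ y, x - d ≤ y → y < x → κ y ≠ κ x

theorem IsStart.add_iff (hκ : ∀ x y, κ x = κ y ↔ κ (x + d) = κ (y + d)) (x : ℤ) :
    IsStart d κ (x + d) ↔ IsStart d κ x := by
  constructor
  · intro h y h1 h2 h3
    exact h (y + d) (by omega) (by omega) ((hκ _ _).1 h3)
  · intro h y h1 h2 h3
    refine h (y - d) (by omega) (by omega) ((hκ _ _).2 ?_)
    rwa [sub_add_cancel]

/-- Starts `x < y < x + n` of one class would interleave `x, x + d, y, y + d`. Noncrossing then puts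
`x + d`, hence also `x - d`, into the class of `x`. -/
theorem starts_isStart (hd : 0 < d) (hper : ∀ x, κ (x + n) = κ x)
    (hnc : ∀ x y z u, x < y → y < z → z < u → u < x + n → κ x = κ z → κ y = κ u → κ x = κ y)
    (hκ : ∀ x y, κ x = κ y ↔ κ (x + d) = κ (y + d)) : Starts n κ (IsStart d κ) := by
  have hper' : ∀ x, κ (x - n) = κ x := fun x => by rw [← hper (x - n), sub_add_cancel]
  refine ⟨fun x => ⟨fun h y h1 h2 h3 => ?_, fun h y h1 h2 h3 => ?_⟩,
    fun x y hx hy hxy hlt => ?_⟩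
  · exact h (y + n) (by omega) (by omega) (by rw [hper, hper, h3])
  · exact h (y - n) (by omega) (by omega) (by rw [hper', h3, hper])
  · by_contra hyn
    have h1 : x + d < y := by
      by_contra hc
      exact hy x (by omega) hlt hxy
    have h2 : y + d < x + n := by
      by_contra hc
      exact hx (y - n) (by omega) (by omega) (by rw [hper', hxy])
    have h3 := hnc x (x + d) y (y + d) (by omega) h1 (by omega) h2 hxy ((hκ _ _).1 hxy)
    refine hx (x - d) (by omega) (by omega) ((hκ _ _).2 ?_)
    rw [sub_add_cancel]; exact h3

/-- A gap closed by a non-start has length at most `d`. The first element of the class of `z` after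
`l` is a start: a predecessor `v` within distance `d` would lie before `l`, and `v < l < z < l'`
would cross within one turn because `2 * d ≤ n`. -/
theorem exists_isStart_gap (hdn : 2 * d ≤ n)
    (hnc : ∀ x y z u, x < y → y < z → z < u → u < x + n → κ x = κ z → κ y = κ u → κ x = κ y)
    (l l' z : ℤ) (hlz : l < z) (hzl' : z < l') (hll' : κ l = κ l')
    (hcons : ∀ y, l < y → y < l' → κ y ≠ κ l) (hl' : ¬ IsStart d κ l') :
    ∃ p, l < p ∧ p ≤ z ∧ IsStart d κ p ∧ κ p = κ z := by
  obtain ⟨p, ⟨hp1, hp2⟩, hp3⟩ := Int.exists_least_of_bdd (P := fun x => l < x ∧ κ x = κ z)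
    ⟨l, fun x hx => hx.1.le⟩ ⟨z, hlz, rfl⟩
  have hpz := hp3 z ⟨hlz, rfl⟩
  have hzl := hcons z hlz hzl'
  refine ⟨p, hp1, hpz, fun v hv1 hv2 hv3 => ?_, hp2⟩
  have hvl : v ≤ l := by
    by_contra hc
    have := hp3 v ⟨by omega, hv3.trans hp2⟩
    omega
  have hvl' : v ≠ l := fun h => hzl (by rw [← hp2, ← hv3, h])
  unfold IsStart at hl'
  push Not at hl'
  obtain ⟨w, hw1, hw2, hw3⟩ := hl'
  have hwl : w ≤ l := by
    by_contra hc
    exact hcons w (by omega) hw2 (hw3.trans hll'.symm)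
  have := hnc v l z l' (by omega) hlz hzl' (by omega) (hv3.trans hp2) hll'
  exact hzl (by rw [← this, hv3, hp2])

/-- A startless class has all gaps of length at most `d`, so two of them would cross inside a
stretch shorter than `2 * d`. -/
theorem eq_of_no_isStart (hd : 0 < d) (hdn : 2 * d ≤ n) (hper : ∀ x, κ (x + n) = κ x)
    (hnc : ∀ x y z u, x < y → y < z → z < u → u < x + n → κ x = κ z → κ y = κ u → κ x = κ y)
    (x y : ℤ) (hx : ∀ z, κ z = κ x → ¬ IsStart d κ z) (hy : ∀ z, κ z = κ y → ¬ IsStart d κ z) :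
    κ x = κ y := by
  by_contra hne
  have hn : 0 < n := by omega
  obtain ⟨l, h1, h2, h3, h4⟩ := exists_last_of_periodic (Q := fun z => κ z = κ x) hn
    (fun z => by rw [hper]) rfl y
  obtain ⟨l', g1, g2, g3, g4⟩ := exists_first_of_periodic (Q := fun z => κ z = κ x) hn
    (fun z => by rw [hper]) rfl y
  have hly : l ≠ y := fun h => hne (by rw [← h3, h])
  have hly' : l' ≠ y := fun h => hne (by rw [← g3, h])
  have hll' : l' ≤ l + d := by
    have := hx l' g3
    unfold IsStart at this
    push Not at this
    obtain ⟨w, hw1, hw2, hw3⟩ := this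
    by_contra hc
    rcases le_or_gt w y with h | h
    · exact h4 w (by omega) h (hw3.trans g3)
    · exact g4 w h.le hw2 (hw3.trans g3)
  obtain ⟨y1, e1, e2, e3, e4⟩ := exists_last_of_periodic (Q := fun z => κ z = κ y) hn
    (fun z => by rw [hper]) rfl l'
  obtain ⟨y2, f1, f2, f3, f4⟩ := exists_first_of_periodic (Q := fun z => κ z = κ y) hn
    (fun z => by rw [hper]) rfl l'
  have hy1 : y ≤ y1 := by
    by_contra hc
    exact e4 y (by omega) (by omega) rfl
  have e5 : y1 ≠ l' := fun h => hne (by rw [← g3, ← h, e3])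
  have f5 : y2 ≠ l' := fun h => hne (by rw [← g3, ← h, f3])
  have hy2 : y2 ≤ y1 + d := by
    have := hy y2 f3
    unfold IsStart at this
    push Not at this
    obtain ⟨w, hw1, hw2, hw3⟩ := this
    by_contra hc
    rcases le_or_gt w l' with h | h
    · exact e4 w (by omega) h (hw3.trans f3)
    · exact f4 w h.le hw2 (hw3.trans f3)
  have := hnc l y1 l' y2 (by omega) (by omega) (by omega) (by omega) (h3.trans g3.symm)
    (e3.trans f3.symm)
  exact hne (by rw [← h3, this, e3])

theorem Starts.eq_add_mul {P : ℤ → Prop} (hn : 0 < n) (hper : ∀ x, κ (x + n) = κ x)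
    (hP : Starts n κ P) {x y : ℤ} (hx : P x) (hy : P y) (h : κ x = κ y) :
    ∃ k : ℤ, y = x + k * n := by
  obtain ⟨k, hk1, hk2⟩ : ∃ k : ℤ, y - n < x + k * n ∧ x + k * n ≤ y := by
    refine ⟨(y - x) / n, ?_, ?_⟩
    · have := Int.lt_ediv_add_one_mul_self (y - x) hn; linarith
    · have := Int.ediv_mul_le (y - x) hn.ne'; linarith
  have h1 : κ (x + k * n) = κ x :=
    (periodic_mul (Q := fun z => κ z = κ x) (fun z => by rw [hper]) k x).2 rfl
  have h2 : P (x + k * n) := (periodic_mul hP.per k x).2 hx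
  exact ⟨k, (hP.eq_of_abs h2 hy (h1.trans h) (by omega) (by omega)).symm⟩

/-- The classes are determined by the potential and the set of starts. -/
theorem Fibres.class_eq {ι' : Type*} {κ' : ℤ → ι'} {P : ℤ → Prop} {G : ℤ → ℤ} (hn : 0 < n)
    (hper : ∀ x, κ (x + n) = κ x) (hP : Starts n κ P) (hF : Fibres n κ P G)
    (hper' : ∀ x, κ' (x + n) = κ' x) (hP' : Starts n κ' P) (hF' : Fibres n κ' P G)
    (hfree' : ∀ x y, (∀ z, κ' z = κ' x → ¬ P z) → (∀ z, κ' z = κ' y → ¬ P z) → κ' x = κ' y)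
    {x y : ℤ} (hxy : κ x = κ y) : κ' x = κ' y := by
  have free : ∀ z, (∀ w, κ w = κ z → ¬ P w) → ∀ w, κ' w = κ' z → ¬ P w := by
    intro z hz
    rcases hF'.start_cases hn hper' hP' z with h | ⟨p, -, -, hp3, -, -, hp6⟩
    · exact h
    · have := hF.lt_of_no_start (p - 1) z (by omega) fun w _ _ h => hz w h
      omega
  -- If the second partition began the class of `z` at some `q ≠ p`, the position before the later
  -- of `p` and `q` would contradict one of the two fibre properties.
  have start : ∀ z p, P p → κ p = κ z → p ≤ z → (∀ y, p < y → y ≤ z → κ y = κ z → ¬ P y) →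
      G (p - 1) < G z → κ' p = κ' z := by
    intro z p h1 h2 h3 h4 h5
    rcases hF'.start_cases hn hper' hP' z with h | ⟨q, hq1, hq2, hq3, hq4, hq5, hq6⟩
    · have := hF'.lt_of_no_start (p - 1) z (by omega) fun w _ _ hw => h w hw
      omega
    · rcases lt_trichotomy p q with h | h | h
      · have := hF.lt_of_no_start (q - 1) z (by omega) fun w hw1 hw2 hw3 =>
          h4 w (by omega) hw2 hw3
        omega
      · rw [h, hq2]
      · have := hF'.lt_of_no_start (p - 1) z (by omega) fun w hw1 hw2 hw3 =>
          hq5 w (by omega) hw2 hw3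
        omega
  rcases hF.start_cases hn hper hP x with h | ⟨p, hp1, hp2, hp3, hp4, hp5, hp6⟩
  · exact hfree' x y (free x h) (free y fun w hw => h w (hw.trans hxy.symm))
  · rcases hF.start_cases hn hper hP y with h | ⟨q, hq1, hq2, hq3, hq4, hq5, hq6⟩
    · exact absurd hp1 (h p (hp2.trans hxy))
    · rw [← start x p hp1 hp2 hp3 hp5 hp6, ← start y q hq1 hq2 hq3 hq5 hq6]
      obtain ⟨k, rfl⟩ := hP.eq_add_mul hn hper hp1 hq1 (by rw [hp2, hq2, hxy])
      exact ((periodic_mul (Q := fun z => κ' z = κ' p) (fun z => by rw [hper']) k p).2 rfl).symm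

end RotationalStarts

/-! ### The rotation in cyclic coordinates -/

section Rotation

variable {n d : ℕ} {π : Finpartition (Finset.Icc 1 n)}

theorem rot_label (hn : 0 < n) (x : ℤ) : rot n (label n x) = label n (x + 1) := by
  obtain ⟨h1, h2, k, hk⟩ := label_spec hn x
  have h3 : label n (x + 1) = label n ((label n x : ℤ) + 1) := by
    nth_rewrite 1 [hk]
    rw [show (label n x : ℤ) + k * n + 1 = (label n x : ℤ) + 1 + k * n by ring, label_add_mul]
  rw [h3, rot]
  split_ifs with h
  · rw [h, add_comm, label_add]
    exact (label_natCast (n := n) (k := 1) (Finset.mem_Icc.2 ⟨le_rfl, hn⟩)).symm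
  · exact_mod_cast (label_natCast (n := n) (k := label n x + 1)
      (Finset.mem_Icc.2 ⟨by omega, by omega⟩)).symm

theorem rot_iterate_label (hn : 0 < n) (e : ℕ) (x : ℤ) :
    (rot n)^[e] (label n x) = label n (x + e) := by
  induction e with
  | zero => simp
  | succ e ih => rw [Function.iterate_succ_apply', ih, rot_label hn]; push_cast; ring_nf

theorem mem_rotBlock_cyc (hn : 0 < n) (e : ℕ) {k : ℕ} (hk : k ∈ Finset.Icc 1 n) (x : ℤ) :
    k ∈ rotBlock n e (cyc π x) ↔ cyc π ((k : ℤ) - e) = cyc π x := by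
  rw [rotBlock, Finset.mem_image]
  constructor
  · rintro ⟨j, hj, hjk⟩
    have hjI := π.le (cyc_mem_parts hn x) hj
    rw [← label_natCast hjI, rot_iterate_label hn] at hjk
    rw [mem_cyc_iff hn hjI] at hj
    obtain ⟨i, hi⟩ := (label_eq_iff hn).1 (hjk.trans (label_natCast hk).symm)
    rw [hi, ← hj, show (j : ℤ) + e + i * n - e = j + i * n by ring, cyc_add_mul]
  · intro h
    refine ⟨label n ((k : ℤ) - e), ?_, ?_⟩
    · rw [← h]; exact label_mem_cyc hn _
    · rw [rot_iterate_label hn, sub_add_cancel, label_natCast hk]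

theorem rotBlock_subset (hn : 0 < n) (e : ℕ) {B : Finset ℕ} (hB : B ⊆ Finset.Icc 1 n) :
    rotBlock n e B ⊆ Finset.Icc 1 n := by
  intro k hk
  obtain ⟨j, hj, rfl⟩ := Finset.mem_image.1 hk
  rw [← label_natCast (hB hj), rot_iterate_label hn]
  exact label_mem hn _

theorem rotBlock_cyc_of_iff (hn : 0 < n) {e : ℕ}
    (h : ∀ x y, cyc π x = cyc π y ↔ cyc π (x + e) = cyc π (y + e)) (x : ℤ) :
    rotBlock n e (cyc π x) = cyc π (x + e) := by
  ext k
  by_cases hk : k ∈ Finset.Icc 1 n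
  · rw [mem_rotBlock_cyc hn e hk, mem_cyc_iff hn hk, h, sub_add_cancel]
  · exact iff_of_false (fun h => hk (rotBlock_subset hn e (π.le (cyc_mem_parts hn x)) h))
      (fun h => hk (π.le (cyc_mem_parts hn _) h))

theorem isRotInvariant_of_iff (hn : 0 < n) {e : ℕ}
    (h : ∀ x y, cyc π x = cyc π y ↔ cyc π (x + e) = cyc π (y + e)) : IsRotInvariant e π := by
  have hex : ∀ B ∈ π.parts, ∃ x, cyc π x = B := fun B hB => by
    obtain ⟨k, hk⟩ := π.nonempty_of_mem_parts hB
    exact ⟨k, cyc_of_mem hB hk⟩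
  rw [IsRotInvariant]
  ext B
  rw [Finset.mem_image]
  constructor
  · rintro ⟨C, hC, rfl⟩
    obtain ⟨x, rfl⟩ := hex C hC
    rw [rotBlock_cyc_of_iff hn h]
    exact cyc_mem_parts hn _
  · intro hB
    obtain ⟨x, rfl⟩ := hex B hB
    exact ⟨cyc π (x - e), cyc_mem_parts hn _, by rw [rotBlock_cyc_of_iff hn h, sub_add_cancel]⟩

theorem IsRotInvariant.rotBlock_cyc (hn : 0 < n) (hπ : IsRotInvariant d π) (x : ℤ) :
    rotBlock n d (cyc π x) = cyc π (x + d) := by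
  have h1 : rotBlock n d (cyc π x) ∈ π.parts := by
    rw [← hπ]; exact Finset.mem_image_of_mem _ (cyc_mem_parts hn x)
  refine π.eq_of_mem_parts h1 (cyc_mem_parts hn _) (a := label n (x + d)) ?_ (label_mem_cyc hn _)
  rw [mem_rotBlock_cyc hn d (label_mem hn _)]
  obtain ⟨-, -, k, hk⟩ := label_spec hn (x + d)
  rw [show (label n (x + d) : ℤ) - d = x + (-k) * n by linarith, cyc_add_mul]

theorem IsRotInvariant.rotBlock_mul_cyc (hn : 0 < n) (hπ : IsRotInvariant d π) (k : ℕ) (x : ℤ) :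
    rotBlock n (d * k) (cyc π x) = cyc π (x + d * k) := by
  induction k with
  | zero => simp [rotBlock]
  | succ k ih =>
    have : rotBlock n (d * (k + 1)) (cyc π x) = rotBlock n d (rotBlock n (d * k) (cyc π x)) := by
      rw [rotBlock, rotBlock, rotBlock, Finset.image_image, mul_add, mul_one, add_comm,
        Function.iterate_add]
    rw [this, ih, hπ.rotBlock_cyc hn]
    push_cast
    ring_nf

theorem IsRotInvariant.cyc_eq_iff (hn : 0 < n) (hdn : d ∣ n) (hπ : IsRotInvariant d π) (x y : ℤ) :
    cyc π x = cyc π y ↔ cyc π (x + d) = cyc π (y + d) := by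
  constructor
  · intro h
    rw [← hπ.rotBlock_cyc hn, h, hπ.rotBlock_cyc hn]
  · intro h
    obtain ⟨q, rfl⟩ := hdn
    have hq : 0 < q := Nat.pos_of_mul_pos_left hn
    -- With `n = d * q`, the inverse of `rot^d` is its power `q - 1`.
    have h1 : ∀ z : ℤ, cyc π z = rotBlock (d * q) (d * (q - 1)) (cyc π (z + d)) := by
      intro z
      rw [hπ.rotBlock_mul_cyc hn, ← cyc_add z]
      congr 1
      push_cast [Nat.cast_sub hq]
      ring
    rw [h1 x, h1 y, h]

end Rotation


/-! ### From a periodic sequence to an invariant partition -/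

/-- The last integer before `y` at which `G` is smaller than at `y` is `x`. -/
def IsPrevInt (G : ℤ → ℤ) (x y : ℤ) : Prop :=
  x < y ∧ G x < G y ∧ ∀ z, x < z → z < y → G y ≤ G z

open scoped Classical in
/-- The class of `y` in the partition of the cycle defined by the potential `G`; labels without
an earlier smaller potential form one class. -/
noncomputable def prevClass (n : ℕ) (G : ℤ → ℤ) (y : ℤ) : Option ℕ :=
  if h : ∃ x, IsPrevInt G x y then some (label n (h.choose + 1)) else none

theorem IsPrevInt.unique {G : ℤ → ℤ} {x x' y : ℤ} (h : IsPrevInt G x y) (h' : IsPrevInt G x' y) :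
    x = x' := by
  rcases lt_trichotomy x x' with h1 | h1 | h1
  · have := h.2.2 x' h1 h'.1; have := h'.2.1; omega
  · exact h1
  · have := h'.2.2 x h1 h.1; have := h.2.1; omega

theorem IsPrevInt.prevClass_eq {n : ℕ} {G : ℤ → ℤ} {x y : ℤ} (h : IsPrevInt G x y) :
    prevClass n G y = some (label n (x + 1)) := by
  have hex : ∃ x, IsPrevInt G x y := ⟨x, h⟩
  rw [prevClass, dif_pos hex, hex.choose_spec.unique h]

theorem exists_isPrevInt {G : ℤ → ℤ} {y z : ℤ} (hz : z < y) (hG : G z < G y) :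
    ∃ x, IsPrevInt G x y := by
  obtain ⟨x, ⟨h1, h2⟩, h3⟩ := Int.exists_greatest_of_bdd (P := fun x => x < y ∧ G x < G y)
    ⟨y, fun x hx => hx.1.le⟩ ⟨z, hz, hG⟩
  refine ⟨x, h1, h2, fun w hw1 hw2 => ?_⟩
  by_contra hc
  have := h3 w ⟨hw2, not_le.1 hc⟩
  omega

/-- Either there is a previous position, or `y` is in the exceptional class. -/
theorem prevClass_cases (n : ℕ) (G : ℤ → ℤ) (y : ℤ) :
    (∃ x, IsPrevInt G x y ∧ prevClass n G y = some (label n (x + 1))) ∨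
      (prevClass n G y = none ∧ ∀ z, z < y → G y ≤ G z) := by
  by_cases h : ∃ x, IsPrevInt G x y
  · obtain ⟨x, hx⟩ := h
    exact Or.inl ⟨x, hx, hx.prevClass_eq⟩
  · refine Or.inr ⟨by rw [prevClass, dif_neg h], fun z hz => ?_⟩
    by_contra hc
    exact h (exists_isPrevInt hz (not_le.1 hc))

theorem prevClass_eq_none {n : ℕ} {G : ℤ → ℤ} {y : ℤ} (h : ∀ z, z < y → G y ≤ G z) :
    prevClass n G y = none := by
  rcases prevClass_cases n G y with ⟨x, hx, -⟩ | h1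
  · have := h x hx.1; have := hx.2.1; omega
  · exact h1.1

/-- The setting of a sequence `s` of period `d` with potential `G`. -/
structure PeriodicSeq (a n d : ℕ) (s G : ℤ → ℤ) : Prop where
  a_pos : 0 < a
  a_le : a ≤ n
  coprime : a.Coprime (n + 1)
  d_pos : 0 < d
  dvd : d ∣ n
  two_mul_le : 2 * d ≤ n
  nonneg : ∀ x, 0 ≤ s x
  per : ∀ x, s (x + d) = s x
  potential : ∀ x, G x = G (x - 1) + ((n : ℤ) + 1) * s x - a
  total_le : ∑ x ∈ Finset.Ioc (0 : ℤ) n, s x ≤ a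

namespace PeriodicSeq

variable {a n d : ℕ} {s G : ℤ → ℤ} (hs : PeriodicSeq a n d s G)
include hs

theorem n_pos : 0 < n := by have := hs.d_pos; have := hs.two_mul_le; omega

theorem shift (x : ℤ) : G (x + d) = G x + (G d - G 0) := potential_add hs.potential hs.per x

theorem per_n (x : ℤ) : s (x + n) = s x := by
  obtain ⟨q, hq⟩ := hs.dvd
  have := (periodic_mul (Q := fun y => s y = s x) (n := d) (fun y => by rw [hs.per]) q x).2 rfl
  rw [hq, Nat.cast_mul, mul_comm]
  exact this

theorem shift_n (x : ℤ) : G (x + n) = G x + (G n - G 0) := potential_add hs.potential hs.per_n x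

theorem drift_n : G n - G 0 = ((n : ℤ) + 1) * ∑ x ∈ Finset.Ioc (0 : ℤ) n, s x - a * n := by
  have := potential_sub hs.potential (show (0 : ℤ) ≤ n by omega)
  rwa [sub_zero] at this

theorem ne {x y : ℤ} (hxy : x < y) (hyb : y < x + (n + 1)) : G x ≠ G y := by
  intro he
  have h := potential_sub hs.potential hxy.le
  rw [he, sub_self] at h
  have h1 : ((n : ℤ) + 1) ∣ a * (y - x) := ⟨∑ i ∈ Finset.Ioc x y, s i, by linarith⟩
  have hcop : IsCoprime ((n : ℤ) + 1) a := by
    rw [Int.isCoprime_iff_gcd_eq_one]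
    have := hs.coprime
    rw [Nat.coprime_comm] at this
    exact_mod_cast this
  have := Int.le_of_dvd (by omega) (hcop.dvd_of_dvd_mul_left h1)
  omega

theorem pos_iff {x : ℤ} : 0 < s (x + 1) ↔ G x < G (x + 1) := by
  have h := hs.potential (x + 1)
  rw [add_sub_cancel_right] at h
  have ha := hs.a_pos
  have hn := hs.a_le
  constructor
  · intro h1
    have := mul_le_mul_of_nonneg_left (show 1 ≤ s (x + 1) by omega) (show (0 : ℤ) ≤ n + 1 by omega)
    omega
  · intro h1
    by_contra hc
    have h2 := hs.nonneg (x + 1)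
    rw [show s (x + 1) = 0 by omega] at h
    omega

theorem isPrevInt_of_pos {p : ℤ} (hp : 0 < s p) : IsPrevInt G (p - 1) p := by
  refine ⟨by omega, ?_, fun z h1 h2 => by omega⟩
  have := hs.pos_iff (x := p - 1)
  rw [sub_add_cancel] at this
  exact this.1 hp

theorem pos_of_isPrevInt {x y : ℤ} (h : IsPrevInt G x y) : 0 < s (x + 1) := by
  rw [hs.pos_iff]
  rcases (show x + 1 = y ∨ x + 1 < y by have := h.1; omega) with h1 | h1
  · rw [h1]; exact h.2.1
  · exact lt_of_lt_of_le h.2.1 (h.2.2 _ (by omega) h1)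

theorem prevClass_of_pos {p : ℤ} (hp : 0 < s p) : prevClass n G p = some (label n p) := by
  rw [(hs.isPrevInt_of_pos hp).prevClass_eq, sub_add_cancel]

/-- The laser of `x` is shorter than the period. -/
theorem le_add {x y : ℤ} (h : IsPrevInt G x y) : y ≤ x + d := by
  by_contra hc
  have hd := hs.d_pos
  -- Both `x + d` and `y - d` lie strictly between `x` and `y`; the first forces a positive drift
  -- per period, the second a nonpositive one.
  have h1 := h.2.2 (x + d) (by omega) (by omega)
  have h2 := h.2.2 (y - d) (by omega) (by omega)
  have h3 := hs.shift x
  have h4 := hs.shift (y - d)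
  rw [sub_add_cancel] at h4
  have := h.2.1
  omega

theorem isPrevInt_shift {x y : ℤ} : IsPrevInt G (x + d) (y + d) ↔ IsPrevInt G x y := by
  have hx := hs.shift x
  have hy := hs.shift y
  constructor
  · rintro ⟨h1, h2, h3⟩
    refine ⟨by omega, by omega, fun z hz1 hz2 => ?_⟩
    have := h3 (z + d) (by omega) (by omega)
    have := hs.shift z
    omega
  · rintro ⟨h1, h2, h3⟩
    refine ⟨by omega, by omega, fun z hz1 hz2 => ?_⟩
    have := h3 (z - d) (by omega) (by omega)
    have h := hs.shift (z - d)
    rw [sub_add_cancel] at h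
    omega

theorem prevClass_none_shift {y : ℤ} (h : prevClass n G y = none) :
    prevClass n G (y + d) = none ∧ prevClass n G (y - d) = none := by
  constructor
  · rcases prevClass_cases n G (y + d) with ⟨x, hx, -⟩ | h1
    · have : IsPrevInt G (x - d) y := by
        rw [← hs.isPrevInt_shift, sub_add_cancel]; exact hx
      rw [this.prevClass_eq] at h
      cases h
    · exact h1.1
  · rcases prevClass_cases n G (y - d) with ⟨x, hx, -⟩ | h1
    · have : IsPrevInt G (x + d) y := by
        have := hs.isPrevInt_shift.2 hx
        rwa [sub_add_cancel] at this
      rw [this.prevClass_eq] at h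
      cases h
    · exact h1.1

theorem prevClass_shift (x y : ℤ) :
    prevClass n G x = prevClass n G y ↔ prevClass n G (x + d) = prevClass n G (y + d) := by
  have hn := hs.n_pos
  rcases prevClass_cases n G x with ⟨u, hu, hu'⟩ | ⟨hu, -⟩ <;>
    rcases prevClass_cases n G y with ⟨v, hv, hv'⟩ | ⟨hv, -⟩
  · rw [hu', hv', (hs.isPrevInt_shift.2 hu).prevClass_eq, (hs.isPrevInt_shift.2 hv).prevClass_eq,
      Option.some_inj, Option.some_inj, label_eq_iff hn, label_eq_iff hn]
    constructor <;> rintro ⟨k, hk⟩ <;> exact ⟨k, by linarith⟩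
  · rw [hu', hv, (hs.isPrevInt_shift.2 hu).prevClass_eq, (hs.prevClass_none_shift hv).1]
    simp
  · rw [hu, hv', (hs.isPrevInt_shift.2 hv).prevClass_eq, (hs.prevClass_none_shift hu).1]
    simp
  · rw [hu, hv, (hs.prevClass_none_shift hu).1, (hs.prevClass_none_shift hv).1]

theorem prevClass_add (x : ℤ) : prevClass n G (x + n) = prevClass n G x := by
  have hn := hs.n_pos
  obtain ⟨q, hq⟩ := hs.dvd
  have h1 : ∀ k : ℕ, ∀ y, (prevClass n G y = none → prevClass n G (y + k * d) = none) ∧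
      ∀ u, IsPrevInt G u y → IsPrevInt G (u + k * d) (y + k * d) := by
    intro k
    induction k with
    | zero => simp
    | succ k ih =>
      intro y
      refine ⟨fun h => ?_, fun u h => ?_⟩
      · have := (hs.prevClass_none_shift ((ih y).1 h)).1
        rw [show y + ((k + 1 : ℕ) : ℤ) * d = y + k * d + d by push_cast; ring]; exact this
      · have := hs.isPrevInt_shift.2 ((ih y).2 u h)
        rw [show y + ((k + 1 : ℕ) : ℤ) * d = y + k * d + d by push_cast; ring,
          show u + ((k + 1 : ℕ) : ℤ) * d = u + k * d + d by push_cast; ring]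
        exact this
  have hqd : (n : ℤ) = q * d := by rw [hq]; push_cast; ring
  rcases prevClass_cases n G x with ⟨u, hu, hu'⟩ | ⟨hu, -⟩
  · have := (h1 q x).2 u hu
    rw [← hqd] at this
    rw [hu', this.prevClass_eq, show u + n + 1 = u + 1 + n by ring, label_add]
  · have := (h1 q x).1 hu
    rw [← hqd] at this
    rw [hu, this]

theorem starts : Starts (n : ℤ) (prevClass n G) (fun x => 0 < s x) := by
  have hn := hs.n_pos
  refine ⟨fun x => by rw [hs.per_n], fun x y hx hy h hxy => ?_⟩
  rw [hs.prevClass_of_pos hx, hs.prevClass_of_pos hy, Option.some_inj, label_eq_iff hn] at h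
  obtain ⟨k, rfl⟩ := h
  have : 0 < k := by
    by_contra hk
    have := mul_nonpos_of_nonpos_of_nonneg (not_lt.1 hk) (show (0 : ℤ) ≤ n by omega)
    omega
  have := mul_le_mul_of_nonneg_right (show 1 ≤ k by omega) (show (0 : ℤ) ≤ n by omega)
  omega

/-- The last smaller position before an element of the class of the start `p` is `p - 1`,
modulo `n`. -/
theorem prev_add_one_eq {p x y : ℤ} (hp : 0 < s p) (hx : IsPrevInt G x y)
    (h : prevClass n G y = prevClass n G p) : ∃ k : ℤ, x + 1 = p + k * n := by
  rw [hs.prevClass_of_pos hp, hx.prevClass_eq, Option.some_inj] at h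
  exact (label_eq_iff hs.n_pos).1 h.symm

theorem fibres : Fibres (n : ℤ) (prevClass n G) (fun x => 0 < s x) G := by
  have hn := hs.n_pos
  have hd := hs.d_pos
  have hdn := hs.two_mul_le
  refine ⟨fun p y hp hyp hpy hyn => ?_, fun z y hzy hno => ?_⟩
  · rcases prevClass_cases n G y with ⟨x, hx, -⟩ | ⟨hy, -⟩
    · obtain ⟨k, hk⟩ := hs.prev_add_one_eq hp hx hyp
      have h1 := hs.le_add hx
      have h2 := hx.1
      have : k = 0 := by
        rcases lt_trichotomy k 0 with h | h | h
        · have := mul_le_mul_of_nonneg_right (show k ≤ -1 by omega) (show (0 : ℤ) ≤ n by omega)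
          omega
        · exact h
        · have := mul_le_mul_of_nonneg_right (show 1 ≤ k by omega) (show (0 : ℤ) ≤ n by omega)
          omega
      rw [this, zero_mul, add_zero] at hk
      rw [← hk, add_sub_cancel_right]
      exact hx.2.1
    · rw [hy, hs.prevClass_of_pos hp] at hyp
      cases hyp
  · rcases prevClass_cases n G y with ⟨x, hx, hy⟩ | ⟨-, hy⟩
    · have h1 := hs.pos_of_isPrevInt hx
      have h2 : x + 1 ≤ z := by
        by_contra hc
        exact hno (x + 1) (by omega) (by have := hx.1; omega)
          (by rw [hs.prevClass_of_pos h1, hy]) h1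
      have h3 := hx.2.2 z (by omega) hzy
      have h4 := hs.le_add hx
      have h5 := hs.ne hzy (by omega)
      omega
    · have h1 := hy z hzy
      rcases lt_or_ge y (z + (n + 1)) with h2 | h2
      · have := hs.ne hzy h2
        omega
      -- More than a turn apart: minimality of `G y` makes the drift per turn nonpositive,
      -- coprimality makes it nonzero, so `G y ≤ G (z + n) < G z`.
      · have h3 := hy (z + n) (by omega)
        have h4 := hs.shift_n z
        have h5 := hs.ne (x := z) (y := z + n) (by omega) (by omega)
        have h6 := hy (y - n) (by omega)
        have h7 := hs.shift_n (y - n)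
        rw [sub_add_cancel] at h7
        omega

theorem prevClass_none_of_no_pos {x : ℤ}
    (h : ∀ z, prevClass n G z = prevClass n G x → ¬ 0 < s z) : prevClass n G x = none := by
  rcases prevClass_cases n G x with ⟨u, hu, hu'⟩ | ⟨hu, -⟩
  · have h1 := hs.pos_of_isPrevInt hu
    exact absurd h1 (h (u + 1) (by rw [hs.prevClass_of_pos h1, hu']))
  · exact hu

theorem apply_label {x : ℤ} : s (label n x) = s x := by
  obtain ⟨-, -, k, hk⟩ := label_spec hs.n_pos x
  nth_rewrite 2 [hk]
  exact ((periodic_mul (Q := fun y => s y = s (label n x)) (n := n)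
    (fun y => by rw [hs.per_n]) k _).2 rfl).symm

/-- The weights of the classes: the exceptional class completes the total weight to `a`. -/
theorem valid : Valid (a : ℤ) n (prevClass n G) (fun C => C.elim
    ((a : ℤ) - ∑ x ∈ Finset.Ioc (0 : ℤ) n, s x) (fun v => s v)) := by
  classical
  have hn := hs.n_pos
  have hn' : (0 : ℤ) < n := by omega
  set A := ∑ x ∈ Finset.Ioc (0 : ℤ) n, s x with hA
  set ω : Option ℕ → ℤ := fun C => C.elim ((a : ℤ) - A) (fun v => s v) with hω
  have hdrift := hs.drift_n
  rw [← hA] at hdrift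
  have hAle : A ≤ a := hs.total_le
  have hωp : ∀ p, 0 < s p → ω (prevClass n G p) = s p := by
    intro p hp
    rw [hs.prevClass_of_pos hp]
    exact hs.apply_label
  have ht : ∀ x, s x = @ite _ (0 < s x) (Classical.propDecidable _) (ω (prevClass n G x)) 0 := by
    intro x
    split_ifs with h
    · exact (hωp x h).symm
    · have := hs.nonneg x; omega
  -- If the sequence already had total `a`, the drift per turn would be `a > 0`, and every position
  -- would have an earlier smaller one.
  have hAlt : ∀ y, prevClass n G y = none → A < a := by
    intro y hy
    rcases prevClass_cases n G y with ⟨x, -, hx⟩ | ⟨-, h⟩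
    · rw [hy] at hx; cases hx
    · by_contra hc
      have : A = a := by omega
      rw [this] at hdrift
      have h1 := h (y - n) (by omega)
      have h2 := hs.shift_n (y - n)
      rw [sub_add_cancel] at h2
      have := hs.a_pos
      have h3 : ((n : ℤ) + 1) * a - a * n = a := by ring
      omega
  have hpos : ∀ x, 0 < ω (prevClass n G x) := by
    intro x
    rcases prevClass_cases n G x with ⟨u, hu, hu'⟩ | ⟨hu, -⟩
    · have h1 := hs.pos_of_isPrevInt hu
      rw [hu', ← hs.prevClass_of_pos h1, hωp _ h1]
      exact h1
    · rw [hu]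
      have := hAlt x hu
      simp only [hω, Option.elim_none]
      omega
  have hcase : ∀ x, prevClass n G x ≠ none → ∃ p ∈ Finset.Ioc (0 : ℤ) n, 0 < s p ∧
      prevClass n G p = prevClass n G x := by
    intro x hx
    rcases prevClass_cases n G x with ⟨u, hu, hu'⟩ | ⟨hu, -⟩
    · have h1 := hs.pos_of_isPrevInt hu
      have h2 := label_mem hn (u + 1)
      have h3 := Finset.mem_Icc.1 h2
      have h4 : 0 < s (label n (u + 1)) := by rw [hs.apply_label]; exact h1
      refine ⟨label n (u + 1), Finset.mem_Ioc.2 ⟨by omega, by omega⟩, h4, ?_⟩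
      rw [hs.prevClass_of_pos h4, hu', label_natCast h2]
    · exact absurd hu hx
  refine hs.fibres.valid (t := s) hn' hs.prevClass_add hs.starts (fun x y hx hy => ?_) hpos ?_ ht
    hs.potential
  · rw [hs.prevClass_none_of_no_pos hx, hs.prevClass_none_of_no_pos hy]
  · by_cases hnone : ∃ y, prevClass n G y = none
    · obtain ⟨y, hy⟩ := hnone
      obtain ⟨y', hy'1, hy'2, hy'3, -⟩ := exists_first_of_periodic
        (Q := fun z => prevClass n G z = none) hn' (fun z => by rw [hs.prevClass_add]) hy 1
      have himg : (Finset.Ioc (0 : ℤ) n).image (prevClass n G) = insert none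
          (((Finset.Ioc (0 : ℤ) n).filter fun x => 0 < s x).image (prevClass n G)) := by
        ext C
        rw [Finset.mem_insert, Finset.mem_image, Finset.mem_image]
        constructor
        · rintro ⟨x, hx, rfl⟩
          by_cases h : prevClass n G x = none
          · exact Or.inl h
          · obtain ⟨p, hp1, hp2, hp3⟩ := hcase x h
            exact Or.inr ⟨p, Finset.mem_filter.2 ⟨hp1, hp2⟩, hp3⟩
        · rintro (rfl | ⟨x, hx, rfl⟩)
          · exact ⟨y', Finset.mem_Ioc.2 ⟨by omega, by omega⟩, hy'3⟩
          · exact ⟨x, (Finset.mem_filter.1 hx).1, rfl⟩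
      have hnot : none ∉ ((Finset.Ioc (0 : ℤ) n).filter fun x => 0 < s x).image
          (prevClass n G) := by
        intro h
        obtain ⟨x, hx, hx'⟩ := Finset.mem_image.1 h
        rw [hs.prevClass_of_pos (Finset.mem_filter.1 hx).2] at hx'
        cases hx'
      have hsum := sum_starts (P := fun x => 0 < s x) (κ := prevClass n G) (ω := ω) (t := s) ht
        (Finset.Ioc (0 : ℤ) n) (fun x hx y hy hPx hPy hxy => by
          simp only [Finset.mem_Ioc] at hx hy
          exact hs.starts.eq_of_abs hPx hPy hxy (by omega) (by omega))
      have hgoal : ∑ C ∈ insert none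
          (((Finset.Ioc (0 : ℤ) n).filter fun x => 0 < s x).image (prevClass n G)), ω C = a := by
        rw [Finset.sum_insert hnot]
        have h0 : ω none = a - A := rfl
        have : ∑ C ∈ ((Finset.Ioc (0 : ℤ) n).filter fun x => 0 < s x).image (prevClass n G), ω C
            = A := by
          rw [hA, hsum]
          congr!
        rw [h0, this]; ring
      rw [← hgoal, ← himg]
      congr!
    · push Not at hnone
      -- Conversely, `A < a ≤ n` makes the drift negative, and then a minimum of `G` over one turn
      -- has no earlier smaller position: the exceptional class is nonempty.
      have hAa : A = a := by
        by_contra hne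
        have hlt : A + 1 ≤ a := by omega
        have hneg : G n - G 0 < 0 := by
          have h1 := mul_le_mul_of_nonneg_left hlt (show (0 : ℤ) ≤ n + 1 by omega)
          have h2 := hs.a_le
          have h3 : ((n : ℤ) + 1) * a = a * n + a := by ring
          have h4 : ((n : ℤ) + 1) * (A + 1) = (n + 1) * A + n + 1 := by ring
          omega
        obtain ⟨y, hy, hmin⟩ := Finset.exists_min_image (Finset.Ioc (0 : ℤ) n) G
          ⟨1, Finset.mem_Ioc.2 ⟨by omega, by omega⟩⟩
        refine hnone y (prevClass_eq_none fun z hz => ?_)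
        rw [Finset.mem_Ioc] at hy
        obtain ⟨h1, h2, k, hk⟩ := label_spec hn z
        have h3 := hmin (label n z) (Finset.mem_Ioc.2 ⟨by omega, by omega⟩)
        have h4 := potential_add_mul hs.potential hs.per_n (label n z) k
        rw [← hk] at h4
        have hk0 : k ≤ 0 := by
          by_contra hc
          have := mul_le_mul_of_nonneg_right (show 1 ≤ k by omega) hn'.le
          omega
        have := mul_nonneg_of_nonpos_of_nonpos hk0 hneg.le
        omega
      rw [← hAa, hA, hs.starts.sum_eq (t := s) (ω := ω) ht fun x _ => hcase x (hnone x)]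

/-- Recovers the sequence from its partition: an element has its class started less than `d` before
it, while the exceptional class is invariant under translation by `d` and so has no start. -/
theorem isStart_iff (p : ℤ) : IsStart (d : ℤ) (prevClass n G) p ↔ 0 < s p := by
  have hn := hs.n_pos
  have hd := hs.d_pos
  have hdn := hs.two_mul_le
  constructor
  · intro h
    by_contra hp
    rcases prevClass_cases n G p with ⟨x, hx, hx'⟩ | ⟨hx, -⟩
    · have h1 := hs.pos_of_isPrevInt hx
      have h2 := hs.le_add hx
      have h3 : x + 1 ≠ p := fun h => hp (h ▸ h1)
      exact h (x + 1) (by omega) (by have := hx.1; omega) (by rw [hs.prevClass_of_pos h1, hx'])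
    · exact h (p - d) le_rfl (by omega) (by rw [hx, (hs.prevClass_none_shift hx).2])
  · intro hp v hv1 hv2 hv
    rcases prevClass_cases n G v with ⟨x, hx, -⟩ | ⟨hx, -⟩
    · obtain ⟨k, hk⟩ := hs.prev_add_one_eq hp hx hv
      have h1 := hs.le_add hx
      have h2 := hx.1
      rcases le_or_gt 0 k with h | h
      · have := mul_nonneg h (show (0 : ℤ) ≤ n by omega)
        omega
      · have := mul_le_mul_of_nonneg_right (show k ≤ -1 by omega) (show (0 : ℤ) ≤ n by omega)
        omega
    · rw [hx, hs.prevClass_of_pos hp] at hv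
      cases hv

/-- Every periodic sequence comes from a rotation invariant valid partition. -/
theorem exists_partition : ∃ (π : Finpartition (Finset.Icc 1 n)) (ω : Finset ℕ → ℤ),
    Valid (a : ℤ) n (cyc π) ω ∧ (∀ x y, cyc π x = cyc π y ↔ cyc π (x + d) = cyc π (y + d)) ∧
    ∀ x, s x = @ite _ (IsStart (d : ℤ) (cyc π) x) (Classical.propDecidable _) (ω (cyc π x)) 0 := by
  classical
  have hn := hs.n_pos
  let S : Setoid ℕ := Setoid.comap (fun k : ℕ => prevClass n G k) ⊥
  let π := Finpartition.ofSetSetoid S (Finset.Icc 1 n)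
  have hκ : ∀ x y, prevClass n G x = prevClass n G y ↔ cyc π x = cyc π y := by
    have hl : ∀ x, prevClass n G (label n x) = prevClass n G x := by
      intro x
      obtain ⟨-, -, k, hk⟩ := label_spec hn x
      nth_rewrite 2 [hk]
      exact ((periodic_mul (Q := fun y => prevClass n G y = prevClass n G (label n x)) (n := n)
        (fun y => by rw [hs.prevClass_add]) k _).2 rfl).symm
    intro x y
    have h1 : cyc π x = cyc π y ↔ label n x ∈ cyc π y := by
      rw [mem_cyc_iff hn (label_mem hn x), cyc_natCast (label_mem hn x)]
      rfl
    rw [h1, cyc, Finpartition.mem_part_ofSetSetoid_iff_rel]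
    simp only [label_mem hn, true_and]
    change _ ↔ prevClass n G (label n y) = prevClass n G (label n x)
    rw [hl, hl, eq_comm]
  let ω₀ : Option ℕ → ℤ := fun C =>
    C.elim ((a : ℤ) - ∑ x ∈ Finset.Ioc (0 : ℤ) n, s x) (fun v => s v)
  let ω : Finset ℕ → ℤ := fun B => ω₀ (prevClass n G (blockMin B))
  have hω : ∀ x, ω₀ (prevClass n G x) = ω (cyc π x) := by
    intro x
    have hB := cyc_mem_parts (π := π) hn x
    have hm := cyc_of_mem hB (blockMin_mem (π.nonempty_of_mem_parts hB))
    rw [← hκ] at hm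
    simp only [ω, hm]
  refine ⟨π, ω, hs.valid.congr hκ hω, fun x y => ?_, fun x => ?_⟩
  · rw [← hκ, ← hκ]; exact hs.prevClass_shift x y
  · have h1 : IsStart (d : ℤ) (cyc π) x ↔ 0 < s x := by
      rw [← hs.isStart_iff]
      unfold IsStart
      simp only [ne_eq, hκ]
    rw [← hω x]
    by_cases h : 0 < s x
    · rw [if_pos (h1.2 h), hs.prevClass_of_pos h]
      exact hs.apply_label.symm
    · rw [if_neg (fun h' => h (h1.1 h'))]
      have := hs.nonneg x; omega

end PeriodicSeq


/-! ### Counting words with prescribed multiplicities -/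

section Count

/-- The number of functions with prescribed fibre cardinalities. -/
theorem card_fibre_functions {α ι : Type*} [Fintype α] [DecidableEq α] [Fintype ι] [DecidableEq ι]
    (m : ι → ℕ) (hm : ∑ i, m i = Fintype.card α) :
    Nat.card {f : α → ι // ∀ i, Fintype.card {x // f x = i} = m i} * ∏ i, (m i)! =
      (Fintype.card α)! := by
  rw [Nat.card_eq_fintype_card]
  obtain ⟨e⟩ : Nonempty (α ≃ Σ i, Fin (m i)) := by
    rw [← Fintype.card_eq]; simp [hm]
  let f₀ : α → ι := fun x => (e x).1
  have hf₀ : ∀ i, Fintype.card {x // f₀ x = i} = m i := by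
    intro i
    rw [← Fintype.card_fin (m i)]
    exact Fintype.card_congr ((e.subtypeEquiv (q := fun y => y.1 = i) fun _ => Iff.rfl).trans
      (Equiv.sigmaSubtype i))
  have hcomp : ∀ (g : Equiv.Perm α) i, Fintype.card {x // f₀ (g x) = i} = m i := fun g i => by
    rw [← hf₀ i]
    exact Fintype.card_congr (g.subtypeEquiv fun _ => Iff.rfl)
  let F : Equiv.Perm α → {f : α → ι // ∀ i, Fintype.card {x // f x = i} = m i} :=
    fun g => ⟨f₀ ∘ g, hcomp g⟩
  -- Orbit counting: permutations act transitively on these functions, and each fibre of `F` is a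
  -- translate of the stabilizer of `f₀`, of order `∏ i, (m i)!`.
  have hfib : ∀ t, Fintype.card {g // F g = t} = ∏ i, (m i)! := by
    rintro ⟨f, hf⟩
    have h1 : ∀ i, Nonempty ({x // f x = i} ≃ {x // f₀ x = i}) := fun i => by
      rw [← Fintype.card_eq, hf, hf₀]
    let g₀ : Equiv.Perm α := Equiv.ofFiberEquiv fun i => (h1 i).some
    have hg₀ : ∀ x, f₀ (g₀ x) = f x := fun x => Equiv.ofFiberEquiv_map _ x
    rw [Finset.prod_congr rfl fun i _ => by rw [← hf₀ i], ← DomMulAct.stabilizer_card f₀]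
    refine Fintype.card_congr ((Equiv.mulRight g₀⁻¹).subtypeEquiv fun g => ?_)
    rw [Subtype.ext_iff]
    constructor
    · intro h
      funext x
      have := congrFun h (g₀⁻¹ x)
      simp only [F, Function.comp_apply] at this
      simp only [Function.comp_apply, Equiv.coe_mulRight, Equiv.Perm.mul_apply, this]
      rw [← hg₀, show g₀ (g₀⁻¹ x) = x from g₀.apply_symm_apply x]
    · intro h
      funext x
      have := congrFun h (g₀ x)
      simp only [Function.comp_apply, Equiv.coe_mulRight, Equiv.Perm.mul_apply, hg₀,
        show g₀⁻¹ (g₀ x) = x from g₀.symm_apply_apply x] at this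
      exact this
  rw [← Fintype.card_perm, ← Fintype.card_congr (Equiv.sigmaFiberEquiv F), Fintype.card_sigma,
    Finset.sum_congr rfl fun t _ => hfib t, Finset.sum_const, smul_eq_mul, Finset.card_univ]

/-- The value `0` fills the remaining places, so all fibres over `Fin (a + 1)` are prescribed. -/
theorem ncard_sequences (a d : ℕ) (m : ℕ → ℕ) (hm : ∑ i ∈ Finset.Icc 1 a, m i ≤ d) :
    {f : Fin d → ℕ | (∀ j, f j ≤ a) ∧ ∀ i ∈ Finset.Icc 1 a,
      (Finset.univ.filter fun j => f j = i).card = m i}.ncard =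
    d ! / ((∏ i ∈ Finset.Icc 1 a, (m i)!) * (d - ∑ i ∈ Finset.Icc 1 a, m i)!) := by
  obtain ⟨m', hm0, hmS⟩ : ∃ m' : Fin (a + 1) → ℕ, m' 0 = d - ∑ i ∈ Finset.Icc 1 a, m i ∧
      ∀ i : Fin a, m' i.succ = m (i + 1) :=
    ⟨Fin.cons (d - ∑ i ∈ Finset.Icc 1 a, m i) fun i => m (i + 1), rfl, fun _ => rfl⟩
  have hsum : ∀ F : ℕ → ℕ, ∑ i : Fin a, F (i + 1) = ∑ i ∈ Finset.Icc 1 a, F i := fun F => by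
    rw [Fin.sum_univ_eq_sum_range (fun i => F (i + 1)), Finset.range_eq_Ico,
      Finset.sum_Ico_add' F 0 a 1]
    rfl
  have hprod : ∀ F : ℕ → ℕ, ∏ i : Fin a, F (i + 1) = ∏ i ∈ Finset.Icc 1 a, F i := fun F => by
    rw [Fin.prod_univ_eq_prod_range (fun i => F (i + 1)), Finset.range_eq_Ico,
      Finset.prod_Ico_add' F 0 a 1]
    rfl
  have htot : ∑ i, m' i = d := by
    rw [Fin.sum_univ_succ, hm0, Finset.sum_congr rfl fun i _ => hmS i, hsum]
    omega
  have hcard := card_fibre_functions (α := Fin d) m' (by rw [htot, Fintype.card_fin])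
  rw [Fin.prod_univ_succ, hm0, Finset.prod_congr rfl fun i _ => by rw [hmS i],
    hprod fun i => (m i)!, mul_comm (_ !), Fintype.card_fin] at hcard
  rw [← hcard, Nat.mul_div_cancel _ (by positivity), ← Nat.card_coe_set_eq]
  symm
  have hval : ∀ (f : Fin d → Fin (a + 1)), (∀ i, Fintype.card {x // f x = i} = m' i) →
      (fun j => (f j : ℕ)) ∈ {f : Fin d → ℕ | (∀ j, f j ≤ a) ∧ ∀ i ∈ Finset.Icc 1 a,
      (Finset.univ.filter fun j => f j = i).card = m i} := by
    refine fun f hf => ⟨fun j => Nat.lt_succ_iff.1 (f j).2, fun i hi => ?_⟩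
    rw [Finset.mem_Icc] at hi
    have := hf (Fin.succ ⟨i - 1, by omega⟩)
    rw [hmS, Fintype.card_subtype] at this
    simp only at this
    rw [show i - 1 + 1 = i by omega] at this
    rw [← this]
    congr 1
    ext j
    simp only [Finset.mem_filter, Finset.mem_univ, true_and, Fin.ext_iff, Fin.val_succ]
    omega
  refine Nat.card_congr (Equiv.ofBijective (fun f => ⟨_, hval f.1 f.2⟩) ⟨?_, ?_⟩)
  · intro f g h
    rw [Subtype.mk.injEq] at h
    refine Subtype.ext (funext fun j => Fin.ext (congrFun h j))
  · rintro ⟨f, hf1, hf2⟩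
    have key : ∀ i : Fin a, Fintype.card {x // (⟨f x, by have := hf1 x; omega⟩ : Fin (a + 1)) =
        Fin.succ i} = m (i + 1) := by
      intro i
      rw [← hf2 (i + 1) (Finset.mem_Icc.2 ⟨by omega, by omega⟩), Fintype.card_subtype]
      congr 1
      ext j
      simp only [Finset.mem_filter, Finset.mem_univ, true_and, Fin.ext_iff, Fin.val_succ]
    refine ⟨⟨fun x => ⟨f x, by have := hf1 x; omega⟩, ?_⟩, rfl⟩
    intro i
    refine Fin.cases ?_ (fun i => ?_) i
    · have h1 := Fintype.card_congr (Equiv.sigmaFiberEquiv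
        fun x : Fin d => (⟨f x, by have := hf1 x; omega⟩ : Fin (a + 1)))
      rw [Fintype.card_sigma, Fin.sum_univ_succ, Fintype.card_fin,
        Finset.sum_congr rfl fun i _ => key i, hsum] at h1
      rw [hm0]
      exact Nat.eq_sub_of_add_eq h1
    · rw [key, hmS]

end Count


/-! ### The sequence of an invariant partition -/

open scoped Classical in
theorem Valid.sum_starts_le {ι : Type*} {a n : ℤ} {κ : ℤ → ι} {ω : ι → ℤ} {P : ℤ → Prop}
    {t : ℤ → ℤ} (hV : Valid a n κ ω) (hS : Starts n κ P)
    (ht : ∀ x, t x = if P x then ω (κ x) else 0) : ∑ x ∈ Finset.Ioc 0 n, t x ≤ a := by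
  rw [sum_starts ht]
  · rw [← hV.total]
    refine Finset.sum_le_sum_of_subset_of_nonneg
      (Finset.image_subset_image (Finset.filter_subset _ _)) fun C hC _ => ?_
    obtain ⟨x, -, rfl⟩ := Finset.mem_image.1 hC
    exact (hV.pos x).le
  · intro x hx y hy hPx hPy hxy
    simp only [Finset.mem_Ioc] at hx hy
    exact hS.eq_of_abs hPx hPy hxy (by omega) (by omega)

open scoped Classical in
/-- The sequence of a partition: the rank of the block of `x` if `x` is the first element of its
block after the largest gap, and zero otherwise. -/
noncomputable def seqOf (a b d : ℕ) (π : Finpartition (Finset.Icc 1 (b - 1))) (x : ℤ) : ℤ :=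
  if IsStart (d : ℤ) (cyc π) x then rank a b π (cyc π x) else 0

section Invariant

variable {a b d : ℕ} {π : Finpartition (Finset.Icc 1 (b - 1))}

/-- The ranks of the blocks of an invariant partition are invariant. -/
theorem rank_cyc_add (ha : 0 < a) (hab : a < b) (hcop : Nat.Coprime a b) (hdn : d ∣ b - 1)
    (hπ : π ∈ NC a b) (hinv : IsRotInvariant d π) (x : ℤ) :
    rank a b π (cyc π (x + d)) = rank a b π (cyc π x) := by
  have hn : 0 < b - 1 := by omega
  have hV := valid_of_mem_NC ha hab hcop hπ
  -- The ranks of the rotated blocks are again valid weights for `π`, and valid weights are forced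
  -- to be the ranks.
  have hV' := (hV.shift (by omega) d).congr (κ' := cyc π)
    (ω' := fun B => rank a b π (rotBlock (b - 1) d B))
    (fun x y => (hinv.cyc_eq_iff hn hdn x y).symm) fun x => by rw [hinv.rotBlock_cyc hn]
  rw [(hV'.mem_NC ha hab hcop).2 _ (cyc_mem_parts hn x), hinv.rotBlock_cyc hn]

/-- The standing assumptions on `a`, `b` and `d`. -/
structure Setting (a b d : ℕ) : Prop where
  a_pos : 0 < a
  a_lt : a < b
  coprime : a.Coprime b
  d_pos : 0 < d
  dvd : d ∣ b - 1
  d_lt : d < b - 1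

theorem Setting.two_mul_le (h : Setting a b d) : 2 * d ≤ b - 1 := by
  obtain ⟨q, hq⟩ := h.dvd
  have h1 := h.d_lt
  rw [hq] at h1 ⊢
  have : 1 < q := by
    by_contra hc
    have := Nat.mul_le_mul_left d (not_lt.1 hc)
    omega
  rw [mul_comm]
  exact Nat.mul_le_mul_left d this

theorem starts_seqOf (h : Setting a b d) (hπ : π ∈ NC a b) (hinv : IsRotInvariant d π) :
    Starts ((b - 1 : ℕ) : ℤ) (cyc π) (IsStart (d : ℤ) (cyc π)) := by
  have hV := valid_of_mem_NC h.a_pos h.a_lt h.coprime hπ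
  have hd := h.d_pos
  have := h.two_mul_le
  exact starts_isStart (by omega) hV.per hV.noncross (hinv.cyc_eq_iff (by omega) h.dvd)

theorem free_seqOf (h : Setting a b d) (hπ : π ∈ NC a b) (x y : ℤ)
    (hx : ∀ z, cyc π z = cyc π x → ¬ IsStart (d : ℤ) (cyc π) z)
    (hy : ∀ z, cyc π z = cyc π y → ¬ IsStart (d : ℤ) (cyc π) z) : cyc π x = cyc π y := by
  have hV := valid_of_mem_NC h.a_pos h.a_lt h.coprime hπ
  have hd := h.d_pos
  have := h.two_mul_le
  exact eq_of_no_isStart (by omega) (by omega) hV.per hV.noncross x y hx hy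

theorem seqOf_pos_iff (h : Setting a b d) (hπ : π ∈ NC a b) (x : ℤ) :
    0 < seqOf a b d π x ↔ IsStart (d : ℤ) (cyc π) x := by
  have hV := valid_of_mem_NC h.a_pos h.a_lt h.coprime hπ
  rw [seqOf]
  split_ifs with hx
  · exact iff_of_true (hV.pos x) hx
  · exact iff_of_false (lt_irrefl _) hx

theorem seqOf_nonneg (h : Setting a b d) (hπ : π ∈ NC a b) (x : ℤ) : 0 ≤ seqOf a b d π x := by
  have hV := valid_of_mem_NC h.a_pos h.a_lt h.coprime hπ
  rw [seqOf]
  split_ifs with hx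
  · exact (hV.pos x).le
  · exact le_rfl

theorem seqOf_add (h : Setting a b d) (hπ : π ∈ NC a b) (hinv : IsRotInvariant d π) (x : ℤ) :
    seqOf a b d π (x + d) = seqOf a b d π x := by
  have hd := h.d_pos
  have := h.two_mul_le
  rw [seqOf, seqOf, IsStart.add_iff (hinv.cyc_eq_iff (by omega) h.dvd),
    rank_cyc_add h.a_pos h.a_lt h.coprime h.dvd hπ hinv]

theorem sum_seqOf_le (h : Setting a b d) (hπ : π ∈ NC a b) (hinv : IsRotInvariant d π) :
    ∑ x ∈ Finset.Ioc (0 : ℤ) ((b - 1 : ℕ) : ℤ), seqOf a b d π x ≤ a :=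
  (valid_of_mem_NC h.a_pos h.a_lt h.coprime hπ).sum_starts_le (starts_seqOf h hπ hinv) fun _ => rfl

theorem seqOf_le (h : Setting a b d) (hπ : π ∈ NC a b) (hinv : IsRotInvariant d π) (x : ℤ) :
    seqOf a b d π x ≤ a := by
  have hn : 0 < b - 1 := by have := h.a_pos; have := h.a_lt; omega
  have hl := Finset.mem_Icc.1 (label_mem (n := b - 1) hn x)
  have hx : seqOf a b d π (label (b - 1) x) = seqOf a b d π x := by
    have hc : cyc π (label (b - 1) x) = cyc π x := cyc_natCast (label_mem hn x)
    have hS := starts_seqOf h hπ hinv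
    obtain ⟨-, -, k, hk⟩ := label_spec hn x
    have hst : IsStart (d : ℤ) (cyc π) (label (b - 1) x) ↔ IsStart (d : ℤ) (cyc π) x := by
      nth_rewrite 2 [hk]
      exact (periodic_mul hS.per k _).symm
    rw [seqOf, seqOf, hc, hst]
  rw [← hx]
  refine le_trans ?_ (sum_seqOf_le h hπ hinv)
  exact Finset.single_le_sum (f := seqOf a b d π) (fun y _ => seqOf_nonneg h hπ y)
    (Finset.mem_Ioc.2 ⟨by omega, by omega⟩)

theorem fibres_seqOf (h : Setting a b d) (hπ : π ∈ NC a b) (hinv : IsRotInvariant d π)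
    {G : ℤ → ℤ} (hG : ∀ x, G x = G (x - 1) + (((b - 1 : ℕ) : ℤ) + 1) * seqOf a b d π x - a) :
    Fibres ((b - 1 : ℕ) : ℤ) (cyc π) (IsStart (d : ℤ) (cyc π)) G := by
  have hV := valid_of_mem_NC h.a_pos h.a_lt h.coprime hπ
  have hd := h.d_pos
  have := h.two_mul_le
  refine hV.fibres (by omega) (starts_seqOf h hπ hinv) ?_ (t := seqOf a b d π) (fun x => rfl) hG
  intro l l' z h1 h2 h3 h4 h5
  exact exists_isStart_gap (by omega) hV.noncross l l' z h1 h2 h3 h4 h5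

theorem eq_of_cyc {n : ℕ} {π π' : Finpartition (Finset.Icc 1 n)}
    (h : ∀ x y, cyc π x = cyc π y ↔ cyc π' x = cyc π' y) : π = π' :=
  eq_of_part_eq_iff fun k hk l hl => by
    rw [← cyc_natCast hk, ← cyc_natCast hl, ← cyc_natCast hk, ← cyc_natCast hl, h]

/-- An invariant partition is determined by its sequence. -/
theorem eq_of_seqOf_eq (h : Setting a b d) {π' : Finpartition (Finset.Icc 1 (b - 1))}
    (hπ : π ∈ NC a b) (hinv : IsRotInvariant d π) (hπ' : π' ∈ NC a b)
    (hinv' : IsRotInvariant d π') (he : seqOf a b d π = seqOf a b d π') : π = π' := by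
  have hn : 0 < b - 1 := by have := h.a_pos; have := h.a_lt; omega
  -- The potential and the set of starts depend on the sequence only, so they serve both partitions.
  obtain ⟨G, -, hG⟩ := exists_potential (a : ℤ) (((b - 1 : ℕ) : ℤ) + 1) (seqOf a b d π)
  have hF := fibres_seqOf h hπ hinv hG
  have hF' := fibres_seqOf h hπ' hinv' (G := G) (by rw [← he]; exact hG)
  have hP : IsStart (d : ℤ) (cyc π) = IsStart (d : ℤ) (cyc π') := by
    funext x
    rw [eq_iff_iff, ← seqOf_pos_iff h hπ, ← seqOf_pos_iff h hπ', he]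
  have hS := starts_seqOf h hπ hinv
  have hS' := starts_seqOf h hπ' hinv'
  have hfree := free_seqOf h hπ
  have hfree' := free_seqOf h hπ'
  rw [← hP] at hF' hS' hfree'
  refine eq_of_cyc fun x y => ⟨fun hxy => ?_, fun hxy => ?_⟩
  · exact hF.class_eq (by omega) cyc_add hS cyc_add hS' hF' hfree' hxy
  · exact hF'.class_eq (by omega) cyc_add hS' cyc_add hS hF hfree hxy

theorem rotOrbit_cyc (h : Setting a b d) (hinv : IsRotInvariant d π) (x : ℤ) :
    rotOrbit (b - 1) d (cyc π x) = {C | ∃ k : ℤ, C = cyc π (x + k * d)} := by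
  have hn : 0 < b - 1 := by have := h.a_pos; have := h.a_lt; omega
  ext C
  rw [rotOrbit, Set.mem_ofPred_eq, Set.mem_ofPred_eq]
  constructor
  · rintro ⟨k, rfl⟩
    exact ⟨k, by rw [hinv.rotBlock_mul_cyc hn, mul_comm]⟩
  · rintro ⟨k, rfl⟩
    obtain ⟨q, hq⟩ := h.dvd
    have hq0 : 0 < q := Nat.pos_of_ne_zero fun h0 => by rw [h0] at hq; omega
    -- Adding `|k|` full turns, that is `|k| * q` translations by `d`, makes the exponent
    -- nonnegative.
    have h1 : 0 ≤ k + |k| * q := by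
      have := neg_abs_le k
      have := mul_le_mul_of_nonneg_left (show (1 : ℤ) ≤ q by omega) (abs_nonneg k)
      omega
    refine ⟨(k + |k| * q).toNat, ?_⟩
    rw [hinv.rotBlock_mul_cyc hn, Int.toNat_of_nonneg h1, ← cyc_add_mul (x + k * d) |k|]
    congr 1
    rw [show ((b - 1 : ℕ) : ℤ) = d * q by exact_mod_cast hq]
    ring

/-- The number of orbits of non-central blocks of rank `i` is the number of terms `i`. -/
theorem ncard_orbitsOfRank (h : Setting a b d) (hπ : π ∈ NC a b) (hinv : IsRotInvariant d π)
    {i : ℕ} (hi : 1 ≤ i) : (orbitsOfRank a b d π i).ncard =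
      (Finset.univ.filter fun j : Fin d => (seqOf a b d π ((j : ℤ) + 1)).toNat = i).card := by
  have hn : 0 < b - 1 := by have := h.a_pos; have := h.a_lt; omega
  have hd := h.d_pos
  have hκ := hinv.cyc_eq_iff hn h.dvd
  have hS := starts_seqOf h hπ hinv
  have hcent : ∀ x, IsCentral (b - 1) d (cyc π x) ↔ cyc π (x + d) = cyc π x := fun x => by
    rw [IsCentral, hinv.rotBlock_cyc hn]
  have hseq : ∀ x, seqOf a b d π x = i ↔
      IsStart (d : ℤ) (cyc π) x ∧ rank a b π (cyc π x) = i := by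
    intro x
    rw [seqOf]
    split_ifs with hx
    · simp [hx]
    · simp only [hx, false_and, iff_false]; omega
  have himg : orbitsOfRank a b d π i = (fun j : Fin d => rotOrbit (b - 1) d (cyc π ((j : ℤ) + 1))) ''
      (Finset.univ.filter fun j : Fin d => (seqOf a b d π ((j : ℤ) + 1)).toNat = i) := by
    ext O
    rw [Set.mem_image, orbitsOfRank, Set.mem_ofPred_eq]
    constructor
    · rintro ⟨B, hB, hBc, hBi, rfl⟩
      obtain ⟨x, hx⟩ : ∃ x : ℤ, cyc π x = B := by
        obtain ⟨k, hk⟩ := π.nonempty_of_mem_parts hB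
        exact ⟨k, cyc_of_mem hB hk⟩
      -- The translate by `d` of a startless block is startless, and there is at most one such
      -- block, so it would be central.
      obtain ⟨p, hp1, hp2⟩ : ∃ p, cyc π p = B ∧ IsStart (d : ℤ) (cyc π) p := by
        by_contra hc
        push Not at hc
        rw [← hx] at hc hBc
        refine hBc ((hcent x).2 (free_seqOf h hπ _ _ (fun z hz hzs => ?_) fun z hz => hc z hz))
        refine hc (z - d) ((hκ _ _).2 (by rwa [sub_add_cancel])) ?_
        rw [← IsStart.add_iff hκ, sub_add_cancel]; exact hzs
      obtain ⟨h1, h2, k, hk⟩ := label_spec hd p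
      have hjp : (((⟨label d p - 1, by omega⟩ : Fin d) : ℕ) : ℤ) + 1 = label d p := by
        simp only; omega
      refine ⟨⟨label d p - 1, by omega⟩, ?_, ?_⟩
      · rw [Finset.mem_coe, Finset.mem_filter]
        refine ⟨Finset.mem_univ _, ?_⟩
        rw [hjp]
        have h3 : seqOf a b d π (label d p) = seqOf a b d π p := by
          nth_rewrite 2 [hk]
          exact ((periodic_mul (Q := fun y => seqOf a b d π y = seqOf a b d π (label d p)) (n := d)
            (fun y => by rw [seqOf_add h hπ hinv]) k _).2 rfl).symm
        rw [h3, (hseq p).2 ⟨hp2, by rw [hp1, hBi]⟩, Int.toNat_natCast]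
      · simp only
        rw [hjp, ← hp1, rotOrbit_cyc h hinv, rotOrbit_cyc h hinv]
        ext C
        rw [Set.mem_ofPred_eq, Set.mem_ofPred_eq]
        constructor
        · rintro ⟨l, rfl⟩
          exact ⟨l - k, by congr 1; nth_rewrite 2 [hk]; ring⟩
        · rintro ⟨l, rfl⟩
          exact ⟨l + k, by congr 1; nth_rewrite 1 [hk]; ring⟩
    · rintro ⟨j, hj, rfl⟩
      rw [Finset.mem_coe, Finset.mem_filter] at hj
      obtain ⟨h1, h2⟩ := (hseq ((j : ℤ) + 1)).1 (by omega)
      refine ⟨_, cyc_mem_parts hn _, fun hc => ?_, h2, rfl⟩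
      rw [hcent] at hc
      refine h1 ((j : ℤ) + 1 - d) le_rfl (by omega) ((hκ _ _).2 ?_)
      rw [sub_add_cancel, hc]
  rw [himg, Set.InjOn.ncard_image, Set.ncard_coe_finset]
  -- Two starts in one orbit become, after a translation by a multiple of `d`, starts of one class.
  -- They agree modulo `n`, hence modulo `d`, and both lie in the same period.
  intro j hj j' hj' he
  rw [Finset.mem_coe, Finset.mem_filter] at hj hj'
  obtain ⟨h1, h2⟩ := (hseq ((j : ℤ) + 1)).1 (by omega)
  obtain ⟨h3, h4⟩ := (hseq ((j' : ℤ) + 1)).1 (by omega)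
  simp only at he
  rw [rotOrbit_cyc h hinv, rotOrbit_cyc h hinv] at he
  have hmem : cyc π ((j : ℤ) + 1) ∈ {C | ∃ k : ℤ, C = cyc π ((j' : ℤ) + 1 + k * d)} := by
    rw [← he]; exact ⟨0, by simp⟩
  obtain ⟨k, hk⟩ := hmem
  have h5 : IsStart (d : ℤ) (cyc π) ((j' : ℤ) + 1 + k * d) :=
    (periodic_mul (IsStart.add_iff hκ) k _).2 h3
  obtain ⟨l, hl⟩ := hS.eq_add_mul (by omega) cyc_add h1 h5 hk
  obtain ⟨q, hq⟩ := h.dvd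
  have h6 : (j' : ℤ) = j + (l * q - k) * d := by
    rw [hq] at hl; push_cast at hl; linarith
  have hj1 := j.2
  have hj2 := j'.2
  have h7 : l * q - k = 0 := by
    rcases lt_trichotomy (l * q - k) 0 with h | h | h
    · have := mul_le_mul_of_nonneg_right (show l * q - k ≤ -1 by omega) (show (0 : ℤ) ≤ d by omega)
      omega
    · exact h
    · have := mul_le_mul_of_nonneg_right (show 1 ≤ l * q - k by omega) (show (0 : ℤ) ≤ d by omega)
      omega
  rw [h7] at h6
  ext; omega

theorem sum_period {d q : ℕ} {s : ℤ → ℤ} (hs : ∀ x, s (x + d) = s x) :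
    ∑ x ∈ Finset.Ioc (0 : ℤ) ((d * q : ℕ) : ℤ), s x = q * ∑ j : Fin d, s ((j : ℤ) + 1) := by
  -- With these constants the potential is the running sum of `s`, and its drift over `q` periods is
  -- `q` times that over one.
  obtain ⟨G, hG0, hG⟩ := exists_potential 0 1 s
  have h1 := potential_sub hG (show (0 : ℤ) ≤ ((d * q : ℕ) : ℤ) by omega)
  have h2 := potential_sub hG (show (0 : ℤ) ≤ d by omega)
  have h3 := potential_add_mul hG hs 0 q
  rw [zero_add] at h3
  have h4 : ∑ x ∈ Finset.Ioc (0 : ℤ) d, s x = ∑ j : Fin d, s ((j : ℤ) + 1) := by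
    rw [Fin.sum_univ_eq_sum_range (fun j : ℕ => s ((j : ℤ) + 1))]
    refine Finset.sum_bij' (fun x _ => (x - 1).toNat) (fun j _ => (j : ℤ) + 1) ?_ ?_ ?_ ?_ ?_
    · intro x hx; rw [Finset.mem_Ioc] at hx; rw [Finset.mem_range]; omega
    · intro j hj; rw [Finset.mem_range] at hj; rw [Finset.mem_Ioc]; omega
    · intro x hx; rw [Finset.mem_Ioc] at hx; omega
    · intro j _; omega
    · intro x hx; rw [Finset.mem_Ioc] at hx; congr 1; omega
  rw [← h4]
  rw [show (q : ℤ) * d = ((d * q : ℕ) : ℤ) by push_cast; ring] at h3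
  rw [h3, hG0] at h1
  rw [hG0] at h2
  simp only [sub_zero, one_mul, zero_mul, zero_add] at h1 h2
  rw [← h1, ← h2]

theorem sum_eq_sum_fibres {d a : ℕ} {f : Fin d → ℕ} (hf : ∀ j, f j ≤ a) :
    ∑ j, f j = ∑ i ∈ Finset.Icc 1 a, i * (Finset.univ.filter fun j => f j = i).card := by
  have h1 := Finset.sum_fiberwise_of_maps_to (s := (Finset.univ : Finset (Fin d)))
    (t := Finset.range (a + 1)) (g := f) (fun j _ => Finset.mem_range.2 (by have := hf j; omega)) f
  rw [← h1, Finset.sum_range_succ']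
  rw [Finset.sum_eq_zero (s := Finset.univ.filter fun j => f j = 0)
    (fun j hj => (Finset.mem_filter.1 hj).2), add_zero, Finset.range_eq_Ico,
    Finset.sum_Ico_add' (fun i => ∑ j with f j = i, f j) 0 a 1]
  refine Finset.sum_congr rfl fun i _ => ?_
  rw [Finset.sum_congr rfl fun j hj => (Finset.mem_filter.1 hj).2, Finset.sum_const, smul_eq_mul,
    mul_comm]

/-- Every sequence of small sum comes from an invariant partition. -/
theorem exists_seqOf_eq (h : Setting a b d) {f : Fin d → ℕ}
    (hf : (b - 1) / d * ∑ j, f j ≤ a) : ∃ π, π ∈ NC a b ∧ IsRotInvariant d π ∧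
      ∀ j : Fin d, seqOf a b d π ((j : ℤ) + 1) = f j := by
  have ha := h.a_pos
  have hab := h.a_lt
  have hn : 0 < b - 1 := by omega
  have hd := h.d_pos
  set s : ℤ → ℤ := fun x => f ⟨label d x - 1, by have := label_spec hd x; omega⟩ with hs
  have hper : ∀ x, s (x + d) = s x := fun x => by simp only [hs, label_add]
  have hsj : ∀ j : Fin d, s ((j : ℤ) + 1) = f j := by
    intro j
    have : label d ((j : ℤ) + 1) = j + 1 := by
      exact_mod_cast label_natCast (n := d) (k := (j : ℕ) + 1)
        (Finset.mem_Icc.2 ⟨by omega, by have := j.2; omega⟩)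
    simp only [hs, this, Nat.add_sub_cancel]
  obtain ⟨G, -, hG⟩ := exists_potential (a : ℤ) (((b - 1 : ℕ) : ℤ) + 1) s
  have hP : PeriodicSeq a (b - 1) d s G := by
    refine ⟨ha, by omega, ?_, hd, h.dvd, h.two_mul_le, fun x => Int.natCast_nonneg _, hper, hG, ?_⟩
    · rw [Nat.sub_add_cancel (by omega)]; exact h.coprime
    · have h1 := sum_period (q := (b - 1) / d) hper
      rw [Nat.mul_div_cancel' h.dvd] at h1
      rw [h1, Finset.sum_congr rfl fun j _ => hsj j]
      exact_mod_cast hf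
  obtain ⟨π, ω, hV, hκ, hsω⟩ := hP.exists_partition
  obtain ⟨hNC, hrank⟩ := hV.mem_NC ha hab h.coprime
  refine ⟨π, hNC, isRotInvariant_of_iff hn hκ, fun j => ?_⟩
  rw [← hsj, hsω, seqOf, hrank _ (cyc_mem_parts hn _)]

end Invariant

end RationalNC

/-! ### The bijection with words of length `d` -/

theorem mainTheorem10 (a b d : ℕ) (ha : 0 < a) (hab : a < b) (hcop : Nat.Coprime a b)
    (hd : 1 ≤ d) (hdvd : d ∣ b - 1) (hdlt : d < b - 1) (m : ℕ → ℕ)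
    (hm : (b - 1) / d * ∑ i ∈ Finset.Icc 1 a, i * m i ≤ a) :
    ∑ i ∈ Finset.Icc 1 a, m i ≤ d ∧
    {π : Finpartition (Finset.Icc 1 (b - 1)) |
        π ∈ RationalNC.NC a b ∧ RationalNC.IsRotInvariant d π ∧
        ∀ i ∈ Finset.Icc 1 a, (RationalNC.orbitsOfRank a b d π i).ncard = m i}.ncard =
      d ! / ((∏ i ∈ Finset.Icc 1 a, (m i)!) * (d - ∑ i ∈ Finset.Icc 1 a, m i)!) := by
  have h : RationalNC.Setting a b d := ⟨ha, hab, hcop, hd, hdvd, hdlt⟩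
  have hmd : ∑ i ∈ Finset.Icc 1 a, m i ≤ d := by
    have h1 : ∑ i ∈ Finset.Icc 1 a, m i ≤ ∑ i ∈ Finset.Icc 1 a, i * m i :=
      Finset.sum_le_sum fun i hi => Nat.le_mul_of_pos_left _ (Finset.mem_Icc.1 hi).1
    by_contra hc
    -- `(b - 1) / d * (d + 1) = b - 1 + (b - 1) / d` exceeds `a`, as `a ≤ b - 1`.
    have h2 := Nat.mul_le_mul_left ((b - 1) / d)
      (show d + 1 ≤ _ from lt_of_lt_of_le (not_le.1 hc) h1)
    rw [mul_add, Nat.div_mul_cancel hdvd] at h2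
    have h3 : 0 < (b - 1) / d := Nat.div_pos hdlt.le hd
    omega
  refine ⟨hmd, ?_⟩
  rw [← RationalNC.ncard_sequences a d m hmd]
  have hseq : ∀ π, π ∈ RationalNC.NC a b → RationalNC.IsRotInvariant d π → ∀ x,
      RationalNC.seqOf a b d π x =
        (RationalNC.seqOf a b d π ((((RationalNC.label d x - 1 : ℕ) : ℤ)) + 1)).toNat := by
    intro π hπ hinv x
    obtain ⟨h1, -, k, hk⟩ := RationalNC.label_spec hd x
    rw [Int.toNat_of_nonneg (RationalNC.seqOf_nonneg h hπ _),
      show (((RationalNC.label d x - 1 : ℕ) : ℤ)) + 1 = RationalNC.label d x by omega]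
    nth_rewrite 1 [hk]
    exact (RationalNC.periodic_mul (n := d)
      (Q := fun y => RationalNC.seqOf a b d π y = RationalNC.seqOf a b d π (RationalNC.label d x))
      (fun y => by rw [RationalNC.seqOf_add h hπ hinv]) k _).2 rfl
  -- A partition is sent to one period of its sequence. Surjectivity uses that the sum of a word
  -- depends only on its multiplicities, so that `hm` bounds it.
  refine Set.ncard_congr (fun π _ j => (RationalNC.seqOf a b d π ((j : ℤ) + 1)).toNat) ?_ ?_ ?_
  · rintro π ⟨hπ, hinv, hcard⟩
    refine ⟨fun j => ?_, fun i hi => ?_⟩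
    · have := RationalNC.seqOf_le h hπ hinv ((j : ℤ) + 1)
      simp only
      omega
    · rw [← hcard i hi, RationalNC.ncard_orbitsOfRank h hπ hinv (Finset.mem_Icc.1 hi).1]
  · rintro π π' ⟨hπ, hinv, -⟩ ⟨hπ', hinv', -⟩ he
    refine RationalNC.eq_of_seqOf_eq h hπ hinv hπ' hinv' (funext fun x => ?_)
    rw [hseq π hπ hinv x, hseq π' hπ' hinv' x]
    have h1 := (RationalNC.label_spec hd x).2.1
    exact_mod_cast congrFun he ⟨RationalNC.label d x - 1, by omega⟩
  · rintro f ⟨hf1, hf2⟩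
    obtain ⟨π, hπ, hinv, hπf⟩ := RationalNC.exists_seqOf_eq h (f := f) (by
      rw [RationalNC.sum_eq_sum_fibres hf1, Finset.sum_congr rfl fun i hi => by rw [hf2 i hi]]
      exact hm)
    refine ⟨π, ⟨hπ, hinv, fun i hi => ?_⟩, ?_⟩
    · rw [RationalNC.ncard_orbitsOfRank h hπ hinv (Finset.mem_Icc.1 hi).1, ← hf2 i hi]
      simp only [hπf, Int.toNat_natCast]
    · funext j
      rw [hπf, Int.toNat_natCast]
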